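/- **Setting.** Let $V,W\subset\mathbb R^2$ be two transversal lines through the origin, neither parallel to a coordinate axis, let $Y=\{0\}\times\mathbb R$, and let $\Pi_V$ be the projection to $V$ parallel to $W$ and $\Pi_Y$ the projection to $Y$ parallel to $V$. Let $\Omega\subset Y\cong\mathbb R$ be a half open interval (of either kind) with lower end point $t$ and length $\ell>0$ (the window). The one-dimensional tiling $\mathcal T$ of $V\cong\mathbb R$ with vertex set $\Pi_V(\mathbb Z^2\cap(V+\Omega))$ is said to have an interval projection structure, with tiling space $V$ and window space $W$. Assume that $\mathcal T$ is nonperiodic (no nonzero translation preserves the vertex set). A substitution rule $\sigma$ consists of a finite protoset of labelled intervals (intervals of equal length may carry different labels), an inflation factor $\lambda>1$, and, for each prototile $T$, a word of adjacent prototiles exactly covering the inflated prototile $\lambda T$. It acts on patches and tilings by inflation by $\lambda$ and replacement. $\mathcal T$ *admits* $\sigma$ if its tiles can be labelled by the prototiles of $\sigma$ (respecting lengths, all prototiles occurring) so that for every $k\in\mathbb N$ there is a labelled tiling $\mathcal T'$ locally isomorphic to the labelled tiling $\mathcal T$ (each finite patch of one occurs in the other up to translation) with $\sigma^k\mathcal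 T'=\mathcal T$. If $\pi$ forgets labels, $\sigma$ and $\sigma'$ are *patch equivalent* if for every prototile $T$ of $\sigma$ and every $k$ there is a prototile $T'$ of $\sigma'$ with $\pi(\sigma^kT)=\pi(\sigma'^kT')$, and conversely. An integer matrix $M$ is *primitive* if some power of $M$ has only nonzero entries. An eigenvalue is expanding if its absolute value is $>1$, contracting if it is $<1$. **Theorem.** 1. $\mathcal T$ admits a substitution rule if and only if there is a primitive $M\in GL(2,\mathbb Z)$ for which $V$ is the eigenspace of an expanding eigenvalue $\lambda$ and $W$ is the eigenspace of a contracting eigenvalue, and $\ell\in\mathbb Q(\lambda)$. 2. For $M$ as in 1 with $\lambda>0$, and $s\in\mathbb Q^2$, put $\overline\Omega_{s}=\Pi_Y(M\Omega_0+s)+t$, where $\Omega_0\subset Y$ is a half open interval with end points $0,\ell$. Say that a substitution rule $\sigma$ admitted by $\mathcal T$ is *associated* to $(M,s)$ if its inflation factor is $\lambda$, the closure of $\overline\Omega_{s}$ is contained in the closure of $\Omega$, and for every labelling of $\mathcal T$ as above and every labelled tiling $\mathcal T'$ locally isomorphic to $\mathcal T$ with $\sigma\mathcal T'=\mathcal T$,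 the vertex set of $\lambda\mathcal T'$ is $\Pi_V(\mathbb Z^2\cap(V+\overline\Omega_{s}))$ for one of the two choices of $\Omega_0$ as $[0,\ell)$ or $(0,\ell]$. Then every substitution rule admitted by $\mathcal T$ is associated to some such $(M,s)$. Conversely, whenever $M$ is as in 1 with $\lambda>0$, $\ell\in\mathbb Q(\lambda)$, $s\in\mathbb Q^2$, and the closure of $\overline\Omega_{s}$ is contained in the closure of $\Omega$, there is a substitution rule admitted by $\mathcal T$ that is associated to $(M,s)$. 3. Substitution rules admitted by $\mathcal T$ that are associated to different $s$ (with the same or different $M$) are not patch equivalent. 4. If $\mathcal T$ admits a substitution rule, then the set of patch equivalence classes of substitution rules admitted by $\mathcal T$ is countably infinite. -/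

import Mathlib

open scoped MatrixGroups

noncomputable section

namespace IntervalProjection

/-! ### Labelled protosets, substitution rules and labelled tilings of the real line -/

/-- A (vertex hierarchic) substitution rule on a finite labelled protoset: the prototiles are
intervals of lengths `len i`, with labels `i : Fin card`. Every prototile is inflated by the uniform
factor `factor > 1` and the inflated tile is replaced by the word `repl i` of adjacent uninflated
tiles, read from left to right, which covers the inflated tile exactly. -/
structure SubstitutionRule where
  card : ℕ
  len : Fin card → ℝ
  len_pos : ∀ i, 0 < len i
  factor : ℝ
  one_lt_factor : 1 < factor
  repl : Fin card → List (Fin card)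
  covers : ∀ i, ((repl i).map len).sum = factor * len i

/-- The tiles of the word `L`, laid down side by side to the right of the point `x`. A labelled tile
is a pair consisting of its left end point and its label. -/
def place {n : ℕ} (len : Fin n → ℝ) : ℝ → List (Fin n) → Set (ℝ × Fin n)
  | _, [] => ∅
  | x, i :: L => insert (x, i) (place len (x + len i) L)

/-- A collection of translated prototiles is a tiling of the line if the tiles cover the line and
distinct tiles overlap at most on their boundaries. -/
def IsTiling {n : ℕ} (len : Fin n → ℝ) (T : Set (ℝ × Fin n)) : Prop :=
  (∀ x : ℝ, ∃ p ∈ T, x ∈ Set.Icc p.1 (p.1 + len p.2)) ∧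
  ∀ p ∈ T, ∀ q ∈ T, p ≠ q →
    Disjoint (Set.Ioo p.1 (p.1 + len p.2)) (Set.Ioo q.1 (q.1 + len q.2))

/-- The vertex set of a tiling (each vertex is the left end point of exactly one tile). -/
def vert {n : ℕ} (T : Set (ℝ × Fin n)) : Set ℝ := {x | ∃ i, (x, i) ∈ T}

/-- Every finite patch of `T` appears, up to translation, in `T'`. -/
def PatchesAppear {n : ℕ} (T T' : Set (ℝ × Fin n)) : Prop :=
  ∀ F : Set (ℝ × Fin n), F.Finite → F ⊆ T → ∃ x : ℝ, ∀ p ∈ F, (p.1 + x, p.2) ∈ T'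

/-- Local isomorphism of labelled tilings. -/
def LocallyIsomorphic {n : ℕ} (T T' : Set (ℝ × Fin n)) : Prop :=
  PatchesAppear T T' ∧ PatchesAppear T' T

namespace SubstitutionRule

/-- The action on labelled tilings: inflate by the factor, then replace every inflated tile. -/
def apply (σ : SubstitutionRule) (T : Set (ℝ × Fin σ.card)) : Set (ℝ × Fin σ.card) :=
  ⋃ p ∈ T, place σ.len (σ.factor * p.1) (σ.repl p.2)

/-- The labelled patch `σ ^ k T` obtained from the prototile `i`, as a word. -/
def patch (σ : SubstitutionRule) (k : ℕ) (i : Fin σ.card) : List (Fin σ.card) :=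
  (fun L : List (Fin σ.card) => L.flatMap σ.repl)^[k] [i]

/-- The shape `π (σ ^ k T)` of that patch: the sequence of lengths of its tiles, labels forgotten. -/
def shape (σ : SubstitutionRule) (k : ℕ) (i : Fin σ.card) : List ℝ := (σ.patch k i).map σ.len

/-- Patch equivalence of substitution rules. -/
def PatchEquivalent (σ σ' : SubstitutionRule) : Prop :=
  (∀ i k, ∃ j, σ.shape k i = σ'.shape k j) ∧ (∀ j k, ∃ i, σ'.shape k j = σ.shape k i)

/-- `T` is a substitution tiling for `σ`: it has a locally isomorphic `k`-th predecessor for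
every `k`. -/
def IsSubstitutionTiling (σ : SubstitutionRule) (T : Set (ℝ × Fin σ.card)) : Prop :=
  ∀ k : ℕ, ∃ T' : Set (ℝ × Fin σ.card),
    IsTiling σ.len T' ∧ LocallyIsomorphic T' T ∧ σ.apply^[k] T' = T

/-- `T` is a labelling of the geometric tiling with vertex set `D` by the prototiles of `σ`, in
which all prototiles occur, and with this labelling it is a substitution tiling for `σ`. -/
def IsLabelling (σ : SubstitutionRule) (D : Set ℝ) (T : Set (ℝ × Fin σ.card)) : Prop :=
  IsTiling σ.len T ∧ vert T = D ∧ (∀ i, ∃ x, (x, i) ∈ T) ∧ σ.IsSubstitutionTiling T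

/-- `σ` is a substitution rule for the geometric tiling with vertex set `D`. -/
def IsRuleOf (σ : SubstitutionRule) (D : Set ℝ) : Prop := ∃ T, σ.IsLabelling D T

/-- Patch equivalence is an equivalence relation. -/
instance patchSetoid : Setoid SubstitutionRule where
  r := PatchEquivalent
  iseqv :=
    { refl := fun _ => ⟨fun i _ => ⟨i, rfl⟩, fun i _ => ⟨i, rfl⟩⟩
      symm := fun h => ⟨h.2, h.1⟩
      trans := fun {a b c} h h' =>
        ⟨fun i k => by
          obtain ⟨j, hj⟩ := h.1 i k
          obtain ⟨m, hm⟩ := h'.1 j k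
          exact ⟨m, hj.trans hm⟩,
         fun i k => by
          obtain ⟨j, hj⟩ := h'.2 i k
          obtain ⟨m, hm⟩ := h.2 j k
          exact ⟨m, hj.trans hm⟩⟩ }

end SubstitutionRule

/-! ### Tilings with an interval projection structure -/

/-- The Euclidean plane. -/
abbrev Plane := EuclideanSpace ℝ (Fin 2)

/-- The point of the vertical axis `Y` with ordinate `y`. -/
def yPoint (y : ℝ) : Plane := !₂[0, y]

/-- The points of the lattice `ℤ²`. -/
def intPoint (z : Fin 2 → ℤ) : Plane := !₂[(z 0 : ℝ), (z 1 : ℝ)]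

/-- The points of `ℚ²`. -/
def ratPoint (s : Fin 2 → ℚ) : Plane := !₂[(s 0 : ℝ), (s 1 : ℝ)]

/-- The linear endomorphism of the plane given by an integer matrix. -/
def matEnd (M : Matrix (Fin 2) (Fin 2) ℤ) : Module.End ℝ Plane :=
  Matrix.toEuclideanLin (M.map (Int.cast : ℤ → ℝ))

/-- The tiling space `V` and the window space `W`: two transversal lines in the plane, not parallel
to the coordinate axes. The unit vector `v` identifies `V` isometrically with `ℝ`. -/
structure Spaces where
  V : Submodule ℝ Plane
  W : Submodule ℝ Plane
  finrank_V : Module.finrank ℝ V = 1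
  finrank_W : Module.finrank ℝ W = 1
  transversal : IsCompl V W
  V_ne_horizontal : V ≠ Submodule.span ℝ {(!₂[1, 0] : Plane)}
  V_ne_vertical : V ≠ Submodule.span ℝ {(!₂[0, 1] : Plane)}
  W_ne_horizontal : W ≠ Submodule.span ℝ {(!₂[1, 0] : Plane)}
  W_ne_vertical : W ≠ Submodule.span ℝ {(!₂[0, 1] : Plane)}
  v : Plane
  v_mem : v ∈ V
  norm_v : ‖v‖ = 1

/-- The half open interval with end points `a` and `b`, closed on the left if `c` is `true` and
closed on the right otherwise. -/
def halfOpen (c : Bool) (a b : ℝ) : Set ℝ := if c = true then Set.Ico a b else Set.Ioc a b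

/-- A window: a half open interval of positive length in the vertical axis `Y`, of either kind. -/
structure Window where
  base : ℝ
  length : ℝ
  length_pos : 0 < length
  leftClosed : Bool

/-- The window as a subset of `Y`. -/
def Window.toSet (Ω : Window) : Set ℝ := halfOpen Ω.leftClosed Ω.base (Ω.base + Ω.length)

namespace Spaces

/-- The strip `V + S` over a subset `S` of the vertical axis `Y`. -/
def strip (P : Spaces) (S : Set ℝ) : Set Plane := {p | ∃ u ∈ P.V, ∃ y ∈ S, p = u + yPoint y}

/-- The set `Π_V (ℤ² ∩ (V + S))`, where `Π_V` is the projection to `V` parallel to `W`, and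
`V` is identified with `ℝ` through the unit vector `v`. For a window `S` this is the vertex set of
the tiling with an interval projection structure. -/
def vertices (P : Spaces) (S : Set ℝ) : Set ℝ :=
  {x | ∃ z : Fin 2 → ℤ, intPoint z ∈ P.strip S ∧ intPoint z - x • P.v ∈ P.W}

/-- The set `Π_Y (M S + s) + t` for a subset `S` of `Y`, where `Π_Y` is the projection to `Y`
parallel to `V`. -/
def subwindow (P : Spaces) (M : Matrix (Fin 2) (Fin 2) ℤ) (s : Fin 2 → ℚ) (t : ℝ) (S : Set ℝ) :
    Set ℝ :=
  {y | ∃ ω ∈ S, matEnd M (yPoint ω) + ratPoint s + yPoint t - yPoint y ∈ P.V}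

end Spaces

/-- A set of points of the line (the vertex set of a tiling) is nonperiodic if no nonzero
translation leaves it invariant. -/
def Nonperiodic (D : Set ℝ) : Prop := ∀ p : ℝ, (∀ x, x ∈ D ↔ x + p ∈ D) → p = 0

/-- A matrix is primitive if some power of it has only nonzero entries. -/
def IsPrimitiveMatrix (M : Matrix (Fin 2) (Fin 2) ℤ) : Prop := ∃ n : ℕ, ∀ i j, (M ^ n) i j ≠ 0

/-- `M` is a primitive matrix in `GL(2, ℤ)`, `V` is its expanding eigenspace, with eigenvalue
`lam`, and `W` is its contracting eigenspace. -/
def HasEigenspaces (P : Spaces) (M : GL (Fin 2) ℤ) (lam : ℝ) : Prop :=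
  IsPrimitiveMatrix M.val ∧ 1 < |lam| ∧ P.V = (matEnd M.val).eigenspace lam ∧
  ∃ mu : ℝ, |mu| < 1 ∧ P.W = (matEnd M.val).eigenspace mu

/-- The subwindow given by `M` and `s` lies in the window (as regards closed intervals). -/
def SubwindowFits (P : Spaces) (Ω : Window) (M : GL (Fin 2) ℤ) (s : Fin 2 → ℚ) : Prop :=
  P.subwindow M.val s Ω.base (Set.Icc 0 Ω.length) ⊆ Set.Icc Ω.base (Ω.base + Ω.length)

/-- `σ` is a substitution rule for the tiling with window `Ω`, associated to the subwindow
`Π_Y (M Ω₀ + s) + t`, where `t` is the base of `Ω` and `Ω₀` is the half open window of the same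
length and base `0`: the eigenvalue of `M` on `V` is the inflation factor, the subwindow lies in the
window, and for each labelled predecessor `T'` of the tiling under `σ` the vertices of the expansion
predecessor, the tiling `T'` inflated by the factor of `σ`, are the projections of the lattice
points in the strip over the subwindow. -/
def IsAssociated (P : Spaces) (Ω : Window) (σ : SubstitutionRule) (M : GL (Fin 2) ℤ)
    (s : Fin 2 → ℚ) : Prop :=
  σ.IsRuleOf (P.vertices Ω.toSet) ∧ HasEigenspaces P M σ.factor ∧ SubwindowFits P Ω M s ∧
  ∀ T T' : Set (ℝ × Fin σ.card), σ.IsLabelling (P.vertices Ω.toSet) T →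
    IsTiling σ.len T' → LocallyIsomorphic T' T → σ.apply T' = T →
    ∃ c : Bool, (fun x => σ.factor * x) '' vert T' =
      P.vertices (P.subwindow M.val s Ω.base (halfOpen c 0 Ω.length))

end IntervalProjection

end

namespace IntervalProjection

/-! ### Words of tiles -/

section Words

variable {n : ℕ} {len : Fin n → ℝ}

/-! The lattice carries two linear forms, `πForm` to `V` and `ρForm` to `Y`. Nonperiodicity forces
`V` to have irrational slope, so `ρForm` is injective with dense values, and a vertex has a
position: the height of its lattice point above the base of the window. The basic tool
(`PosNear.abs_sub_le`) is that long patterns pin positions. If two vertices see the same pattern far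
enough to the right, their positions are close, for otherwise some lattice vector stays in the
window from one and leaves it from the other.

Necessity. A copy of a pair of vertices in a predecessor inflates to a pair of vertices, and vectors
with `|ρ| < ℓ` generate the lattice, so inflation lifts to an integer matrix `M`. It multiplies `ρ`
by some `mu`, as a `π`-component would be unbounded (`exists_matrix`). Among one more vertices than
there are labels, two share a label in the `k`-th predecessor, hence give two copies of one
level-`k` patch. Their positions differ by at least a constant times `|mu| ^ k`, while linear
recurrence allows only a constant over `factor ^ k`. So `factor * |mu| ≤ 1`, and the nonzero integer
`det M = factor * mu` is a unit (`exists_hasEigenspaces`). The same pigeonhole excludes a rational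
slope of `W` (`not_isRuleOf_of_cyclic`).

Subwindows. A tiling locally isomorphic to a model set with half open window has a window of the
same length (`exists_window_of_transfer`), so passing from a predecessor to the tiling acts on
positions by `u ↦ r + mu * u`. Level-`k` patches occur at positions tending to the fixed point `r /
(1 - mu)` (`position_tendsto`). This point depends only on the patch class, and so does `mu`; hence
`r`, and with it `s`, is an invariant of the class, which also makes association independent of the
labelling. The extreme positions of each label solve a finite affine system of slope `mu`, and `0`
and `ℓ` are among them, so `r` and `ℓ` lie in `ℚ(lam)` (`shift_and_length_mem`), whose elements are
exactly the `ρ`-values of rational points.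

Construction. If the image of the window fits, a position is labelled by its comparisons with the
points `ρ f / q`, `|π f| ≤ K`, where `q` clears the denominators of `ℓ` and `r`. There are finitely
many labels. For suitable `K` a label determines the next vertex and also all labels along the
inflated tile (`map_congr`), so replacement words can be read off (`exists_rule_of_fits`).

Counting. A rule is encoded by lattice vectors and finite words, so there are countably many;
integral translations that fit give infinitely many inequivalent ones. -/

@[simp] lemma place_nil (x : ℝ) : place len x [] = ∅ := rfl

@[simp] lemma place_cons (x : ℝ) (i : Fin n) (L : List (Fin n)) :
    place len x (i :: L) = insert (x, i) (place len (x + len i) L) := rfl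

lemma place_append (x : ℝ) (L L' : List (Fin n)) :
    place len x (L ++ L') = place len x L ∪ place len (x + (L.map len).sum) L' := by
  induction L generalizing x with
  | nil => simp
  | cons i L ih => simp [ih, Set.insert_union, add_assoc]

lemma finite_place (x : ℝ) (L : List (Fin n)) : (place len x L).Finite := by
  induction L generalizing x with
  | nil => simp
  | cons i L ih => simpa using (ih _).insert (x, i)

lemma mem_place_add_iff (x a : ℝ) (L : List (Fin n)) (p : ℝ × Fin n) :
    (p.1 + a, p.2) ∈ place len (x + a) L ↔ p ∈ place len x L := by
  induction L generalizing x with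
  | nil => simp
  | cons i L ih =>
    have := ih (x + len i)
    rw [show x + len i + a = x + a + len i by ring] at this
    simp [this, Prod.ext_iff]

lemma place_subset_of_shift {T' : Set (ℝ × Fin n)} {x a : ℝ} {L : List (Fin n)}
    (h : ∀ p ∈ place len x L, (p.1 + a, p.2) ∈ T') : place len (x + a) L ⊆ T' := by
  intro p hp
  have := h (p.1 - a, p.2) (by rw [← mem_place_add_iff x a]; simpa using hp)
  simpa using this

/-- The distances of the left end points of the tiles of a word from its left end point. -/
def offsets : List ℝ → Set ℝ
  | [] => ∅
  | a :: l => insert 0 ((a + ·) '' offsets l)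

end Words

/-! ### Tilings -/

section Tilings

variable {n : ℕ} {len : Fin n → ℝ} {T : Set (ℝ × Fin n)}

lemma IsTiling.eq_of_overlap (hT : IsTiling len T) {p q : ℝ × Fin n} (hp : p ∈ T) (hq : q ∈ T)
    {z : ℝ} (h1 : p.1 < z) (h2 : z < p.1 + len p.2) (h3 : q.1 < z) (h4 : z < q.1 + len q.2) :
    p = q := by
  by_contra h
  exact Set.disjoint_left.1 (hT.2 p hp q hq h) ⟨h1, h2⟩ ⟨h3, h4⟩

lemma IsTiling.label_unique (hlen : ∀ i, 0 < len i) (hT : IsTiling len T) {x : ℝ} {i j : Fin n}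
    (hi : (x, i) ∈ T) (hj : (x, j) ∈ T) : i = j := by
  have h1 := hlen i
  have h2 := hlen j
  have h3 : 0 < min (len i) (len j) := lt_min h1 h2
  have h4 := min_le_left (len i) (len j)
  have h5 := min_le_right (len i) (len j)
  have := hT.eq_of_overlap hi hj (z := x + min (len i) (len j) / 2) (by simp only; linarith)
    (by simp only; linarith) (by simp only; linarith) (by simp only; linarith)
  exact (Prod.ext_iff.1 this).2

lemma IsTiling.le_of_lt (hlen : ∀ i, 0 < len i) (hT : IsTiling len T) {p q : ℝ × Fin n}
    (hp : p ∈ T) (hq : q ∈ T) (h : p.1 < q.1) : p.1 + len p.2 ≤ q.1 := by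
  by_contra! h'
  have h1 := hlen q.2
  have h3 : 0 < min (p.1 + len p.2 - q.1) (len q.2) := lt_min (by linarith) h1
  have h4 := min_le_left (p.1 + len p.2 - q.1) (len q.2)
  have h5 := min_le_right (p.1 + len p.2 - q.1) (len q.2)
  have := hT.eq_of_overlap hp hq (z := q.1 + min (p.1 + len p.2 - q.1) (len q.2) / 2)
    (by linarith) (by linarith) (by linarith) (by linarith)
  rw [this] at h
  exact lt_irrefl _ h

lemma exists_min_len [NeZero n] (hlen : ∀ i, 0 < len i) : ∃ m > 0, ∀ i, m ≤ len i := by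
  obtain ⟨i, -, hi⟩ := Finset.exists_min_image Finset.univ len ⟨0, Finset.mem_univ _⟩
  exact ⟨len i, hlen i, fun j => hi j (Finset.mem_univ _)⟩

lemma exists_min_len' (hlen : ∀ i, 0 < len i) : ∃ m > 0, ∀ i, m ≤ len i := by
  rcases n.eq_zero_or_pos with rfl | h
  · exact ⟨1, one_pos, fun i => i.elim0⟩
  · have : NeZero n := ⟨h.ne'⟩
    exact exists_min_len hlen

/-- A tile covering `e + δ` starts in `[e, e + δ]`. If none started at `e` itself, there would be
two starts to the right of `e` closer together than the shortest tile. -/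
lemma IsTiling.end_mem_vert (hlen : ∀ i, 0 < len i) (hT : IsTiling len T) {x : ℝ} {i : Fin n}
    (hi : (x, i) ∈ T) : x + len i ∈ vert T := by
  obtain ⟨m, hm, hml⟩ := exists_min_len' hlen
  set e := x + len i with he
  have key : ∀ δ > 0, ∃ q ∈ T, e ≤ q.1 ∧ q.1 ≤ e + δ := by
    intro δ hδ
    obtain ⟨q, hq, h1, h2⟩ := hT.1 (e + δ)
    refine ⟨q, hq, ?_, h1⟩
    have hi0 := hlen i
    rcases lt_trichotomy x q.1 with h | h | h
    · exact hT.le_of_lt hlen hi hq h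
    · obtain ⟨y, j⟩ := q
      simp only at h
      subst h
      have := hT.label_unique hlen hi hq
      subst this
      simp only at h2
      linarith
    · have := hT.le_of_lt hlen hq hi h
      simp only at this
      linarith
  obtain ⟨q, hq, h1, h2⟩ := key (m / 2) (by positivity)
  rcases eq_or_lt_of_le h1 with h | h
  · exact ⟨q.2, by rw [h]; exact hq⟩
  · obtain ⟨q', hq', h3, h4⟩ := key ((q.1 - e) / 2) (by linarith)
    have := hT.le_of_lt hlen hq' hq (by linarith)
    have := hml q'.2
    linarith

/-- Every point of the line lies in the half open interval of some tile. -/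
lemma IsTiling.exists_mem_Ico (hlen : ∀ i, 0 < len i) (hT : IsTiling len T) (x : ℝ) :
    ∃ p ∈ T, x ∈ Set.Ico p.1 (p.1 + len p.2) := by
  obtain ⟨p, hp, h1, h2⟩ := hT.1 x
  rcases h2.lt_or_eq with h | h
  · exact ⟨p, hp, h1, h⟩
  · obtain ⟨j, hj⟩ := hT.end_mem_vert hlen (x := p.1) (i := p.2) hp
    rw [← h] at hj
    exact ⟨_, hj, le_rfl, by simpa using hlen j⟩

/-- A patch determines the vertices in the interval which it covers. -/
lemma IsTiling.add_mem_vert_iff (hlen : ∀ i, 0 < len i) (hT : IsTiling len T) {x : ℝ}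
    {L : List (Fin n)} (h : place len x L ⊆ T) {w : ℝ} (h0 : 0 ≤ w)
    (hw : w < (L.map len).sum) : x + w ∈ vert T ↔ w ∈ offsets (L.map len) := by
  induction L generalizing x w with
  | nil => simp only [List.map_nil, List.sum_nil] at hw; linarith
  | cons i L ih =>
    simp only [place_cons, Set.insert_subset_iff] at h
    simp only [List.map_cons, List.sum_cons] at hw
    simp only [List.map_cons, offsets, Set.mem_insert_iff, Set.mem_image]
    rcases lt_or_ge w (len i) with hlt | hge
    · have hr : ¬ ∃ y ∈ offsets (L.map len), len i + y = w := by
        rintro ⟨y, hy, rfl⟩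
        have : ∀ (l : List (Fin n)), ∀ y ∈ offsets (l.map len), 0 ≤ y := by
          intro l
          induction l with
          | nil => intro y hy; simp [offsets] at hy
          | cons j l ih' =>
            intro y hy
            simp only [List.map_cons, offsets, Set.mem_insert_iff, Set.mem_image] at hy
            rcases hy with rfl | ⟨y, hy, rfl⟩
            · exact le_rfl
            · have := ih' y hy
              have := hlen j
              linarith
        have := this L y hy
        linarith
      simp only [hr, or_false]
      constructor
      · rintro ⟨j, hj⟩
        by_contra hne
        have h1 : 0 < w := lt_of_le_of_ne h0 (Ne.symm hne)
        have := hT.le_of_lt hlen h.1 hj (by simp only; linarith)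
        simp only at this
        linarith
      · rintro rfl
        exact ⟨i, by simpa using h.1⟩
    · have hne : w ≠ 0 := by have := hlen i; intro h; linarith
      have := ih h.2 (w := w - len i) (by linarith) (by linarith)
      rw [show x + len i + (w - len i) = x + w by ring] at this
      rw [this]
      simp only [hne, false_or]
      constructor
      · intro h; exact ⟨_, h, by ring⟩
      · rintro ⟨y, hy, rfl⟩; simpa using hy

/-- Two occurrences of a patch have the same pattern of vertices. -/
lemma IsTiling.pattern_eq {n' : ℕ} {len' : Fin n' → ℝ} {T' : Set (ℝ × Fin n')}
    (hlen : ∀ i, 0 < len i) (hT : IsTiling len T) (hlen' : ∀ i, 0 < len' i)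
    (hT' : IsTiling len' T') {x x' : ℝ} {L : List (Fin n)} {L' : List (Fin n')}
    (h : place len x L ⊆ T) (h' : place len' x' L' ⊆ T') (hL : L.map len = L'.map len')
    {w : ℝ} (h0 : 0 ≤ w) (hw : w < (L.map len).sum) : x + w ∈ vert T ↔ x' + w ∈ vert T' := by
  rw [hT.add_mem_vert_iff hlen h h0 hw, hT'.add_mem_vert_iff hlen' h' h0 (hL ▸ hw), hL]

/-- Arbitrarily long words can be read off a tiling. -/
lemma IsTiling.exists_word (hlen : ∀ i, 0 < len i) (hT : IsTiling len T) {x : ℝ} {i : Fin n}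
    (hi : (x, i) ∈ T) (R : ℝ) :
    ∃ L : List (Fin n), place len x (i :: L) ⊆ T ∧ R ≤ ((i :: L).map len).sum := by
  obtain ⟨m, hm, hml⟩ := exists_min_len' hlen
  have key : ∀ k : ℕ, ∀ x i, (x, i) ∈ T → ∃ L : List (Fin n), place len x (i :: L) ⊆ T ∧
      k * m ≤ ((i :: L).map len).sum := by
    intro k
    induction k with
    | zero =>
      intro x i hi
      exact ⟨[], by simpa using hi, by simpa using (hlen i).le⟩
    | succ k ih =>
      intro x i hi
      obtain ⟨j, hj⟩ := hT.end_mem_vert hlen hi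
      obtain ⟨L, hL, hs⟩ := ih _ _ hj
      refine ⟨j :: L, ?_, ?_⟩
      · rw [place_cons, Set.insert_subset_iff]
        exact ⟨hi, hL⟩
      · rw [List.map_cons, List.sum_cons]
        have := hml i
        push_cast
        linarith
  obtain ⟨k, hk⟩ := exists_nat_ge (R / m)
  obtain ⟨L, hL, hs⟩ := key k x i hi
  exact ⟨L, hL, le_trans ((div_le_iff₀ hm).1 hk) hs⟩

/-- The tiles between two vertices form a word. -/
lemma IsTiling.exists_word_between (hlen : ∀ i, 0 < len i) (hT : IsTiling len T) {x y : ℝ}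
    (hx : x ∈ vert T) (hy : y ∈ vert T) (hxy : x ≤ y) :
    ∃ L : List (Fin n), place len x L = {p ∈ T | x ≤ p.1 ∧ p.1 < y} ∧ (L.map len).sum = y - x := by
  obtain ⟨m, hm, hml⟩ := exists_min_len' hlen
  have key : ∀ k : ℕ, ∀ x, x ∈ vert T → x ≤ y → y - x ≤ k * m → ∃ L : List (Fin n),
      place len x L = {p ∈ T | x ≤ p.1 ∧ p.1 < y} ∧ (L.map len).sum = y - x := by
    intro k
    induction k with
    | zero =>
      intro x _ h1 h2
      have : x = y := by simp at h2; linarith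
      subst this
      refine ⟨[], ?_, by simp⟩
      ext p
      simp
      tauto
    | succ k ih =>
      intro x hx h1 h2
      rcases h1.eq_or_lt with rfl | h1
      · refine ⟨[], ?_, by simp⟩
        ext p
        simp
        tauto
      · obtain ⟨i, hi⟩ := hx
        obtain ⟨j, hj⟩ := hy
        have hle := hT.le_of_lt hlen hi hj h1
        simp only at hle
        have := hml i
        push_cast at h2
        obtain ⟨L, hL, hs⟩ := ih _ (hT.end_mem_vert hlen hi) hle (by linarith)
        refine ⟨i :: L, ?_, by simp [hs]; ring⟩
        rw [place_cons, hL]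
        ext ⟨z, l⟩
        simp only [Set.mem_insert_iff, Set.mem_ofPred_eq, Prod.mk.injEq]
        have hi0 := hlen i
        constructor
        · rintro (⟨rfl, rfl⟩ | ⟨h3, h4, h5⟩)
          · exact ⟨hi, le_rfl, h1⟩
          · exact ⟨h3, by linarith, h5⟩
        · rintro ⟨h3, h4, h5⟩
          rcases h4.eq_or_lt with rfl | h4
          · exact Or.inl ⟨rfl, hT.label_unique hlen h3 hi⟩
          · exact Or.inr ⟨h3, hT.le_of_lt hlen hi h3 h4, h5⟩
  obtain ⟨k, hk⟩ := exists_nat_ge ((y - x) / m)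
  exact key k x hx hxy ((div_le_iff₀ hm).1 hk)

lemma IsTiling.nonempty (hT : IsTiling len T) : T.Nonempty := by
  obtain ⟨p, hp, -⟩ := hT.1 0
  exact ⟨p, hp⟩

end Tilings

/-! ### The action of a substitution rule -/

namespace SubstitutionRule

variable (σ : SubstitutionRule)

lemma factor_pos : 0 < σ.factor := zero_lt_one.trans σ.one_lt_factor

lemma sum_flatMap (L : List (Fin σ.card)) :
    ((L.flatMap σ.repl).map σ.len).sum = σ.factor * (L.map σ.len).sum := by
  induction L with
  | nil => simp
  | cons i L ih =>
    simp only [List.flatMap_cons, List.map_append, List.sum_append, ih, σ.covers, List.map_cons,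
      List.sum_cons]
    ring

lemma patch_succ (k : ℕ) (i : Fin σ.card) :
    σ.patch (k + 1) i = (σ.patch k i).flatMap σ.repl := by
  simp only [patch, Function.iterate_succ_apply']

lemma sum_patch (k : ℕ) (i : Fin σ.card) :
    ((σ.patch k i).map σ.len).sum = σ.factor ^ k * σ.len i := by
  induction k with
  | zero => simp [patch]
  | succ k ih => rw [patch_succ, sum_flatMap, ih]; ring

lemma place_flatMap_subset {S : Set (ℝ × Fin σ.card)} {x : ℝ} {L : List (Fin σ.card)}
    (h : place σ.len x L ⊆ S) : place σ.len (σ.factor * x) (L.flatMap σ.repl) ⊆ σ.apply S := by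
  induction L generalizing x with
  | nil => simp
  | cons i L ih =>
    simp only [place_cons, Set.insert_subset_iff] at h
    rw [List.flatMap_cons, place_append, σ.covers, ← mul_add]
    refine Set.union_subset ?_ (ih h.2)
    exact Set.subset_biUnion_of_mem (u := fun p : ℝ × Fin σ.card =>
      place σ.len (σ.factor * p.1) (σ.repl p.2)) h.1

lemma place_patch_subset {S : Set (ℝ × Fin σ.card)} {x : ℝ} {i : Fin σ.card} (h : (x, i) ∈ S)
    (k : ℕ) : place σ.len (σ.factor ^ k * x) (σ.patch k i) ⊆ σ.apply^[k] S := by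
  induction k with
  | zero => simpa [patch] using h
  | succ k ih =>
    rw [patch_succ, Function.iterate_succ_apply', pow_succ', mul_assoc]
    exact σ.place_flatMap_subset ih

lemma repl_ne_nil (i : Fin σ.card) : σ.repl i ≠ [] := by
  intro h
  have h1 := σ.covers i
  rw [h] at h1
  have := mul_pos σ.factor_pos (σ.len_pos i)
  simp at h1
  rcases h1 with h1 | h1
  · exact σ.factor_pos.ne' h1
  · exact (σ.len_pos i).ne' h1

lemma factor_mul_mem_vert {S : Set (ℝ × Fin σ.card)} {x : ℝ} (h : x ∈ vert S) :
    σ.factor * x ∈ vert (σ.apply S) := by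
  obtain ⟨i, hi⟩ := h
  have h1 := σ.place_flatMap_subset (S := S) (x := x) (L := [i]) (by simpa using hi)
  simp only [List.flatMap_cons, List.flatMap_nil, List.append_nil] at h1
  cases hr : σ.repl i with
  | nil => exact absurd hr (σ.repl_ne_nil i)
  | cons j L =>
    rw [hr, place_cons, Set.insert_subset_iff] at h1
    exact ⟨j, h1.1⟩

end SubstitutionRule

/-! ### Half open intervals -/

/-- Comparison with an end point of a half open interval: `e ≤ u` for intervals which are closed
on the left, and `e < u` otherwise. -/
def Above (c : Bool) (u e : ℝ) : Prop := if c = true then e ≤ u else e < u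

@[simp] lemma above_true (u e : ℝ) : Above true u e ↔ e ≤ u := by simp [Above]

@[simp] lemma above_false (u e : ℝ) : Above false u e ↔ e < u := by simp [Above]

lemma mem_halfOpen_iff {c : Bool} {a b u : ℝ} :
    u ∈ halfOpen c a b ↔ Above c u a ∧ ¬ Above c u b := by
  cases c <;> simp [halfOpen]

lemma mem_Icc_of_mem_halfOpen {c : Bool} {a b u : ℝ} (h : u ∈ halfOpen c a b) :
    a ≤ u ∧ u ≤ b := by
  cases c
  · simp only [halfOpen] at h; exact ⟨h.1.le, h.2⟩
  · simp only [halfOpen] at h; exact ⟨h.1, h.2.le⟩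

lemma mem_halfOpen_of_lt {c : Bool} {a b u : ℝ} (h : a < u) (h' : u < b) :
    u ∈ halfOpen c a b := by
  cases c
  · exact ⟨h, h'.le⟩
  · exact ⟨h.le, h'⟩

lemma sub_lt_of_mem_halfOpen {c : Bool} {a b u v : ℝ} (hu : u ∈ halfOpen c a b)
    (hv : v ∈ halfOpen c a b) : u - v < b - a := by
  cases c
  · simp only [halfOpen] at hu hv; have := hu.2; have := hv.1; linarith
  · simp only [halfOpen] at hu hv; have := hu.2; have := hv.1; linarith

lemma mem_halfOpen_of_between {c : Bool} {a b u v w : ℝ} (hu : u ∈ halfOpen c a b)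
    (hw : w ∈ halfOpen c a b) (huv : u ≤ v) (hvw : v ≤ w) : v ∈ halfOpen c a b := by
  cases c
  · exact ⟨lt_of_lt_of_le hu.1 huv, le_trans hvw hw.2⟩
  · exact ⟨le_trans hu.1 huv, lt_of_le_of_lt hvw hw.2⟩

lemma mem_halfOpen_base {c : Bool} {t ℓ u : ℝ} :
    u ∈ halfOpen c t (t + ℓ) ↔ u - t ∈ halfOpen c 0 ℓ := by
  cases c <;> simp [halfOpen, sub_lt_iff_lt_add, add_comm]

/-! ### Cut and project schemes on the line -/

/-- A group with two projections to the line: the projection `π` to the tiling space and the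
projection `ρ` to the window space. -/
structure CutScheme (G : Type*) [AddCommGroup G] where
  π : G →+ ℝ
  ρ : G →+ ℝ
  ρ_injective : Function.Injective ρ
  dense : ∀ a b R : ℝ, a < b → ∃ g, a < ρ g ∧ ρ g < b ∧ R < π g
  finite : ∀ R : ℝ, {g | |π g| ≤ R ∧ |ρ g| ≤ R}.Finite

namespace CutScheme

variable {G : Type*} [AddCommGroup G] (C : CutScheme G)

/-- The projections of the points over a window. -/
def vset (S : Set ℝ) : Set ℝ := {x | ∃ g, C.ρ g ∈ S ∧ C.π g = x}

/-- The set `X` looks, from `x`, like the model set with window `halfOpen c 0 ℓ` from a point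
which projects to `u`. -/
def PosAt (ℓ : ℝ) (X : Set ℝ) (x : ℝ) (c : Bool) (u : ℝ) : Prop :=
  ∀ g, x + C.π g ∈ X ↔ C.ρ g + u ∈ halfOpen c 0 ℓ

/-- A weak form of `PosAt` which says nothing about the points that project far outside the
window. -/
structure PosNear (ℓ L : ℝ) (X : Set ℝ) (x : ℝ) (u : ℝ) : Prop where
  nonneg : 0 ≤ u
  le : u ≤ ℓ
  inside : ∀ g, 0 < C.ρ g + u → C.ρ g + u < ℓ → x + C.π g ∈ X
  outside : ∀ g, ℓ < C.ρ g + u → C.ρ g + u < L → x + C.π g ∉ X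

variable {C}

lemma PosAt.mem_Icc {ℓ : ℝ} {X : Set ℝ} {x u : ℝ} {c : Bool} (h : C.PosAt ℓ X x c u)
    (hx : x ∈ X) : 0 ≤ u ∧ u ≤ ℓ := by
  have := (h 0).1 (by simpa using hx)
  simpa using mem_Icc_of_mem_halfOpen this

lemma PosAt.posNear {ℓ : ℝ} {X : Set ℝ} {x u : ℝ} {c : Bool} (h : C.PosAt ℓ X x c u)
    (hx : x ∈ X) (L : ℝ) : C.PosNear ℓ L X x u where
  nonneg := (h.mem_Icc hx).1
  le := (h.mem_Icc hx).2
  inside g h1 h2 := (h g).2 (mem_halfOpen_of_lt h1 h2)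
  outside g h1 _ h3 := by
    have := mem_Icc_of_mem_halfOpen ((h g).1 h3)
    linarith

lemma PosAt.add {ℓ : ℝ} {X : Set ℝ} {x u : ℝ} {c : Bool} (h : C.PosAt ℓ X x c u) (d : G) :
    C.PosAt ℓ X (x + C.π d) c (u + C.ρ d) := by
  intro g
  have := h (d + g)
  rw [map_add, map_add] at this
  rw [add_assoc, this]
  congr! 1
  ring

lemma posAt_vset (hπ : Function.Injective C.π) (ℓ t : ℝ) (c : Bool) (z : G) :
    C.PosAt ℓ (C.vset (halfOpen c t (t + ℓ))) (C.π z) c (C.ρ z - t) := by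
  intro g
  rw [← map_add]
  constructor
  · rintro ⟨h, h1, h2⟩
    rw [hπ h2, mem_halfOpen_base, map_add] at h1
    convert h1 using 1
    ring
  · intro h
    refine ⟨z + g, ?_, rfl⟩
    rw [mem_halfOpen_base, map_add]
    convert h using 1
    ring

variable (C) in
/-- The points whose projections to the tiling space lie in `(0, R)` project to a `w`-dense subset
of the window space. -/
def Covers (w R : ℝ) : Prop := ∀ a, ∃ g, a < C.ρ g ∧ C.ρ g < a + w ∧ 0 < C.π g ∧ C.π g < R

variable (C) in
-- Density gives a point above each node of a grid of mesh `w / 2`, and only finitely many nodes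
-- matter for `a` in `[0, ℓ]`, so a single `R` bounds them all.
lemma exists_cover {w : ℝ} (hw : 0 < w) (ℓ : ℝ) : ∃ R, ∀ a, 0 ≤ a → a ≤ ℓ →
    ∃ g, a < C.ρ g ∧ C.ρ g < a + w ∧ 0 < C.π g ∧ C.π g < R := by
  have h1 : ∀ j : ℕ, ∃ g, j * (w / 2) < C.ρ g ∧ C.ρ g < j * (w / 2) + w / 2 ∧ 0 < C.π g :=
    fun j => C.dense _ _ 0 (by linarith)
  choose g hg1 hg2 hg3 using h1
  obtain ⟨N, hN⟩ := exists_nat_gt (ℓ / (w / 2))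
  obtain ⟨R, hR⟩ := ((Finset.range (N + 2)).image fun j => C.π (g j)).exists_le
  refine ⟨R + 1, fun a ha0 ha1 => ⟨g ⌈a / (w / 2)⌉₊, ?_, ?_, hg3 _, ?_⟩⟩
  · have h2 := Nat.le_ceil (a / (w / 2))
    rw [div_le_iff₀ (by positivity)] at h2
    exact lt_of_le_of_lt h2 (hg1 _)
  · have h2 := Nat.ceil_lt_add_one (a := a / (w / 2)) (by positivity)
    have h3 : (⌈a / (w / 2)⌉₊ : ℝ) * (w / 2) < (a / (w / 2) + 1) * (w / 2) :=
      mul_lt_mul_of_pos_right h2 (by positivity)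
    rw [add_mul, div_mul_cancel₀ _ (by positivity)] at h3
    have := hg2 ⌈a / (w / 2)⌉₊
    linarith
  · have h2 : ⌈a / (w / 2)⌉₊ ≤ N := by
      rw [Nat.ceil_le]
      exact (div_le_div_of_nonneg_right ha1 (by positivity)).trans hN.le
    have := hR (C.π (g ⌈a / (w / 2)⌉₊)) (Finset.mem_image_of_mem _ (Finset.mem_range.2 (by omega)))
    linarith

/-- If `u'` exceeded `u + w`, a vector with `ρ` just above `ℓ - u'` would leave the window from `u'`
but stay inside it from `u`. The hypothesis `hwL` keeps it below the height `L` up to which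
`outside` speaks. -/
lemma PosNear.le_add {ℓ L w R : ℝ} {X X' : Set ℝ} {x x' u u' : ℝ}
    (h : C.PosNear ℓ L X x u) (h' : C.PosNear ℓ L X' x' u') (hwL : w ≤ L - ℓ)
    (hcov : ∀ a, 0 ≤ a → a ≤ ℓ → ∃ g, a < C.ρ g ∧ C.ρ g < a + w ∧ 0 < C.π g ∧ C.π g < R)
    (hpat : ∀ s, 0 ≤ s → s < R → (x + s ∈ X ↔ x' + s ∈ X')) : u' ≤ u + w := by
  by_contra! hlt
  have := h.nonneg
  have := h'.le
  have := h'.nonneg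
  obtain ⟨g, h1, h2, h3, h4⟩ := hcov (ℓ - u') (by linarith) (by linarith)
  refine h'.outside g (by linarith) (by linarith) ((hpat _ h3.le h4).1 ?_)
  exact h.inside g (by linarith) (by linarith)

/-- Points with the same pattern of vertices to their right have nearby positions. -/
lemma PosNear.abs_sub_le {ℓ L w R : ℝ} {X X' : Set ℝ} {x x' u u' : ℝ}
    (h : C.PosNear ℓ L X x u) (h' : C.PosNear ℓ L X' x' u') (hwL : w ≤ L - ℓ)
    (hcov : ∀ a, 0 ≤ a → a ≤ ℓ → ∃ g, a < C.ρ g ∧ C.ρ g < a + w ∧ 0 < C.π g ∧ C.π g < R)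
    (hpat : ∀ s, 0 ≤ s → s < R → (x + s ∈ X ↔ x' + s ∈ X')) : |u - u'| ≤ w := by
  have h1 := h.le_add h' hwL hcov hpat
  have h2 := h'.le_add h hwL hcov fun s hs hs' => (hpat s hs hs').symm
  rw [abs_le]
  constructor <;> linarith

lemma PosAt.abs_sub_le {ℓ w R : ℝ} {X X' : Set ℝ} {x x' u u' : ℝ} {c c' : Bool}
    (h : C.PosAt ℓ X x c u) (hx : x ∈ X) (h' : C.PosAt ℓ X' x' c' u') (hx' : x' ∈ X')
    (hcov : ∀ a, 0 ≤ a → a ≤ ℓ → ∃ g, a < C.ρ g ∧ C.ρ g < a + w ∧ 0 < C.π g ∧ C.π g < R)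
    (hpat : ∀ s, 0 ≤ s → s < R → (x + s ∈ X ↔ x' + s ∈ X')) : |u - u'| ≤ w :=
  (h.posNear hx (ℓ + w)).abs_sub_le (h'.posNear hx' (ℓ + w)) (by linarith) hcov hpat

/-- The position of a point is unique. -/
lemma PosAt.unique {ℓ : ℝ} {X : Set ℝ} {x u u' : ℝ} {c c' : Bool}
    (h : C.PosAt ℓ X x c u) (hx : x ∈ X) (h' : C.PosAt ℓ X x c' u') : u = u' := by
  have : |u - u'| ≤ 0 := by
    refine le_of_forall_pos_le_add fun w hw => ?_
    rw [zero_add]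
    obtain ⟨R, hR⟩ := C.exists_cover hw ℓ
    exact h.abs_sub_le hx h' hx hR fun _ _ _ => Iff.rfl
  have := abs_nonpos_iff.1 this
  linarith

variable (C) in
/-- A set with the same finite patches as a model set with a half open window is a translated
model set with a half open window of the same length. -/
lemma exists_window_of_transfer {ℓ t : ℝ} {c : Bool} {A : Set G} (hA : A.Nonempty)
    (hin : ∀ I O : Set G, I.Finite → O.Finite → I.Nonempty → I ⊆ A → Disjoint O A →
      ∃ h, (∀ g ∈ I, C.ρ (g + h) ∈ halfOpen c t (t + ℓ)) ∧
        ∀ g ∈ O, C.ρ (g + h) ∉ halfOpen c t (t + ℓ))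
    (hout : ∀ I : Set G, I.Finite → I.Nonempty → (∀ g ∈ I, C.ρ g ∈ halfOpen c t (t + ℓ)) →
      ∃ h, ∀ g ∈ I, g + h ∈ A) :
    ∃ c' u, ∀ g, g ∈ A ↔ C.ρ g + u ∈ halfOpen c' 0 ℓ := by
  have hdiff : ∀ a ∈ A, ∀ b ∈ A, C.ρ a - C.ρ b < ℓ := by
    intro a ha b hb
    obtain ⟨h, h1, -⟩ := hin {a, b} ∅ (by simp) (by simp) (by simp)
      (by simp [Set.insert_subset_iff, ha, hb]) (by simp)
    have := sub_lt_of_mem_halfOpen (h1 a (by simp)) (h1 b (by simp))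
    rw [map_add, map_add] at this
    linarith
  have hbdd : BddBelow (C.ρ '' A) := by
    obtain ⟨a, ha⟩ := hA
    refine ⟨C.ρ a - ℓ, ?_⟩
    rintro _ ⟨b, hb, rfl⟩
    have := hdiff a ha b hb
    linarith
  set m := sInf (C.ρ '' A) with hm
  have hlow : ∀ a ∈ A, m ≤ C.ρ a := fun a ha => csInf_le hbdd ⟨a, ha, rfl⟩
  have hup : ∀ a ∈ A, C.ρ a ≤ m + ℓ := by
    intro a ha
    have : C.ρ a - ℓ ≤ m := by
      refine le_csInf (hA.image _) ?_
      rintro _ ⟨b, hb, rfl⟩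
      have := hdiff a ha b hb
      linarith
    linarith
  -- `A` has points that project below `g`. A pair of nearly extreme points of the window, moved
  -- into `A` by `hout`, provides one above `g`, and a half open interval containing both contains
  -- the translate of `g` too.
  have hmid : ∀ g, m < C.ρ g → C.ρ g < m + ℓ → g ∈ A := by
    intro g h1 h2
    by_contra hg
    obtain ⟨_, ⟨b, hb, rfl⟩, hbg⟩ := exists_lt_of_csInf_lt (hA.image _) h1
    -- With this `e` one gets `ρ g1 - ρ g2 > ℓ - 2 * e = ρ g - m`; since `g2 + h` projects to at
    -- least `m`, the point `g1 + h` projects above `g`.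
    set e := (m + ℓ - C.ρ g) / 2 with he
    obtain ⟨g1, h11, h12, -⟩ := C.dense (t + ℓ - e) (t + ℓ) 0 (by linarith)
    obtain ⟨g2, h21, h22, -⟩ := C.dense t (t + e) 0 (by linarith)
    obtain ⟨h, hh⟩ := hout {g1, g2} (by simp) (by simp) (by
      rintro g (rfl | rfl)
      · exact mem_halfOpen_of_lt (by linarith) (by linarith)
      · exact mem_halfOpen_of_lt (by linarith) (by linarith))
    have ha := hh g1 (by simp)
    have hb' := hlow _ (hh g2 (by simp))
    obtain ⟨k, h3, h4⟩ := hin {g1 + h, b} {g} (by simp) (by simp) (by simp)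
      (by simp [Set.insert_subset_iff, ha, hb]) (by simpa using hg)
    refine h4 g rfl (mem_halfOpen_of_between (h3 b (by simp)) (h3 (g1 + h) (by simp)) ?_ ?_)
    · rw [map_add, map_add]; linarith
    · rw [map_add, map_add, map_add]; rw [map_add] at hb'; linarith
  by_cases hc1 : ∃ a ∈ A, C.ρ a = m
  · obtain ⟨a, ha, ham⟩ := hc1
    refine ⟨true, -m, fun g => ?_⟩
    simp only [halfOpen, if_true, Set.mem_Ico]
    constructor
    · intro hg
      have := hlow g hg
      have := hdiff g hg a ha
      constructor <;> linarith
    · rintro ⟨h1, h2⟩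
      rcases h1.eq_or_lt with h1 | h1
      · have : g = a := C.ρ_injective (by linarith)
        exact this ▸ ha
      · exact hmid g (by linarith) (by linarith)
  · by_cases hc2 : ∃ a ∈ A, C.ρ a = m + ℓ
    · obtain ⟨a, ha, ham⟩ := hc2
      refine ⟨false, -m, fun g => ?_⟩
      simp only [halfOpen, Set.mem_Ioc, Bool.false_eq_true, if_false]
      constructor
      · intro hg
        have := hup g hg
        have := hdiff a ha g hg
        constructor <;> linarith
      · rintro ⟨h1, h2⟩
        rcases h2.eq_or_lt with h2 | h2
        · have : g = a := C.ρ_injective (by linarith)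
          exact this ▸ ha
        · exact hmid g (by linarith) (by linarith)
    · have hmid' : ∀ g, g ∈ A → m < C.ρ g ∧ C.ρ g < m + ℓ := fun g hg =>
        ⟨lt_of_le_of_ne (hlow g hg) fun h => hc1 ⟨g, hg, h.symm⟩,
          lt_of_le_of_ne (hup g hg) fun h => hc2 ⟨g, hg, h⟩⟩
      -- Neither end is attained in `A`. This contradicts nothing as long as the group does not meet
      -- both ends: if it met both, their translates would be at distance `ℓ` around a point of the
      -- half open window, which then contains one of them.
      by_cases hg0 : ∃ g0, C.ρ g0 = m
      · obtain ⟨g0, hg0⟩ := hg0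
        refine ⟨false, -m, fun g => ?_⟩
        simp only [halfOpen, Set.mem_Ioc, Bool.false_eq_true, if_false]
        constructor
        · intro hg
          have := hmid' g hg
          constructor <;> linarith
        · rintro ⟨h1, h2⟩
          rcases h2.eq_or_lt with h2 | h2
          · exfalso
            obtain ⟨a, ha⟩ := hA
            obtain ⟨h, h3, h4⟩ := hin {a} {g0, g} (by simp) (by simp) (by simp)
              (by simpa using ha) (by
                rw [Set.disjoint_left]
                rintro x (rfl | rfl) hx
                · exact hc1 ⟨_, hx, hg0⟩
                · exact hc2 ⟨_, hx, by linarith⟩)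
            have h5 := h3 a rfl
            have h6 := h4 g0 (by simp)
            have h7 := h4 g (by simp)
            have h8 := hmid' a ha
            rw [map_add, mem_halfOpen_base] at h5 h6 h7
            rw [show C.ρ g = C.ρ g0 + ℓ by linarith] at h7
            cases c
            · simp only [halfOpen, Set.mem_Ioc, Bool.false_eq_true, if_false, not_and, not_le]
                at h5 h6 h7
              have h9 : 0 < C.ρ g0 + ℓ + C.ρ h - t := by linarith
              have := h7 h9
              have := h6 (by linarith)
              linarith
            · simp only [halfOpen, Set.mem_Ico, if_true, not_and, not_lt] at h5 h6 h7
              have h9 : 0 ≤ C.ρ g0 + ℓ + C.ρ h - t := by linarith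
              have := h7 h9
              have := h6 (by linarith)
              linarith
          · exact hmid g (by linarith) (by linarith)
      · refine ⟨true, -m, fun g => ?_⟩
        simp only [halfOpen, if_true, Set.mem_Ico]
        constructor
        · intro hg
          have := hmid' g hg
          constructor <;> linarith
        · rintro ⟨h1, h2⟩
          rcases h1.eq_or_lt with h1 | h1
          · exact absurd ⟨g, by linarith⟩ hg0
          · exact hmid g (by linarith) (by linarith)

variable (C) in
/-- The points that project close to the origin of the window space generate the group. -/
lemma eq_top_of_forall_abs_lt {ℓ : ℝ} (hℓ : 0 < ℓ) (H : AddSubgroup G)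
    (h : ∀ g, |C.ρ g| < ℓ → g ∈ H) : H = ⊤ := by
  obtain ⟨h0, h1, h2, -⟩ := C.dense 0 ℓ 0 hℓ
  have hh0 : h0 ∈ H := h h0 (by rw [abs_lt]; constructor <;> linarith)
  rw [eq_top_iff]
  intro g _
  have h3 := Int.floor_le (C.ρ g / C.ρ h0)
  have h4 := Int.lt_floor_add_one (C.ρ g / C.ρ h0)
  rw [le_div_iff₀ h1] at h3
  rw [div_lt_iff₀ h1] at h4
  have : g - ⌊C.ρ g / C.ρ h0⌋ • h0 ∈ H := by
    apply h
    rw [map_sub, map_zsmul, zsmul_eq_mul, abs_lt]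
    constructor <;> linarith
  have h5 := H.add_mem this (H.zsmul_mem hh0 ⌊C.ρ g / C.ρ h0⌋)
  simpa using h5

end CutScheme

/-! ### Positions in tilings locally isomorphic to a model set -/

namespace CutScheme

variable {G : Type*} [AddCommGroup G] (C : CutScheme G)

variable {n : ℕ} {len : Fin n → ℝ} {T T' : Set (ℝ × Fin n)} {ℓ t : ℝ} {c : Bool}

lemma PatchesAppear.exists_pair {X X' : Set (ℝ × Fin n)} (h : PatchesAppear X X') {x y : ℝ}
    (hx : x ∈ vert X) (hy : y ∈ vert X) : ∃ a, x + a ∈ vert X' ∧ y + a ∈ vert X' := by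
  obtain ⟨i, hi⟩ := hx
  obtain ⟨j, hj⟩ := hy
  obtain ⟨a, ha⟩ := h {(x, i), (y, j)} (by simp) (by simp [Set.insert_subset_iff, hi, hj])
  exact ⟨a, ⟨i, ha (x, i) (by simp)⟩, ⟨j, ha (y, j) (by simp)⟩⟩

lemma exists_sub_eq_of_mem_vset {x y : ℝ} (hx : x ∈ C.vset (halfOpen c t (t + ℓ)))
    (hy : y ∈ C.vset (halfOpen c t (t + ℓ))) : ∃ g, x - y = C.π g ∧ |C.ρ g| < ℓ := by
  obtain ⟨g, hg, rfl⟩ := hx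
  obtain ⟨h, hh, rfl⟩ := hy
  refine ⟨g - h, by simp, ?_⟩
  have h1 := sub_lt_of_mem_halfOpen hg hh
  have h2 := sub_lt_of_mem_halfOpen hh hg
  rw [map_sub, abs_lt]
  constructor <;> linarith

/-- In a tiling that is locally isomorphic to an interval projection tiling, each vertex has a
position. -/
lemma exists_posAt (hπ : Function.Injective C.π) (hlen : ∀ i, 0 < len i) (hT : IsTiling len T)
    (hT' : IsTiling len T') (hV : vert T = C.vset (halfOpen c t (t + ℓ)))
    (hLI : LocallyIsomorphic T' T) {x : ℝ} (hx : x ∈ vert T') :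
    (∃ c' u, C.PosAt ℓ (vert T') x c' u) ∧ ∀ y ∈ vert T', ∃ g, y = x + C.π g := by
  have hdiff : ∀ y ∈ vert T', ∃ g, y = x + C.π g := by
    intro y hy
    obtain ⟨a, h1, h2⟩ := PatchesAppear.exists_pair hLI.1 hx hy
    rw [hV] at h1 h2
    obtain ⟨g, hg, -⟩ := C.exists_sub_eq_of_mem_vset h2 h1
    exact ⟨g, by linarith⟩
  refine ⟨?_, hdiff⟩
  have hmem : ∀ g, C.π g ∈ vert T ↔ C.ρ g ∈ halfOpen c t (t + ℓ) := by
    intro g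
    rw [hV]
    constructor
    · rintro ⟨h, h1, h2⟩
      rwa [← hπ h2]
    · intro h
      exact ⟨g, h, rfl⟩
  refine C.exists_window_of_transfer (A := {g | x + C.π g ∈ vert T'}) (t := t) (c := c)
    ⟨0, by simpa using hx⟩ ?_ ?_
  -- Each point is recorded by the tile containing it. A vertex starts its tile and any other point
  -- lies in the interior, so the copy of the tile in `T` preserves both presence and absence of
  -- vertices.
  · intro I O hI hO ⟨g0, hg0⟩ hIA hOA
    have h1 : ∀ g, ∃ p ∈ T', x + C.π g ∈ Set.Ico p.1 (p.1 + len p.2) := fun g =>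
      hT'.exists_mem_Ico hlen _
    choose τ hτ hτ2 using h1
    have hstart : ∀ g ∈ I, (τ g).1 = x + C.π g := by
      intro g hg
      rcases (hτ2 g).1.eq_or_lt with h | h
      · exact h
      · obtain ⟨j, hj⟩ := hIA hg
        have h3 := hT'.le_of_lt hlen (hτ g) hj h
        have := (hτ2 g).2
        simp only at h3
        linarith
    obtain ⟨a, ha⟩ := hLI.1 (τ '' (I ∪ O)) ((hI.union hO).image _) (by
      rintro _ ⟨g, -, rfl⟩
      exact hτ g)
    have hI' : ∀ g ∈ I, x + C.π g + a ∈ vert T := by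
      intro g hg
      refine ⟨(τ g).2, ?_⟩
      rw [← hstart g hg]
      exact ha _ ⟨g, Or.inl hg, rfl⟩
    have h2 := hI' g0 hg0
    rw [hV] at h2
    obtain ⟨z, hz, hz2⟩ := h2
    refine ⟨z - g0, ?_, ?_⟩
    · intro g hg
      rw [← hmem]
      convert hI' g hg using 1
      rw [map_add, map_sub, hz2]
      ring
    · intro g hg hmem'
      rw [← hmem, map_add, map_sub, hz2] at hmem'
      obtain ⟨j, hj⟩ := hmem'
      have h3 := ha _ ⟨g, Or.inr hg, rfl⟩
      have h4 : (τ g).1 ≠ x + C.π g := by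
        intro h
        refine Set.disjoint_left.1 hOA hg ⟨(τ g).2, ?_⟩
        rw [← h]
        exact hτ g
      have h5 := lt_of_le_of_ne (hτ2 g).1 h4
      have h6 := hT.le_of_lt hlen h3 hj (by simp only; linarith)
      have := (hτ2 g).2
      simp only at h6
      linarith
  · intro I hI ⟨g0, hg0⟩ hIA
    have h1 : ∀ g, ∃ i, g ∈ I → (C.π g, i) ∈ T := by
      intro g
      by_cases hg : g ∈ I
      · obtain ⟨i, hi⟩ := (hmem g).2 (hIA g hg)
        exact ⟨i, fun _ => hi⟩
      · obtain ⟨i, -⟩ := hx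
        exact ⟨i, fun h => absurd h hg⟩
    choose τ hτ using h1
    obtain ⟨a, ha⟩ := hLI.2 ((fun g => (C.π g, τ g)) '' I) (hI.image _) (by
      rintro _ ⟨g, hg, rfl⟩
      exact hτ g hg)
    have h2 : ∀ g ∈ I, C.π g + a ∈ vert T' := fun g hg => ⟨τ g, ha _ ⟨g, hg, rfl⟩⟩
    obtain ⟨d, hd⟩ := hdiff _ (h2 g0 hg0)
    refine ⟨d - g0, fun g hg => ?_⟩
    change x + C.π (g + (d - g0)) ∈ vert T'
    convert h2 g hg using 1
    rw [map_add, map_sub]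
    linarith

/-- The vertices of `T'` inflated by `lam` project to the window with base `t`, in positions which
are the images of their positions in `T'` under the affine map `u ↦ r + mu * u`. -/
def PredShift (ℓ t lam mu : ℝ) (T' : Set (ℝ × Fin n)) (r : ℝ) : Prop :=
  ∀ x ∈ vert T', ∃ c u z, C.PosAt ℓ (vert T') x c u ∧ lam * x = C.π z ∧ C.ρ z - t = r + mu * u

/-- One vertex `x` and one lift `z` of its inflation determine everything: the vertices are `x + π
g`, and they inflate to `π (z + m g)`. Surjectivity of `m` gives the reverse inclusion. -/
lemma PosAt.vset_image {C : CutScheme G} {X : Set ℝ} {x u lam mu : ℝ}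
    (hmu : mu ≠ 0) (m : G ≃+ G) (hmπ : ∀ g, C.π (m g) = lam * C.π g)
    (hmρ : ∀ g, C.ρ (m g) = mu * C.ρ g) (h : C.PosAt ℓ X x c u) (hX : ∀ y ∈ X, ∃ g, y = x + C.π g) {z : G} (hz : lam * x = C.π z) :
    (fun y => lam * y) '' X =
      C.vset {y | ∃ ω ∈ halfOpen c 0 ℓ, y = C.ρ z - mu * u + mu * ω} := by
  ext y
  constructor
  · rintro ⟨y, hy, rfl⟩
    obtain ⟨g, rfl⟩ := hX y hy
    refine ⟨z + m g, ⟨C.ρ g + u, (h g).1 hy, ?_⟩, ?_⟩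
    · rw [map_add, hmρ]; ring
    · rw [map_add, hmπ, ← hz]; ring
  · rintro ⟨g, ⟨ω, hω, h1⟩, rfl⟩
    have h2 : C.ρ (m.symm (g - z)) = ω - u := by
      have := hmρ (m.symm (g - z))
      rw [AddEquiv.apply_symm_apply, map_sub, h1] at this
      have h3 : mu * (C.ρ (m.symm (g - z)) - (ω - u)) = 0 := by linarith
      rcases mul_eq_zero.1 h3 with h3 | h3
      · exact absurd h3 hmu
      · linarith
    refine ⟨x + C.π (m.symm (g - z)), (h _).2 ?_, ?_⟩
    · rw [h2]; simpa using hω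
    · have := hmπ (m.symm (g - z))
      rw [AddEquiv.apply_symm_apply, map_sub] at this
      simp only
      rw [mul_add, ← this, hz]
      ring

/-- Injectivity of `π` makes the lift of an inflated vertex unique, so the parameter `ω` of that
lift is well defined and serves as the position of the vertex in `T'`. -/
lemma predShift_of_image (hπ : Function.Injective C.π) {lam mu r : ℝ}
    (hmu : mu ≠ 0) (hlam : lam ≠ 0)
    (m : G → G) (hmπ : ∀ g, C.π (m g) = lam * C.π g) (hmρ : ∀ g, C.ρ (m g) = mu * C.ρ g)
    (h : (fun y => lam * y) '' vert T' =
      C.vset {y | ∃ ω ∈ halfOpen c 0 ℓ, y = t + r + mu * ω}) :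
    C.PredShift ℓ t lam mu T' r := by
  have hmem : ∀ g, C.π g ∈ (fun y => lam * y) '' vert T' ↔
      ∃ ω ∈ halfOpen c 0 ℓ, C.ρ g = t + r + mu * ω := by
    intro g
    rw [h]
    constructor
    · rintro ⟨g', h1, h2⟩
      rwa [← hπ h2]
    · exact fun h => ⟨g, h, rfl⟩
  intro x hx
  have h1 : lam * x ∈ (fun y => lam * y) '' vert T' := ⟨x, hx, rfl⟩
  rw [h] at h1
  obtain ⟨z, ⟨ω, hω, h2⟩, h3⟩ := h1
  refine ⟨c, ω, z, fun g => ?_, h3.symm, by rw [h2]; ring⟩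
  have h4 : x + C.π g ∈ vert T' ↔ C.π (z + m g) ∈ (fun y => lam * y) '' vert T' := by
    rw [map_add, h3, hmπ, ← mul_add]
    exact (Function.Injective.mem_set_image (mul_right_injective₀ hlam)).symm
  rw [h4, hmem]
  constructor
  · rintro ⟨ω', hω', h5⟩
    rw [map_add, hmρ, h2] at h5
    have h6 : mu * (C.ρ g + ω - ω') = 0 := by linarith
    rcases mul_eq_zero.1 h6 with h6 | h6
    · exact absurd h6 hmu
    · rwa [show C.ρ g + ω = ω' by linarith]
  · intro h5
    exact ⟨_, h5, by rw [map_add, hmρ, h2]; ring⟩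

lemma posAt_of_mem_vert (hπ : Function.Injective C.π)
    (hV : vert T = C.vset (halfOpen c t (t + ℓ))) {z : G} :
    C.PosAt ℓ (vert T) (C.π z) c (C.ρ z - t) := by
  rw [hV]
  exact posAt_vset hπ ℓ t c z

/-! ### Patches of high level -/

lemma _root_.IntervalProjection.SubstitutionRule.mem_vert_of_place_patch {σ : SubstitutionRule}
    {S : Set (ℝ × Fin σ.card)} {x : ℝ} {k : ℕ} {i : Fin σ.card}
    (h : place σ.len x (σ.patch k i) ⊆ S) : x ∈ vert S := by
  cases hp : σ.patch k i with
  | nil =>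
    have := σ.sum_patch k i
    rw [hp] at this
    have h2 := mul_pos (pow_pos σ.factor_pos k) (σ.len_pos i)
    simp only [List.map_nil, List.sum_nil] at this
    linarith
  | cons j L =>
    rw [hp, place_cons, Set.insert_subset_iff] at h
    exact ⟨j, h.1⟩

lemma _root_.IntervalProjection.SubstitutionRule.exists_level (σ : SubstitutionRule) (R : ℝ) :
    ∃ K, ∀ k, K ≤ k → ∀ i, R ≤ ((σ.patch k i).map σ.len).sum := by
  obtain ⟨m, hm, hml⟩ := exists_min_len' σ.len_pos
  obtain ⟨K, hK⟩ := pow_unbounded_of_one_lt (R / m) σ.one_lt_factor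
  refine ⟨K, fun k hk i => ?_⟩
  rw [σ.sum_patch]
  have h1 := pow_le_pow_right₀ σ.one_lt_factor.le hk
  rw [div_lt_iff₀ hm] at hK
  have h3 : σ.factor ^ K * m ≤ σ.factor ^ k * σ.len i :=
    mul_le_mul h1 (hml i) hm.le (pow_pos σ.factor_pos k).le
  linarith

lemma _root_.IntervalProjection.SubstitutionRule.IsLabelling.exists_place_patch
    {σ : SubstitutionRule} {D : Set ℝ} {T : Set (ℝ × Fin σ.card)} (h : σ.IsLabelling D T) (k : ℕ)
    (i : Fin σ.card) : ∃ x, place σ.len x (σ.patch k i) ⊆ T := by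
  obtain ⟨S, -, hS2, hS3⟩ := h.2.2.2 k
  obtain ⟨x, hx⟩ := h.2.2.1 i
  obtain ⟨a, ha⟩ := hS2.2 {(x, i)} (by simp) (by simpa using hx)
  have h1 := σ.place_patch_subset (ha (x, i) rfl) k
  rw [hS3] at h1
  exact ⟨_, h1⟩

/-- The positions at which the patches of level `k` occur converge to the fixed point of
the map `u ↦ r + mu * u`. -/
lemma position_tendsto (hπ : Function.Injective C.π) {σ : SubstitutionRule}
    {T T' : Set (ℝ × Fin σ.card)} {mu r : ℝ} (hmu : |mu| < 1)
    (hT : σ.IsLabelling (C.vset (halfOpen c t (t + ℓ))) T) (hT' : IsTiling σ.len T')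
    (hTT' : PatchesAppear T T') (happ : σ.apply T' = T)
    (hr : C.PredShift ℓ t σ.factor mu T' r) {ε : ℝ} (hε : 0 < ε) :
    ∃ K, ∀ k, K ≤ k → ∀ i z, place σ.len (C.π z) (σ.patch k i) ⊆ T →
      |C.ρ z - t - r / (1 - mu)| < ε := by
  set p := r / (1 - mu) with hp
  have hmu1 : 0 < 1 - mu := by have := le_abs_self mu; linarith
  have hpr : r = p - mu * p := by rw [hp]; field_simp
  -- Chosen so that `2 * w + |mu| * (ε / 2) = ε / 2`, which makes the error bound in `key` stable
  -- under one step.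
  set w := ε * (1 - |mu|) / 4 with hw
  have hw0 : 0 < w := by have : 0 < 1 - |mu| := by linarith
                         positivity
  obtain ⟨R, hR⟩ := C.exists_cover hw0 ℓ
  obtain ⟨K0, hK0⟩ := σ.exists_level R
  have hpos : ∀ z, C.PosAt ℓ (vert T) (C.π z) c (C.ρ z - t) := fun z =>
    C.posAt_of_mem_vert hπ hT.2.1
  -- An occurrence in `T'` at position `u` inflates to one of the next level at `r + mu * u`, which
  -- contracts the distance to `p` by `|mu|`. Changing from one occurrence of a patch to another
  -- costs at most `w`, as patches of level at least `K0` are longer than `R`.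
  have key : ∀ j, ∀ i z, place σ.len (C.π z) (σ.patch (K0 + j) i) ⊆ T →
      |C.ρ z - t - p| ≤ |mu| ^ j * (ℓ + |p|) + ε / 2 := by
    intro j
    induction j with
    | zero =>
      intro i z hz
      have h1 := (hpos z).mem_Icc (SubstitutionRule.mem_vert_of_place_patch hz)
      have := abs_sub (C.ρ z - t) p
      rw [abs_of_nonneg h1.1] at this
      simp only [pow_zero, one_mul]
      linarith [h1.2]
    | succ j ih =>
      intro i z hz
      obtain ⟨x, hx⟩ := hT.exists_place_patch (K0 + j) i
      obtain ⟨a, ha⟩ := hTT' _ (finite_place x (σ.patch (K0 + j) i)) hx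
      have hx' := place_subset_of_shift ha
      have hxv := SubstitutionRule.mem_vert_of_place_patch hx
      have hxv' := SubstitutionRule.mem_vert_of_place_patch hx'
      have hxv2 := hxv
      rw [hT.2.1] at hxv2
      obtain ⟨y, hy, rfl⟩ := hxv2
      obtain ⟨c', u, z', hu, hz', hzu⟩ := hr _ hxv'
      have h1 := σ.place_flatMap_subset hx'
      rw [← σ.patch_succ, happ, hz', add_assoc] at h1
      rw [← add_assoc] at hz
      have hlev := hK0 (K0 + j) (by omega) i
      have hlev' := hK0 (K0 + j + 1) (by omega) i
      have h2 : |C.ρ z - t - (C.ρ z' - t)| ≤ w :=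
        (hpos z).abs_sub_le (SubstitutionRule.mem_vert_of_place_patch hz) (hpos z')
          (SubstitutionRule.mem_vert_of_place_patch h1) hR fun s hs hs' =>
          hT.1.pattern_eq σ.len_pos σ.len_pos hT.1 hz h1 rfl hs (hs'.trans_le hlev')
      have h3 : |u - (C.ρ y - t)| ≤ w :=
        hu.abs_sub_le hxv' (hpos y) hxv hR fun s hs hs' =>
          hT'.pattern_eq σ.len_pos σ.len_pos hT.1 hx' hx rfl hs (hs'.trans_le hlev)
      have h4 := ih i y hx
      have h5 : C.ρ z - t - p = (C.ρ z - t - (C.ρ z' - t)) +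
          mu * ((u - (C.ρ y - t)) + (C.ρ y - t - p)) := by
        rw [hzu, hpr]; ring
      rw [h5]
      refine (abs_add_le _ _).trans ?_
      rw [abs_mul]
      have h6 := (abs_add_le (u - (C.ρ y - t)) (C.ρ y - t - p)).trans (add_le_add h3 h4)
      have h7 := mul_le_mul_of_nonneg_left h6 (abs_nonneg mu)
      have h8 : |mu| * w ≤ w := by
        have := mul_le_mul_of_nonneg_right hmu.le hw0.le
        linarith
      have h9 : w + (w + |mu| * (ε / 2)) = ε / 2 := by rw [hw]; ring
      have h10 : |mu| * (w + (|mu| ^ j * (ℓ + |p|) + ε / 2)) =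
          |mu| * w + |mu| ^ (j + 1) * (ℓ + |p|) + |mu| * (ε / 2) := by ring
      linarith
  have hlim : Filter.Tendsto (fun j : ℕ => |mu| ^ j * (ℓ + |p|)) Filter.atTop (nhds 0) := by
    simpa using (tendsto_pow_atTop_nhds_zero_of_lt_one (abs_nonneg mu) hmu).mul_const (ℓ + |p|)
  obtain ⟨J, hJ⟩ := (hlim.eventually (gt_mem_nhds (half_pos hε))).exists_forall_of_atTop
  refine ⟨K0 + J, fun k hk i z hz => ?_⟩
  obtain ⟨j, rfl⟩ := Nat.exists_eq_add_of_le hk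
  rw [add_assoc] at hz
  have h1 := key _ i z hz
  have h2 := hJ (J + j) (by omega)
  linarith

/-- The fixed points that belong to two rules with the same patches of every level coincide. -/
lemma fixedPoint_eq (hπ : Function.Injective C.π) {σ₁ σ₂ : SubstitutionRule}
    {T₁ T₁' : Set (ℝ × Fin σ₁.card)} {T₂ T₂' : Set (ℝ × Fin σ₂.card)} {mu₁ r₁ mu₂ r₂ : ℝ}
    (hmu₁ : |mu₁| < 1) (hT₁ : σ₁.IsLabelling (C.vset (halfOpen c t (t + ℓ))) T₁)
    (hT₁' : IsTiling σ₁.len T₁') (hTT₁ : PatchesAppear T₁ T₁') (happ₁ : σ₁.apply T₁' = T₁)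
    (hr₁ : C.PredShift ℓ t σ₁.factor mu₁ T₁' r₁)
    (hmu₂ : |mu₂| < 1) (hT₂ : σ₂.IsLabelling (C.vset (halfOpen c t (t + ℓ))) T₂)
    (hT₂' : IsTiling σ₂.len T₂') (hTT₂ : PatchesAppear T₂ T₂') (happ₂ : σ₂.apply T₂' = T₂)
    (hr₂ : C.PredShift ℓ t σ₂.factor mu₂ T₂' r₂) (hσ : σ₁.PatchEquivalent σ₂) :
    r₁ / (1 - mu₁) = r₂ / (1 - mu₂) := by
  refine eq_of_forall_dist_le fun ε hε => ?_
  rw [Real.dist_eq]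
  have hε3 : 0 < ε / 3 := by positivity
  obtain ⟨K₁, hK₁⟩ := C.position_tendsto hπ hmu₁ hT₁ hT₁' hTT₁ happ₁ hr₁ hε3
  obtain ⟨K₂, hK₂⟩ := C.position_tendsto hπ hmu₂ hT₂ hT₂' hTT₂ happ₂ hr₂ hε3
  obtain ⟨R, hR⟩ := C.exists_cover hε3 ℓ
  obtain ⟨K₃, hK₃⟩ := σ₁.exists_level R
  -- At this single level both patches are within `ε / 3` of their fixed points and, having one
  -- shape of length at least `R`, within `ε / 3` of each other. It does no harm that `j` depends on
  -- `k`.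
  set k := max K₁ (max K₂ K₃)
  obtain ⟨⟨-, i⟩, -⟩ := hT₁.1.nonempty
  obtain ⟨j, hj⟩ := hσ.1 i k
  obtain ⟨x, hx⟩ := hT₁.exists_place_patch k i
  obtain ⟨y, hy⟩ := hT₂.exists_place_patch k j
  have hxv := SubstitutionRule.mem_vert_of_place_patch hx
  have hyv := SubstitutionRule.mem_vert_of_place_patch hy
  have hxv2 := hxv
  have hyv2 := hyv
  rw [hT₁.2.1] at hxv2
  rw [hT₂.2.1] at hyv2
  obtain ⟨z, -, rfl⟩ := hxv2
  obtain ⟨z', -, rfl⟩ := hyv2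
  have h1 := hK₁ k (le_max_left _ _) i z hx
  have h2 := hK₂ k ((le_max_left _ _).trans (le_max_right _ _)) j z' hy
  have h3 : |C.ρ z - t - (C.ρ z' - t)| ≤ ε / 3 :=
    (C.posAt_of_mem_vert hπ hT₁.2.1).abs_sub_le hxv (C.posAt_of_mem_vert hπ hT₂.2.1) hyv hR
      fun s hs hs' => hT₁.1.pattern_eq σ₁.len_pos σ₂.len_pos hT₂.1 hx hy hj hs
        (hs'.trans_le (hK₃ k ((le_max_right _ _).trans (le_max_right _ _)) i))
  rw [abs_lt] at h1 h2
  rw [abs_le] at h3 ⊢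
  constructor <;> linarith [h1.1, h1.2, h2.1, h2.2, h3.1, h3.2]

/-! ### Consequences of self-similarity -/

/-- A vector with `|ρ g| < ℓ` joins two vertices of `T`. A copy of this pair occurs in `T'`, and its
inflation is again a pair of vertices of `T`. -/
lemma exists_lam_mul (hℓ : 0 < ℓ) {σ : SubstitutionRule}
    {T T' : Set (ℝ × Fin σ.card)} (hV : vert T = C.vset (halfOpen c t (t + ℓ)))
    (hTT' : PatchesAppear T T') (happ : σ.apply T' = T) {g : G} (hg : |C.ρ g| < ℓ) :
    ∃ g', σ.factor * C.π g = C.π g' ∧ |C.ρ g'| < ℓ := by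
  have h1 : ∃ z, C.ρ z ∈ halfOpen c t (t + ℓ) ∧ C.ρ (z + g) ∈ halfOpen c t (t + ℓ) := by
    rw [abs_lt] at hg
    obtain ⟨z, h1, h2, -⟩ := C.dense (max t (t - C.ρ g)) (min (t + ℓ) (t + ℓ - C.ρ g)) 0 (by
      rw [max_lt_iff, lt_min_iff, lt_min_iff]
      refine ⟨⟨by linarith, by linarith⟩, by linarith, by linarith⟩)
    rw [max_lt_iff] at h1
    rw [lt_min_iff] at h2
    exact ⟨z, mem_halfOpen_of_lt h1.1 h2.1, mem_halfOpen_of_lt (by rw [map_add]; linarith)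
      (by rw [map_add]; linarith)⟩
  obtain ⟨z, hz, hzg⟩ := h1
  obtain ⟨a, h2, h3⟩ := PatchesAppear.exists_pair hTT' (x := C.π z) (y := C.π (z + g))
    (hV ▸ ⟨z, hz, rfl⟩) (hV ▸ ⟨z + g, hzg, rfl⟩)
  have h4 := σ.factor_mul_mem_vert h2
  have h5 := σ.factor_mul_mem_vert h3
  rw [happ, hV] at h4 h5
  obtain ⟨g', h6, h7⟩ := C.exists_sub_eq_of_mem_vset h5 h4
  exact ⟨g', by rw [← h6, map_add]; ring, h7⟩

/-- The vectors whose inflation lifts form a subgroup, and it contains the generators `|ρ g| < ℓ`.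
-/
lemma exists_lam_mul' (hℓ : 0 < ℓ) {σ : SubstitutionRule}
    {T T' : Set (ℝ × Fin σ.card)} (hV : vert T = C.vset (halfOpen c t (t + ℓ)))
    (hTT' : PatchesAppear T T') (happ : σ.apply T' = T) (g : G) :
    ∃ g', σ.factor * C.π g = C.π g' := by
  have : (AddSubgroup.comap ((AddMonoidHom.mulLeft σ.factor).comp C.π) C.π.range) = ⊤ := by
    refine C.eq_top_of_forall_abs_lt hℓ _ fun g hg => ?_
    obtain ⟨g', h, -⟩ := C.exists_lam_mul hℓ hV hTT' happ hg
    exact ⟨g', h.symm⟩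
  have h2 : g ∈ (AddSubgroup.comap ((AddMonoidHom.mulLeft σ.factor).comp C.π) C.π.range) :=
    this ▸ AddSubgroup.mem_top g
  obtain ⟨g', hg'⟩ := h2
  exact ⟨g', hg'.symm⟩

/-- Pigeonhole: there is one vertex more than there are labels, so two of the copies in `S` carry
the same label and inflate to two copies of one level-`k` patch. -/
lemma _root_.IntervalProjection.SubstitutionRule.exists_same_patch {σ : SubstitutionRule}
    {T S : Set (ℝ × Fin σ.card)} {k : ℕ} (hTS : PatchesAppear T S) (happ : σ.apply^[k] S = T)
    (x : Fin (σ.card + 1) → ℝ) (hx : ∀ a, x a ∈ vert T) :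
    ∃ a b i y y', a < b ∧ place σ.len y (σ.patch k i) ⊆ T ∧ place σ.len y' (σ.patch k i) ⊆ T ∧
      y' - y = σ.factor ^ k * (x b - x a) := by
  choose τ hτ using hx
  obtain ⟨s, hs⟩ := hTS (Set.range fun a => (x a, τ a)) (Set.finite_range _) (by
    rintro _ ⟨a, rfl⟩
    exact hτ a)
  have hs' : ∀ a, (x a + s, τ a) ∈ S := fun a => hs _ ⟨a, rfl⟩
  have hp : ∀ a, place σ.len (σ.factor ^ k * (x a + s)) (σ.patch k (τ a)) ⊆ T := fun a =>
    happ ▸ σ.place_patch_subset (hs' a) k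
  obtain ⟨a, b, hab, h⟩ := Fintype.exists_ne_map_eq_of_card_lt τ (by simp)
  rcases lt_or_gt_of_ne hab with hlt | hlt
  · exact ⟨a, b, τ a, _, _, hlt, hp a, h ▸ hp b, by ring⟩
  · exact ⟨b, a, τ b, _, _, hlt, hp b, h ▸ hp a, by ring⟩

/-- The contraction in the window space is bounded by the recurrence of the patches. -/
lemma abs_pow_mul_le (hπ : Function.Injective C.π) (hℓ : 0 < ℓ) {σ : SubstitutionRule}
    {T S : Set (ℝ × Fin σ.card)} {mu : ℝ} (hT : IsTiling σ.len T)
    (hV : vert T = C.vset (halfOpen c t (t + ℓ)))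
    (m : G → G) (hmπ : ∀ g, C.π (m g) = σ.factor * C.π g) (hmρ : ∀ g, C.ρ (m g) = mu * C.ρ g)
    {k : ℕ} (hTS : PatchesAppear T S) (happ : σ.apply^[k] S = T)
    {w R : ℝ} (hcov : C.Covers w R) (hR : ∀ i, R ≤ σ.factor ^ k * σ.len i) :
    |mu| ^ k * (ℓ / (σ.card + 1) / 2) ≤ w := by
  set η := ℓ / (σ.card + 1) with hη
  have hη0 : 0 < η := by positivity
  have hηℓ : (σ.card + 1) * η = ℓ := by rw [hη]; field_simp
  -- The chosen vertices are spread over the window with gaps of at least `η / 2`, so whichever pair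
  -- repeats, the two patches differ in position by at least `|mu| ^ k * (η / 2)`.
  have h1 : ∀ a : Fin (σ.card + 1), ∃ g, t + a * η < C.ρ g ∧ C.ρ g < t + a * η + η / 2 := by
    intro a
    obtain ⟨g, h1, h2, -⟩ := C.dense (t + a * η) (t + a * η + η / 2) 0 (by linarith)
    exact ⟨g, h1, h2⟩
  choose g hg1 hg2 using h1
  have hgV : ∀ a, C.π (g a) ∈ vert T := by
    intro a
    rw [hV]
    refine ⟨g a, mem_halfOpen_of_lt ?_ ?_, rfl⟩
    · have : 0 ≤ (a : ℝ) * η := by positivity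
      linarith [hg1 a]
    · have : (a : ℝ) ≤ σ.card := by exact_mod_cast Nat.lt_succ_iff.1 a.2
      have := mul_le_mul_of_nonneg_right this hη0.le
      linarith [hg2 a]
  obtain ⟨a, b, i, y, y', hab, hy, hy', hyy⟩ :=
    SubstitutionRule.exists_same_patch hTS happ _ hgV
  have hyv := SubstitutionRule.mem_vert_of_place_patch hy
  have hyv' := SubstitutionRule.mem_vert_of_place_patch hy'
  have hyv2 := hyv
  have hyv2' := hyv'
  rw [hV] at hyv2 hyv2'
  obtain ⟨z, -, rfl⟩ := hyv2
  obtain ⟨z', -, rfl⟩ := hyv2'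
  have h3 : |C.ρ z - t - (C.ρ z' - t)| ≤ w :=
    (C.posAt_of_mem_vert hπ hV).abs_sub_le hyv (C.posAt_of_mem_vert hπ hV) hyv'
      (fun a _ _ => hcov a) fun s hs hs' => hT.pattern_eq σ.len_pos σ.len_pos hT hy hy' rfl hs
        (hs'.trans_le (by rw [σ.sum_patch]; exact hR i))
  have hit : ∀ k g, C.π (m^[k] g) = σ.factor ^ k * C.π g ∧ C.ρ (m^[k] g) = mu ^ k * C.ρ g := by
    intro k g
    induction k with
    | zero => simp
    | succ k ih =>
      rw [Function.iterate_succ_apply', hmπ, hmρ, ih.1, ih.2]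
      constructor <;> ring
  have h4 : z' - z = m^[k] (g b - g a) := by
    apply hπ
    rw [map_sub, hyy, (hit _ _).1, map_sub]
  have h5 : C.ρ z' - C.ρ z = mu ^ k * (C.ρ (g b) - C.ρ (g a)) := by
    rw [← map_sub, h4, (hit _ _).2, map_sub]
  have h6 : η / 2 ≤ C.ρ (g b) - C.ρ (g a) := by
    have : (a : ℝ) + 1 ≤ b := by exact_mod_cast hab
    have := mul_le_mul_of_nonneg_right this hη0.le
    linarith [hg1 b, hg2 a]
  calc |mu| ^ k * (η / 2) ≤ |mu| ^ k * |C.ρ (g b) - C.ρ (g a)| :=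
        mul_le_mul_of_nonneg_left (h6.trans (le_abs_self _)) (by positivity)
    _ = |C.ρ z - t - (C.ρ z' - t)| := by
        rw [← abs_pow, ← abs_mul, ← h5, ← abs_neg]
        congr 1
        ring
    _ ≤ w := h3

end CutScheme

/-! ### Arithmetic of the end points -/

lemma mem_place_iff {n : ℕ} {len : Fin n → ℝ} {x : ℝ} {L : List (Fin n)} {p : ℝ × Fin n} :
    p ∈ place len x L ↔
      ∃ a : Fin L.length, p = (x + ((L.take a).map len).sum, L[a]) := by
  induction L generalizing x with
  | nil => simp
  | cons i L ih =>
    rw [place_cons, Set.mem_insert_iff, ih]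
    constructor
    · rintro (rfl | ⟨a, rfl⟩)
      · exact ⟨⟨0, by simp⟩, by simp⟩
      · exact ⟨a.succ, by simp [add_assoc]⟩
    · rintro ⟨a, rfl⟩
      refine Fin.cases ?_ (fun a => ?_) a
      · left; simp
      · right; exact ⟨a, by simp [add_assoc]⟩

/-- The greatest lower bound of a set or, if `b` is `false`, its least upper bound. -/
def IsExtreme (b : Bool) (S : Set ℝ) (m : ℝ) : Prop := if b = true then IsGLB S m else IsLUB S m

lemma IsExtreme.unique {b : Bool} {S : Set ℝ} {m m' : ℝ} (h : IsExtreme b S m)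
    (h' : IsExtreme b S m') : m = m' := by
  cases b
  · exact IsLUB.unique h h'
  · exact IsGLB.unique h h'

lemma exists_isExtreme {S : Set ℝ} (hS : S.Nonempty) {A B : ℝ} (h : ∀ u ∈ S, A ≤ u ∧ u ≤ B)
    (b : Bool) : ∃ m, IsExtreme b S m := by
  cases b
  · exact ⟨_, isLUB_csSup hS ⟨B, fun u hu => (h u hu).2⟩⟩
  · exact ⟨_, isGLB_csInf hS ⟨A, fun u hu => (h u hu).1⟩⟩

lemma exists_isExtreme_iUnion {ι : Type*} [Finite ι] [Nonempty ι] {S : ι → Set ℝ} {m : ι → ℝ}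
    {b : Bool} (h : ∀ a, IsExtreme b (S a) (m a)) : ∃ a, IsExtreme b (⋃ a, S a) (m a) := by
  cases b
  · obtain ⟨a, ha⟩ := Finite.exists_max m
    refine ⟨a, fun u hu => ?_, fun u hu => ?_⟩
    · obtain ⟨a', hu⟩ := Set.mem_iUnion.1 hu
      exact ((h a').1 hu).trans (ha a')
    · exact (h a).2 fun v hv => hu (Set.mem_iUnion.2 ⟨a, hv⟩)
  · obtain ⟨a, ha⟩ := Finite.exists_min m
    refine ⟨a, fun u hu => ?_, fun u hu => ?_⟩
    · obtain ⟨a', hu⟩ := Set.mem_iUnion.1 hu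
      exact (ha a').trans ((h a').1 hu)
    · exact (h a).2 fun v hv => hu (Set.mem_iUnion.2 ⟨a, hv⟩)

lemma IsExtreme.image {b : Bool} {S : Set ℝ} {m : ℝ} (h : IsExtreme b S m) {r mu : ℝ}
    (hmu : mu ≠ 0) :
    IsExtreme (if 0 < mu then b else !b) ((fun u => r + mu * u) '' S) (r + mu * m) := by
  rcases lt_or_gt_of_ne hmu with hneg | hpos
  · rw [if_neg hneg.not_gt]
    cases b
    · refine ⟨?_, fun u hu => ?_⟩
      · rintro _ ⟨u, hu, rfl⟩
        have := mul_le_mul_of_nonpos_left (h.1 hu) hneg.le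
        simp only; linarith
      · have : m ≤ (u - r) / mu := h.2 fun v hv => by
          rw [le_div_iff_of_neg hneg]
          have := hu ⟨v, hv, rfl⟩
          simp only at this; linarith
        rw [le_div_iff_of_neg hneg] at this
        linarith
    · refine ⟨?_, fun u hu => ?_⟩
      · rintro _ ⟨u, hu, rfl⟩
        have := mul_le_mul_of_nonpos_left (h.1 hu) hneg.le
        simp only; linarith
      · have : (u - r) / mu ≤ m := h.2 fun v hv => by
          rw [div_le_iff_of_neg hneg]
          have := hu ⟨v, hv, rfl⟩
          simp only at this; linarith
        rw [div_le_iff_of_neg hneg] at this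
        linarith
  · rw [if_pos hpos]
    cases b
    · refine ⟨?_, fun u hu => ?_⟩
      · rintro _ ⟨u, hu, rfl⟩
        have := mul_le_mul_of_nonneg_left (h.1 hu) hpos.le
        simp only; linarith
      · have : m ≤ (u - r) / mu := h.2 fun v hv => by
          rw [le_div_iff₀ hpos]
          have := hu ⟨v, hv, rfl⟩
          simp only at this; linarith
        rw [le_div_iff₀ hpos] at this
        linarith
    · refine ⟨?_, fun u hu => ?_⟩
      · rintro _ ⟨u, hu, rfl⟩
        have := mul_le_mul_of_nonneg_left (h.1 hu) hpos.le
        simp only; linarith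
      · have : (u - r) / mu ≤ m := h.2 fun v hv => by
          rw [div_le_iff₀ hpos]
          have := hu ⟨v, hv, rfl⟩
          simp only at this; linarith
        rw [div_le_iff₀ hpos] at this
        linarith

/-- Two sets that approximate each other have the same extreme values. -/
lemma IsExtreme.congr_of_approx {b : Bool} {S S' : Set ℝ} {m : ℝ} (h : IsExtreme b S m)
    (h1 : ∀ u ∈ S, ∀ ε > 0, ∃ u' ∈ S', |u - u'| ≤ ε)
    (h2 : ∀ u ∈ S', ∀ ε > 0, ∃ u' ∈ S, |u - u'| ≤ ε) : IsExtreme b S' m := by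
  cases b
  · refine ⟨fun u hu => ?_, fun v hv => ?_⟩
    · refine le_of_forall_pos_le_add fun ε hε => ?_
      obtain ⟨u', hu', h3⟩ := h2 u hu ε hε
      have := h.1 hu'
      linarith [(abs_le.1 h3).2]
    · refine h.2 fun u hu => le_of_forall_pos_le_add fun ε hε => ?_
      obtain ⟨u', hu', h3⟩ := h1 u hu ε hε
      have := hv hu'
      linarith [(abs_le.1 h3).2]
  · refine ⟨fun u hu => ?_, fun v hv => ?_⟩
    · refine le_of_forall_pos_le_add fun ε hε => ?_
      obtain ⟨u', hu', h3⟩ := h2 u hu ε hε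
      have := h.1 hu'
      linarith [(abs_le.1 h3).1]
    · refine h.2 fun u hu => le_of_forall_pos_le_add fun ε hε => ?_
      obtain ⟨u', hu', h3⟩ := h1 u hu ε hε
      have := hv hu'
      linarith [(abs_le.1 h3).1]

/-- A finite system of affine equations with common slope `mu` is solved in any field that contains
its coefficients. -/
lemma mem_of_forall_sub_mul_mem {X : Type*} [Finite X] (φ : X → X) (f : X → ℝ) (K : Subfield ℝ)
    {mu : ℝ} (hmu : mu ∈ K) (hmu1 : |mu| < 1) (h : ∀ x, f x - mu * f (φ x) ∈ K) (x : X) :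
    f x ∈ K := by
  have hit : ∀ k x, f x - mu ^ k * f (φ^[k] x) ∈ K := by
    intro k
    induction k with
    | zero => intro x; simp
    | succ k ih =>
      intro x
      have h1 := K.add_mem (ih x) (K.mul_mem (K.pow_mem hmu k) (h (φ^[k] x)))
      rw [Function.iterate_succ_apply']
      convert h1 using 1
      ring
  -- The orbit of `x` under `φ` is eventually periodic. Going once around the cycle gives `f y * (1
  -- - mu ^ (k + 1)) ∈ K`, which can be solved because `|mu| < 1`.
  obtain ⟨a, b, hab, he⟩ := Set.finite_univ.exists_lt_map_eq_of_forall_mem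
    (f := fun k : ℕ => φ^[k] x) (fun _ => Set.mem_univ _)
  obtain ⟨k, rfl⟩ := Nat.exists_eq_add_of_lt hab
  have h1 := hit (k + 1) (φ^[a] x)
  rw [← Function.iterate_add_apply, add_comm (k + 1) a, ← add_assoc, ← he] at h1
  have h2 : 1 - mu ^ (k + 1) ≠ 0 := by
    intro h0
    have h3 : |mu ^ (k + 1)| = 1 := by rw [show mu ^ (k + 1) = 1 by linarith, abs_one]
    rw [abs_pow] at h3
    exact (pow_lt_one₀ (abs_nonneg mu) hmu1 (Nat.succ_ne_zero k)).ne h3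
  have h3 : f (φ^[a] x) ∈ K := by
    have h4 := K.div_mem h1 (K.sub_mem K.one_mem (K.pow_mem hmu (k + 1)))
    rwa [show f (φ^[a] x) - mu ^ (k + 1) * f (φ^[a] x) = f (φ^[a] x) * (1 - mu ^ (k + 1)) by ring,
      mul_div_cancel_right₀ _ h2] at h4
  have h4 := K.add_mem (hit a x) (K.mul_mem (K.pow_mem hmu a) h3)
  simpa using h4

namespace CutScheme

variable {G : Type*} [AddCommGroup G] (C : CutScheme G)

/-- The positions of the tiles with a given label. -/
def labelPos (ℓ : ℝ) {n : ℕ} (T : Set (ℝ × Fin n)) (i : Fin n) : Set ℝ :=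
  {u | ∃ x c, (x, i) ∈ T ∧ C.PosAt ℓ (vert T) x c u}

/-- A long word starting at a tile pins the position of that tile, and a copy of the word in `T'`
starts with the same label. -/
lemma labelPos_approx {n : ℕ} {len : Fin n → ℝ} {T T' : Set (ℝ × Fin n)} {ℓ : ℝ}
    (hlen : ∀ i, 0 < len i) (hT : IsTiling len T) (hT' : IsTiling len T')
    (hTT' : PatchesAppear T T') (hpos : ∀ x ∈ vert T', ∃ c u, C.PosAt ℓ (vert T') x c u)
    (i : Fin n) : ∀ u ∈ C.labelPos ℓ T i, ∀ ε > 0, ∃ u' ∈ C.labelPos ℓ T' i, |u - u'| ≤ ε := by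
  rintro u ⟨x, c, hxi, hx⟩ ε hε
  obtain ⟨R, hR⟩ := C.exists_cover hε ℓ
  obtain ⟨L, hL, hs⟩ := hT.exists_word hlen hxi R
  obtain ⟨a, ha⟩ := hTT' _ (finite_place _ _) hL
  have hL' := place_subset_of_shift ha
  have h1 : (x + a, i) ∈ T' := hL' (by simp)
  obtain ⟨c', u', hu'⟩ := hpos _ ⟨i, h1⟩
  refine ⟨u', ⟨_, c', h1, hu'⟩, hx.abs_sub_le ⟨i, hxi⟩ hu' ⟨i, h1⟩ hR fun s hs1 hs2 => ?_⟩
  exact hT.pattern_eq hlen hlen hT' hL hL' rfl hs1 (hs2.trans_le hs)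

/-- A tile labelled `j` sits at one of finitely many offsets inside an inflated tile of `T'`, so
extreme positions of labels are affine functions of each other with slope `mu`. The unknown `r`
disappears when positions are measured from the fixed point `p`, so all differences from `p` lie in
`K`; the end `0` of the window then yields `p`, and the end `ℓ` yields `ℓ`. -/
lemma shift_and_length_mem (hπ : Function.Injective C.π) {ℓ t : ℝ} (hℓ : 0 < ℓ) {c : Bool}
    {σ : SubstitutionRule} {T T' : Set (ℝ × Fin σ.card)} {mu r : ℝ} (hmu : |mu| < 1)
    (hmu0 : mu ≠ 0) (hT : σ.IsLabelling (C.vset (halfOpen c t (t + ℓ))) T)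
    (hT' : IsTiling σ.len T')
    (hLI : LocallyIsomorphic T' T) (happ : σ.apply T' = T)
    (hr : C.PredShift ℓ t σ.factor mu T' r) (K : Subfield ℝ) (hmuK : mu ∈ K)
    (hρK : ∀ g, C.ρ g ∈ K) : r ∈ K ∧ ℓ ∈ K := by
  obtain ⟨hTt, hV, hocc, -⟩ := hT
  have hpos : ∀ x ∈ vert T, ∃ c u, C.PosAt ℓ (vert T) x c u := by
    intro x hx
    have hx2 := hx
    rw [hV] at hx2
    obtain ⟨z, -, rfl⟩ := hx2
    exact ⟨_, _, C.posAt_of_mem_vert hπ hV⟩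
  have hpos' : ∀ x ∈ vert T', ∃ c u, C.PosAt ℓ (vert T') x c u := by
    intro x hx
    obtain ⟨c, u, -, h, -⟩ := hr x hx
    exact ⟨c, u, h⟩
  have hne : ∀ i, (C.labelPos ℓ T i).Nonempty := by
    intro i
    obtain ⟨x, hx⟩ := hocc i
    obtain ⟨c, u, h⟩ := hpos x ⟨i, hx⟩
    exact ⟨u, x, c, hx, h⟩
  have hbd : ∀ i, ∀ u ∈ C.labelPos ℓ T i, 0 ≤ u ∧ u ≤ ℓ := by
    rintro i u ⟨x, c, hx, h⟩
    exact h.mem_Icc ⟨i, hx⟩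
  choose e he using fun (s : Fin σ.card × Bool) => exists_isExtreme (hne s.1) (hbd s.1) s.2
  have he' : ∀ s : Fin σ.card × Bool, IsExtreme s.2 (C.labelPos ℓ T' s.1) (e s) := fun s =>
    (he s).congr_of_approx (C.labelPos_approx σ.len_pos hTt hT' hLI.2 hpos' s.1)
      (C.labelPos_approx σ.len_pos hT' hTt hLI.1 hpos s.1)
  have hoff : ∀ i (a : Fin (σ.repl i).length),
      ∃ d, (((σ.repl i).take a).map σ.len).sum = C.π d := by
    intro i a
    obtain ⟨x, hx⟩ := hocc i
    obtain ⟨s, hs⟩ := hLI.2 {(x, i)} (by simp) (by simpa using hx)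
    have hx' := hs (x, i) rfl
    have h1 := σ.place_flatMap_subset (S := T') (x := x + s) (L := [i]) (by simpa using hx')
    rw [List.flatMap_singleton, happ] at h1
    have h2 : σ.factor * (x + s) + (((σ.repl i).take a).map σ.len).sum ∈ vert T :=
      ⟨_, h1 (mem_place_iff.2 ⟨a, rfl⟩)⟩
    have h3 := σ.factor_mul_mem_vert (S := T') ⟨i, hx'⟩
    rw [happ] at h3
    rw [hV] at h2 h3
    obtain ⟨g, hg, -⟩ := C.exists_sub_eq_of_mem_vset h2 h3
    exact ⟨g, by rw [← hg]; simp⟩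
  choose d hd using hoff
  have hU : ∀ j, C.labelPos ℓ T j =
      ⋃ s : {s : (i : Fin σ.card) × Fin (σ.repl i).length // (σ.repl s.1).get s.2 = j},
        (fun u => r + C.ρ (d s.1.1 s.1.2) + mu * u) '' C.labelPos ℓ T' s.1.1 := by
    intro j
    ext v
    rw [Set.mem_iUnion]
    constructor
    · rintro ⟨y, c', hy, hv⟩
      have hy2 := hy
      rw [← happ] at hy2
      obtain ⟨⟨x, i⟩, hx, hy3⟩ := Set.mem_iUnion₂.1 hy2
      obtain ⟨a, ha⟩ := mem_place_iff.1 hy3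
      rw [Prod.mk.injEq] at ha
      obtain ⟨c'', u, z, hu, hz, hzu⟩ := hr x ⟨i, hx⟩
      refine ⟨⟨⟨i, a⟩, ha.2.symm⟩, u, ⟨x, c'', hx, hu⟩, ?_⟩
      have h1 := (C.posAt_of_mem_vert hπ hV (z := z)).add (d i a)
      rw [← hz, ← hd, ← ha.1] at h1
      have := h1.unique ⟨j, hy⟩ hv
      simp only
      rw [← this, hzu]; ring
    · rintro ⟨⟨⟨i, a⟩, ha⟩, _, ⟨x, c', hx, hu⟩, rfl⟩
      obtain ⟨c'', u, z, hu', hz, hzu⟩ := hr x ⟨i, hx⟩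
      rw [hu'.unique ⟨i, hx⟩ hu] at hzu
      refine ⟨σ.factor * x + C.π (d i a), c, ?_, ?_⟩
      · rw [← happ]
        refine Set.mem_iUnion₂.2 ⟨(x, i), hx, mem_place_iff.2 ⟨a, ?_⟩⟩
        rw [Prod.mk.injEq]
        exact ⟨by rw [← hd], ha.symm⟩
      · have h1 := (C.posAt_of_mem_vert hπ hV (z := z)).add (d i a)
        rw [← hz, hzu] at h1
        convert h1 using 1
        simp only; ring
  set p := r / (1 - mu) with hp
  have hmu1 : 0 < 1 - mu := by have := le_abs_self mu; linarith
  have hpr : r = p - mu * p := by rw [hp]; field_simp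
  have hstep : ∀ s : Fin σ.card × Bool, ∃ s' g, e s = r + C.ρ g + mu * e s' := by
    rintro ⟨j, b⟩
    -- A negative slope exchanges infima and suprema.
    set b' : Bool := if 0 < mu then b else !b with hb'
    have hbb : (if 0 < mu then b' else !b') = b := by
      rw [hb']; split_ifs <;> simp
    have h1 := he (j, b)
    simp only at h1
    rw [hU] at h1
    have hnon : Nonempty
        {s : (i : Fin σ.card) × Fin (σ.repl i).length // (σ.repl s.1).get s.2 = j} := by
      obtain ⟨u, hu⟩ := hne j
      rw [hU] at hu
      obtain ⟨s, -⟩ := Set.mem_iUnion.1 hu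
      exact ⟨s⟩
    obtain ⟨s, hs⟩ := exists_isExtreme_iUnion (b := b) (fun s :
        {s : (i : Fin σ.card) × Fin (σ.repl i).length // (σ.repl s.1).get s.2 = j} => by
      have := (he' (s.1.1, b')).image (r := r + C.ρ (d s.1.1 s.1.2)) hmu0
      rw [hbb] at this
      exact this)
    exact ⟨_, _, h1.unique hs⟩
  choose φ g hφ using hstep
  have hmem : ∀ s, e s - p ∈ K := by
    refine mem_of_forall_sub_mul_mem φ (fun s => e s - p) K hmuK hmu fun s => ?_
    have : e s - p - mu * (e (φ s) - p) = C.ρ (g s) := by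
      rw [hφ s]
      linear_combination hpr
    rw [this]
    exact hρK _
  -- The positions of all labels together are dense in `[0, ℓ]`, so the ends of the window are
  -- extreme values of particular labels.
  have hall : ∀ b : Bool, ∃ s, IsExtreme b (Set.Icc 0 ℓ) (e s) := by
    intro b
    have hnon : Nonempty (Fin σ.card) := by
      obtain ⟨⟨-, i⟩, -⟩ := hTt.nonempty
      exact ⟨i⟩
    obtain ⟨i, hi⟩ := exists_isExtreme_iUnion (b := b) fun i => he (i, b)
    refine ⟨_, hi.congr_of_approx ?_ ?_⟩
    · intro u hu ε hε
      obtain ⟨i, hu⟩ := Set.mem_iUnion.1 hu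
      exact ⟨u, hbd i u hu, by simpa using hε.le⟩
    · intro u hu ε hε
      obtain ⟨z, h1, h2, -⟩ := C.dense (max t (t + u - ε)) (min (t + ℓ) (t + u + ε)) 0 (by
        rw [max_lt_iff, lt_min_iff, lt_min_iff]
        refine ⟨⟨by linarith, by linarith [hu.1]⟩, by linarith [hu.2], by linarith⟩)
      rw [max_lt_iff] at h1
      rw [lt_min_iff] at h2
      have hz : C.π z ∈ vert T := by
        rw [hV]
        exact ⟨z, mem_halfOpen_of_lt h1.1 h2.1, rfl⟩
      obtain ⟨i, hi⟩ := hz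
      refine ⟨C.ρ z - t, Set.mem_iUnion.2 ⟨i, _, c, hi, C.posAt_of_mem_vert hπ hV⟩, ?_⟩
      rw [abs_le]
      constructor <;> linarith
  obtain ⟨s0, hs0⟩ := hall true
  obtain ⟨s1, hs1⟩ := hall false
  have h0 : e s0 = 0 := IsGLB.unique hs0 (isGLB_Icc hℓ.le)
  have h1 : e s1 = ℓ := IsLUB.unique hs1 (isLUB_Icc hℓ.le)
  have h2 := hmem s0
  have h3 := hmem s1
  rw [h0] at h2
  rw [h1] at h3
  have hpK : p ∈ K := by simpa using K.neg_mem h2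
  refine ⟨?_, by simpa using K.add_mem h3 hpK⟩
  rw [hpr]
  exact K.sub_mem hpK (K.mul_mem hmuK hpK)

end CutScheme

/-! ### Construction of substitution rules -/

lemma above_add_iff {c : Bool} {u a x : ℝ} : Above c (u + a) x ↔ Above c u (x - a) := by
  cases c <;> simp [sub_lt_iff_lt_add]

lemma exists_pos_forall_le {α : Type*} {S : Set α} (hS : S.Finite) (f : α → ℝ)
    (hf : ∀ x ∈ S, 0 < f x) : ∃ δ > 0, ∀ x ∈ S, δ ≤ f x := by
  rcases S.eq_empty_or_nonempty with rfl | hne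
  · exact ⟨1, one_pos, by simp⟩
  · obtain ⟨x, hx, h⟩ := Set.exists_min_image S f hS hne
    exact ⟨f x, hf x hx, h⟩

/-- A self-similarity of a cut and project scheme which maps a window into itself, together with
bounds `W` for the lengths of tiles and `K` for the points that are used to label the tiles. -/
structure WindowMap {G : Type*} [AddCommGroup G] (C : CutScheme G) where
  π_injective : Function.Injective C.π
  m : G ≃+ G
  lam : ℝ
  mu : ℝ
  one_lt_lam : 1 < lam
  mu_ne_zero : mu ≠ 0
  π_map : ∀ g, C.π (m g) = lam * C.π g
  ρ_map : ∀ g, C.ρ (m g) = mu * C.ρ g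
  ℓ : ℝ
  r : ℝ
  fits : ∀ u, 0 ≤ u → u ≤ ℓ → 0 ≤ r + mu * u ∧ r + mu * u ≤ ℓ
  q : ℕ
  q_pos : 0 < q
  e : G
  s : G
  ρ_e : C.ρ e = q * ℓ
  ρ_s : C.ρ s = q * r
  W : ℝ
  cover : ∀ u, 0 ≤ u → u ≤ ℓ → ∃ g, 0 < C.ρ g + u ∧ C.ρ g + u < ℓ ∧ 0 < C.π g ∧ C.π g ≤ W
  K : ℝ
  K_window : |C.π e| + q * W ≤ K
  K_map : K + |C.π s| + q * (lam * W) ≤ lam * K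

namespace WindowMap

variable {G : Type*} [AddCommGroup G] {C : CutScheme G} (D : WindowMap C)

/-- The kind of the image of a half open interval. -/
noncomputable def flip (c : Bool) : Bool := if 0 < D.mu then c else !c

lemma flip_flip (c : Bool) : D.flip (D.flip c) = c := by
  unfold flip; split_ifs <;> simp

lemma lam_pos : 0 < D.lam := zero_lt_one.trans D.one_lt_lam

lemma q_pos' : (0 : ℝ) < D.q := by exact_mod_cast D.q_pos

/-- Comparing `r + mu * u` with `x` amounts to comparing `u` with `(x - r) / mu`. A negative `mu`
replaces a comparison by the negation of the one of the other strictness, which is why the kind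
flips. -/
lemma above_flip_congr {c c' : Bool} {u u' x : ℝ}
    (h : Above c u ((x - D.r) / D.mu) ↔ Above c' u' ((x - D.r) / D.mu)) :
    Above (D.flip c) (D.r + D.mu * u) x ↔ Above (D.flip c') (D.r + D.mu * u') x := by
  rcases lt_or_gt_of_ne D.mu_ne_zero with hneg | hpos
  · have key : ∀ c u, Above (D.flip c) (D.r + D.mu * u) x ↔
        ¬ Above c u ((x - D.r) / D.mu) := by
      intro c u
      unfold flip
      rw [if_neg hneg.not_gt]
      cases c
      · simp only [Bool.not_false, above_true, above_false, not_lt, le_div_iff_of_neg hneg]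
        constructor <;> intro h <;> linarith
      · simp only [Bool.not_true, above_true, above_false, not_le, lt_div_iff_of_neg hneg]
        constructor <;> intro h <;> linarith
    rw [key, key, h]
  · have key : ∀ c u, Above (D.flip c) (D.r + D.mu * u) x ↔
        Above c u ((x - D.r) / D.mu) := by
      intro c u
      unfold flip
      rw [if_pos hpos]
      cases c
      · simp only [above_false, div_lt_iff₀ hpos]
        constructor <;> intro h <;> linarith
      · simp only [above_true, div_le_iff₀ hpos]
        constructor <;> intro h <;> linarith
    rw [key, key, h]

lemma map_mem_halfOpen {c : Bool} {u : ℝ} (hu : u ∈ halfOpen c 0 D.ℓ) :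
    D.r + D.mu * u ∈ halfOpen (D.flip c) 0 D.ℓ := by
  have h1 := mem_Icc_of_mem_halfOpen hu
  have hℓ : 0 ≤ D.ℓ := h1.1.trans h1.2
  have h0 := D.fits 0 le_rfl hℓ
  have h2 := D.fits D.ℓ hℓ le_rfl
  unfold flip
  rcases lt_or_gt_of_ne D.mu_ne_zero with hneg | hpos
  · rw [if_neg hneg.not_gt]
    cases c
    · simp only [halfOpen, Bool.not_false, if_true, Bool.false_eq_true, if_false, Set.mem_Ico,
        Set.mem_Ioc] at hu ⊢
      have h3 := mul_lt_mul_of_neg_left hu.1 hneg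
      have h4 := mul_le_mul_of_nonpos_left hu.2 hneg.le
      constructor <;> linarith
    · simp only [halfOpen, Bool.not_true, if_true, Bool.false_eq_true, if_false, Set.mem_Ico,
        Set.mem_Ioc] at hu ⊢
      have h3 := mul_lt_mul_of_neg_left hu.2 hneg
      have h4 := mul_le_mul_of_nonpos_left hu.1 hneg.le
      constructor <;> linarith
  · rw [if_pos hpos]
    cases c
    · simp only [halfOpen, Bool.false_eq_true, if_false, Set.mem_Ioc] at hu ⊢
      have h3 := mul_lt_mul_of_pos_left hu.1 hpos
      have h4 := mul_le_mul_of_nonneg_left hu.2 hpos.le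
      constructor <;> linarith
    · simp only [halfOpen, if_true, Set.mem_Ico] at hu ⊢
      have h3 := mul_lt_mul_of_pos_left hu.2 hpos
      have h4 := mul_le_mul_of_nonneg_left hu.1 hpos.le
      constructor <;> linarith

/-- The label of a position: its location relative to finitely many points of the window. -/
def label (c : Bool) (u : ℝ) : Set G := {f | |C.π f| ≤ D.K ∧ Above c u (C.ρ f / D.q)}

variable {D}

lemma above_congr {c c' : Bool} {u u' : ℝ} (h : D.label c u = D.label c' u') {f : G}
    (hf : |C.π f| ≤ D.K) : Above c u (C.ρ f / D.q) ↔ Above c' u' (C.ρ f / D.q) := by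
  have := Set.ext_iff.1 h f
  simpa [label, hf] using this

lemma ρ_sub_nsmul_div (f d : G) : C.ρ (f - D.q • d) / D.q = C.ρ f / D.q - C.ρ d := by
  have := D.q_pos'.ne'
  rw [map_sub, map_nsmul, nsmul_eq_mul]
  field_simp

lemma abs_π_sub_nsmul_le (f d : G) : |C.π (f - D.q • d)| ≤ |C.π f| + D.q * |C.π d| := by
  rw [map_sub, map_nsmul, nsmul_eq_mul]
  refine (abs_sub _ _).trans ?_
  rw [abs_mul, Nat.abs_cast]

lemma above_add_congr {c c' : Bool} {u u' : ℝ} (h : D.label c u = D.label c' u') {f d : G}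
    (hf : |C.π f| + D.q * |C.π d| ≤ D.K) :
    Above c (C.ρ d + u) (C.ρ f / D.q) ↔ Above c' (C.ρ d + u') (C.ρ f / D.q) := by
  rw [add_comm, add_comm _ u', above_add_iff, above_add_iff, ← ρ_sub_nsmul_div]
  exact above_congr h ((abs_π_sub_nsmul_le f d).trans hf)

lemma ρ_e_div : C.ρ D.e / D.q = D.ℓ := by
  have := D.q_pos'.ne'
  rw [D.ρ_e]
  field_simp

/-- The ends of the window are themselves points of comparison: `f = 0` gives `0` and `f = D.e`
gives `ℓ`. -/
lemma mem_halfOpen_congr_of_above {c c' : Bool} {u u' : ℝ}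
    (h : ∀ f : G, |C.π f| ≤ |C.π D.e| →
      (Above c u (C.ρ f / D.q) ↔ Above c' u' (C.ρ f / D.q))) :
    u ∈ halfOpen c 0 D.ℓ ↔ u' ∈ halfOpen c' 0 D.ℓ := by
  have h0 := h 0 (by simp)
  have h1 := h D.e le_rfl
  rw [map_zero, zero_div] at h0
  rw [ρ_e_div] at h1
  rw [mem_halfOpen_iff, mem_halfOpen_iff, h0, h1]

/-- The label determines the nearby vertices. -/
lemma mem_halfOpen_congr {c c' : Bool} {u u' : ℝ} (h : D.label c u = D.label c' u') {d : G}
    (hd : |C.π d| ≤ D.W) :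
    C.ρ d + u ∈ halfOpen c 0 D.ℓ ↔ C.ρ d + u' ∈ halfOpen c' 0 D.ℓ := by
  refine mem_halfOpen_congr_of_above fun f hf => above_add_congr h ?_
  have := mul_le_mul_of_nonneg_left hd D.q_pos'.le
  linarith [D.K_window]

/-- Pulling `ρ f / q` back along `u ↦ ρ d + (r + mu * u)` gives the comparison point of `m⁻¹ (f - q
• d - s)`. Applying `m⁻¹` divides `π` by `lam`, and `K_map` says exactly that the result is again
bounded by `K`. -/
lemma above_map_congr {c c' : Bool} {u u' : ℝ} (h : D.label c u = D.label c' u') {f d : G}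
    (hd : |C.π d| ≤ D.lam * D.W) (hf : |C.π f| ≤ D.K) :
    Above (D.flip c) (C.ρ d + (D.r + D.mu * u)) (C.ρ f / D.q) ↔
      Above (D.flip c') (C.ρ d + (D.r + D.mu * u')) (C.ρ f / D.q) := by
  rw [add_comm (C.ρ d) (D.r + D.mu * u), add_comm (C.ρ d) (D.r + D.mu * u'), above_add_iff (a := C.ρ d),
    above_add_iff (a := C.ρ d)]
  apply above_flip_congr
  have h1 : (C.ρ f / D.q - C.ρ d - D.r) / D.mu =
      C.ρ (D.m.symm (f - D.q • d - D.s)) / D.q := by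
    have h2 := D.ρ_map (D.m.symm (f - D.q • d - D.s))
    rw [AddEquiv.apply_symm_apply, map_sub, map_sub, map_nsmul, nsmul_eq_mul, D.ρ_s] at h2
    have := D.q_pos'.ne'
    have := D.mu_ne_zero
    field_simp
    linarith
  rw [h1]
  apply above_congr h
  have h2 := D.π_map (D.m.symm (f - D.q • d - D.s))
  rw [AddEquiv.apply_symm_apply] at h2
  have h3 : D.lam * |C.π (D.m.symm (f - D.q • d - D.s))| ≤ D.lam * D.K := by
    rw [← abs_of_pos D.lam_pos, ← abs_mul, ← h2, abs_of_pos D.lam_pos, map_sub]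
    refine (abs_sub _ _).trans (le_trans ?_ D.K_map)
    have h4 := abs_π_sub_nsmul_le (D := D) f d
    have h5 := mul_le_mul_of_nonneg_left hd D.q_pos'.le
    linarith
  exact le_of_mul_le_mul_left h3 D.lam_pos

lemma K_nonneg_window : |C.π D.e| ≤ D.K ∨ D.W < 0 := by
  rcases lt_or_ge D.W 0 with h | h
  · exact Or.inr h
  · left
    have := mul_nonneg D.q_pos'.le h
    linarith [D.K_window]

/-- The label determines the vertices and the labels near the image of a position. -/
lemma map_congr {c c' : Bool} {u u' : ℝ} (h : D.label c u = D.label c' u') {d : G}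
    (hd : |C.π d| ≤ D.lam * D.W) :
    (C.ρ d + (D.r + D.mu * u) ∈ halfOpen (D.flip c) 0 D.ℓ ↔
      C.ρ d + (D.r + D.mu * u') ∈ halfOpen (D.flip c') 0 D.ℓ) ∧
    D.label (D.flip c) (C.ρ d + (D.r + D.mu * u)) =
      D.label (D.flip c') (C.ρ d + (D.r + D.mu * u')) := by
  constructor
  · refine mem_halfOpen_congr_of_above fun f hf => above_map_congr h hd (hf.trans ?_)
    rcases K_nonneg_window (D := D) with h1 | h1
    · exact h1
    · have := mul_neg_of_pos_of_neg D.lam_pos h1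
      linarith [abs_nonneg (C.π d)]
  · ext f
    simp only [label, Set.mem_ofPred_eq]
    exact and_congr_right fun hf => above_map_congr h hd hf

variable (D)

/-- The set of the labels of the positions in the window. -/
def labels : Set (Set G) := {L | ∃ c u, u ∈ halfOpen c 0 D.ℓ ∧ D.label c u = L}

/-- Points with `ρ f < 0` lie below every position and points with `ρ f > q * ℓ` above every one, so
labels differ only in finitely many points. -/
lemma finite_labels : D.labels.Finite := by
  have hF : {f : G | |C.π f| ≤ D.K ∧ |C.ρ f| ≤ D.q * D.ℓ}.Finite :=
    (C.finite (max D.K (D.q * D.ℓ))).subset fun f hf =>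
      ⟨hf.1.trans (le_max_left _ _), hf.2.trans (le_max_right _ _)⟩
  refine (hF.finite_subsets.image fun A => {f | |C.π f| ≤ D.K ∧ C.ρ f < 0} ∪ A).subset ?_
  rintro _ ⟨c, u, hu, rfl⟩
  have hu' := mem_Icc_of_mem_halfOpen hu
  have hq := D.q_pos'
  refine ⟨D.label c u ∩ {f | 0 ≤ C.ρ f}, ?_, ?_⟩
  · rintro f ⟨⟨h1, h2⟩, h3⟩
    refine ⟨h1, ?_⟩
    rw [abs_of_nonneg h3]
    have h4 : C.ρ f / D.q ≤ u := by
      cases c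
      · exact ((above_false _ _).1 h2).le
      · exact (above_true _ _).1 h2
    rw [div_le_iff₀ hq] at h4
    have := mul_le_mul_of_nonneg_right hu'.2 hq.le
    linarith
  · ext f
    simp only [Set.mem_union, Set.mem_ofPred_eq, Set.mem_inter_iff]
    constructor
    · rintro (⟨h1, h2⟩ | h)
      · refine ⟨h1, ?_⟩
        have h3 : C.ρ f / D.q < u := (div_neg_of_neg_of_pos h2 hq).trans_le hu'.1
        cases c
        · exact (above_false _ _).2 h3
        · exact (above_true _ _).2 h3.le
      · exact h.1
    · intro h
      rcases lt_or_ge (C.ρ f) 0 with h1 | h1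
      · exact Or.inl ⟨h.1, h1⟩
      · exact Or.inr ⟨h, h1⟩

lemma exists_next {c : Bool} {u : ℝ} (hu : u ∈ halfOpen c 0 D.ℓ) :
    ∃ d, 0 < C.π d ∧ C.π d ≤ D.W ∧ C.ρ d + u ∈ halfOpen c 0 D.ℓ ∧
      ∀ d', 0 < C.π d' → C.ρ d' + u ∈ halfOpen c 0 D.ℓ → C.π d ≤ C.π d' := by
  have hu' := mem_Icc_of_mem_halfOpen hu
  have hfin : {d : G | 0 < C.π d ∧ C.π d ≤ D.W ∧ C.ρ d + u ∈ halfOpen c 0 D.ℓ}.Finite := by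
    refine (C.finite (max D.W D.ℓ)).subset ?_
    rintro d ⟨h1, h2, h3⟩
    have h4 := mem_Icc_of_mem_halfOpen h3
    refine ⟨?_, ?_⟩
    · rw [abs_of_pos h1]; exact h2.trans (le_max_left _ _)
    · refine le_trans ?_ (le_max_right _ _)
      rw [abs_le]
      constructor <;> linarith
  obtain ⟨g, h1, h2, h3, h4⟩ := D.cover u hu'.1 hu'.2
  obtain ⟨d, ⟨hd1, hd2, hd3⟩, hd4⟩ := Set.exists_min_image _ C.π hfin
    ⟨g, h3, h4, mem_halfOpen_of_lt h1 h2⟩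
  refine ⟨d, hd1, hd2, hd3, fun d' h5 h6 => ?_⟩
  rcases le_or_gt (C.π d') D.W with h7 | h7
  · exact hd4 d' ⟨h5, h7, h6⟩
  · exact hd2.trans h7.le

/-- The number of labels. -/
noncomputable def numLabels : ℕ := D.finite_labels.fin_embedding.choose

/-- The labels, enumerated. -/
noncomputable def lab : Fin D.numLabels ↪ Set G := D.finite_labels.fin_embedding.choose_spec.choose

lemma range_lab : Set.range D.lab = D.labels := D.finite_labels.fin_embedding.choose_spec.choose_spec

lemma exists_state (i : Fin D.numLabels) :
    ∃ c u, u ∈ halfOpen c 0 D.ℓ ∧ D.label c u = D.lab i := by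
  have : D.lab i ∈ D.labels := D.range_lab ▸ ⟨i, rfl⟩
  exact this

lemma exists_lab {c : Bool} {u : ℝ} (hu : u ∈ halfOpen c 0 D.ℓ) : ∃ i, D.lab i = D.label c u := by
  have : D.label c u ∈ Set.range D.lab := D.range_lab ▸ ⟨c, u, hu, rfl⟩
  exact this

/-- A position with a given label: the kind of the window. -/
noncomputable def kind (i : Fin D.numLabels) : Bool := (D.exists_state i).choose

/-- A position with a given label. -/
noncomputable def pos (i : Fin D.numLabels) : ℝ := (D.exists_state i).choose_spec.choose

lemma pos_mem (i : Fin D.numLabels) : D.pos i ∈ halfOpen (D.kind i) 0 D.ℓ :=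
  (D.exists_state i).choose_spec.choose_spec.1

lemma label_pos (i : Fin D.numLabels) : D.label (D.kind i) (D.pos i) = D.lab i :=
  (D.exists_state i).choose_spec.choose_spec.2

/-- The vector from a vertex with a given label to the next vertex. -/
noncomputable def next (i : Fin D.numLabels) : G := (D.exists_next (D.pos_mem i)).choose

lemma π_next_pos (i : Fin D.numLabels) : 0 < C.π (D.next i) :=
  (D.exists_next (D.pos_mem i)).choose_spec.1

lemma π_next_le (i : Fin D.numLabels) : C.π (D.next i) ≤ D.W :=
  (D.exists_next (D.pos_mem i)).choose_spec.2.1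

lemma next_mem {c : Bool} {u : ℝ} {i : Fin D.numLabels} (h : D.lab i = D.label c u) :
    C.ρ (D.next i) + u ∈ halfOpen c 0 D.ℓ := by
  rw [← D.label_pos] at h
  rw [← mem_halfOpen_congr h (by rw [abs_of_pos (D.π_next_pos i)]; exact D.π_next_le i)]
  exact (D.exists_next (D.pos_mem i)).choose_spec.2.2.1

lemma next_le {c : Bool} {u : ℝ} {i : Fin D.numLabels} (h : D.lab i = D.label c u) {d : G}
    (hd : 0 < C.π d) (hdu : C.ρ d + u ∈ halfOpen c 0 D.ℓ) : C.π (D.next i) ≤ C.π d := by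
  rcases le_or_gt (C.π d) D.W with h1 | h1
  · rw [← D.label_pos] at h
    refine (D.exists_next (D.pos_mem i)).choose_spec.2.2.2 d hd ?_
    rwa [mem_halfOpen_congr h (by rwa [abs_of_pos hd])]
  · exact (D.π_next_le i).trans h1.le

/-- The lengths of the prototiles. -/
noncomputable def len (i : Fin D.numLabels) : ℝ := C.π (D.next i)

lemma len_pos (i : Fin D.numLabels) : 0 < D.len i := D.π_next_pos i

/-- The labelled tiling given by the half open window of kind `c` with base `t`. -/
def tiling (c : Bool) (t : ℝ) : Set (ℝ × Fin D.numLabels) :=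
  {p | ∃ z, C.ρ z - t ∈ halfOpen c 0 D.ℓ ∧ C.π z = p.1 ∧ D.lab p.2 = D.label c (C.ρ z - t)}

variable {D}

lemma vert_tiling {c : Bool} {t : ℝ} :
    vert (D.tiling c t) = C.vset (halfOpen c t (t + D.ℓ)) := by
  ext x
  constructor
  · rintro ⟨i, z, h1, h2, -⟩
    exact ⟨z, mem_halfOpen_base.2 h1, h2⟩
  · rintro ⟨z, h1, h2⟩
    rw [mem_halfOpen_base] at h1
    obtain ⟨i, hi⟩ := D.exists_lab h1
    exact ⟨i, z, h1, h2, hi⟩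

lemma isTiling_tiling (hℓ : 0 < D.ℓ) {c : Bool} {t : ℝ} : IsTiling D.len (D.tiling c t) := by
  constructor
  · intro x
    have hfin : ∀ y, {z : G | y ≤ C.π z ∧ C.π z ≤ x ∧ C.ρ z - t ∈ halfOpen c 0 D.ℓ}.Finite := by
      intro y
      refine (C.finite (max (max |x| |y|) (max |t| |t + D.ℓ|))).subset ?_
      rintro z ⟨h1, h2, h3⟩
      have h4 := mem_Icc_of_mem_halfOpen h3
      constructor
      · exact (abs_le_max_abs_abs h1 h2).trans ((max_comm |y| |x|).le.trans (le_max_left _ _))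
      · exact (abs_le_max_abs_abs (by linarith) (by linarith)).trans (le_max_right _ _)
    -- `dense` supplies only points with large `π`; a vertex to the left of `x` is obtained by
    -- negation.
    obtain ⟨z0, h1, h2, h3⟩ := C.dense (-(t + D.ℓ)) (-t) (-x) (by linarith)
    have hz0 : C.ρ (-z0) - t ∈ halfOpen c 0 D.ℓ :=
      mem_halfOpen_of_lt (by rw [map_neg]; linarith) (by rw [map_neg]; linarith)
    obtain ⟨z, ⟨hz1, hz2, hz3⟩, hz4⟩ := Set.exists_max_image _ C.π (hfin (C.π (-z0)))
      ⟨-z0, le_rfl, by rw [map_neg]; linarith, hz0⟩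
    obtain ⟨i, hi⟩ := D.exists_lab hz3
    refine ⟨(C.π z, i), ⟨z, hz3, rfl, hi⟩, hz2, ?_⟩
    by_contra! hlt
    simp only [len] at hlt
    have h4 := D.next_mem hi
    have h5 := D.π_next_pos i
    have := hz4 (z + D.next i) ⟨by rw [map_add]; linarith, by rw [map_add]; linarith, by
      rw [map_add]
      convert h4 using 1
      ring⟩
    rw [map_add] at this
    linarith
  · have key : ∀ p ∈ D.tiling c t, ∀ q ∈ D.tiling c t, p.1 < q.1 →
        p.1 + D.len p.2 ≤ q.1 := by
      rintro ⟨x, i⟩ ⟨z, hz, hzx, hi⟩ ⟨y, j⟩ ⟨z', hz', hzy, -⟩ hlt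
      simp only at hzx hzy hi hlt ⊢
      subst hzx hzy
      have := D.next_le hi (d := z' - z) (by rw [map_sub]; linarith) (by
        rw [map_sub]
        convert hz' using 1
        ring)
      rw [map_sub] at this
      simp only [len]
      linarith
    have hlab : ∀ p ∈ D.tiling c t, ∀ q ∈ D.tiling c t, p.1 = q.1 → p = q := by
      rintro ⟨x, i⟩ ⟨z, hz, hzx, hi⟩ ⟨y, j⟩ ⟨z', hz', hzy, hj⟩ h
      simp only at hzx hzy hi hj h
      have : z = z' := D.π_injective (by rw [hzx, hzy, h])
      subst this
      rw [Prod.mk.injEq]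
      exact ⟨h, D.lab.injective (hi.trans hj.symm)⟩
    intro p hp q hq hpq
    rw [Set.disjoint_left]
    rintro x ⟨h1, h2⟩ ⟨h3, h4⟩
    rcases lt_trichotomy p.1 q.1 with h | h | h
    · linarith [key p hp q hq h]
    · exact hpq (hlab p hp q hq h)
    · linarith [key q hq p hp h]

variable (D)

/-- The word is read off at the representative position `pos i`: the base is chosen so that the
vertex `0` has position `r + mu * pos i`, and the inflated next vertex is a vertex again because the
image of the window fits. -/
lemma exists_repl (hℓ : 0 < D.ℓ) (i : Fin D.numLabels) : ∃ L : List (Fin D.numLabels),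
    place D.len 0 L = {p ∈ D.tiling (D.flip (D.kind i)) (-(D.r + D.mu * D.pos i)) |
      0 ≤ p.1 ∧ p.1 < D.lam * D.len i} ∧ (L.map D.len).sum = D.lam * D.len i := by
  have h0 : (0 : ℝ) ∈ vert (D.tiling (D.flip (D.kind i)) (-(D.r + D.mu * D.pos i))) := by
    rw [vert_tiling]
    refine ⟨0, ?_, map_zero _⟩
    rw [mem_halfOpen_base]
    simpa using D.map_mem_halfOpen (D.pos_mem i)
  have h1 : D.lam * D.len i ∈
      vert (D.tiling (D.flip (D.kind i)) (-(D.r + D.mu * D.pos i))) := by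
    rw [vert_tiling]
    refine ⟨D.m (D.next i), ?_, D.π_map _⟩
    rw [mem_halfOpen_base, D.ρ_map]
    have := D.map_mem_halfOpen (D.next_mem (D.label_pos i).symm)
    convert this using 1
    ring
  obtain ⟨L, hL, hs⟩ := (isTiling_tiling hℓ).exists_word_between D.len_pos h0 h1
    (mul_nonneg D.lam_pos.le (D.len_pos i).le)
  exact ⟨L, hL, by rw [hs, sub_zero]⟩

/-- The word which replaces an inflated prototile. -/
noncomputable def word (hℓ : 0 < D.ℓ) (i : Fin D.numLabels) : List (Fin D.numLabels) :=
  (D.exists_repl hℓ i).choose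

/-- The substitution rule given by a self-similarity which maps a window into itself. -/
noncomputable abbrev rule (hℓ : 0 < D.ℓ) : SubstitutionRule where
  card := D.numLabels
  len := D.len
  len_pos := D.len_pos
  factor := D.lam
  one_lt_factor := D.one_lt_lam
  repl := D.word hℓ
  covers i := (D.exists_repl hℓ i).choose_spec.2

variable {D}

/-- The word was read at one representative, but by `map_congr` equal labels give equal vertices and
labels up to distance `lam * W` from the inflated vertex, which covers the whole inflated tile. -/
lemma place_repl (hℓ : 0 < D.ℓ) {c : Bool} {t : ℝ} {x : ℝ} {i : Fin D.numLabels}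
    (h : (x, i) ∈ D.tiling c t) :
    place D.len (D.lam * x) (D.word hℓ i) =
      {p ∈ D.tiling (D.flip c) (D.mu * t - D.r) |
        D.lam * x ≤ p.1 ∧ p.1 < D.lam * (x + D.len i)} := by
  obtain ⟨z, hz, hzx, hi⟩ := h
  simp only at hzx hi
  subst hzx
  have hlab : D.label (D.kind i) (D.pos i) = D.label c (C.ρ z - t) := by rw [D.label_pos, hi]
  ext p
  have h1 : p ∈ place D.len (D.lam * C.π z) (D.word hℓ i) ↔
      (p.1 - D.lam * C.π z, p.2) ∈ place D.len 0 (D.word hℓ i) := by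
    rw [← mem_place_add_iff 0 (D.lam * C.π z)]
    simp
  have h2 : place D.len 0 (D.word hℓ i) = _ := (D.exists_repl hℓ i).choose_spec.1
  rw [h1, h2]
  have hW : ∀ d, 0 ≤ C.π d → C.π d < D.lam * D.len i → |C.π d| ≤ D.lam * D.W := by
    intro d hd1 hd2
    rw [abs_of_nonneg hd1]
    exact hd2.le.trans (mul_le_mul_of_nonneg_left (D.π_next_le i) D.lam_pos.le)
  constructor
  · rintro ⟨⟨d, hd1, hd2, hd3⟩, h3, h4⟩
    simp only at hd2 hd3 h3 h4
    rw [sub_neg_eq_add] at hd1 hd3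
    obtain ⟨h5, h6⟩ := map_congr hlab (hW d (by linarith) (by linarith))
    have h7 : C.ρ (D.m z + d) - (D.mu * t - D.r) =
        C.ρ d + (D.r + D.mu * (C.ρ z - t)) := by
      rw [map_add, D.ρ_map]; ring
    refine ⟨⟨D.m z + d, ?_, ?_, ?_⟩, by linarith, by linarith⟩
    · rw [h7, ← h5]; exact hd1
    · rw [map_add, D.π_map, hd2]; ring
    · rw [h7, ← h6]; exact hd3
  · rintro ⟨⟨h, hh1, hh2, hh3⟩, h3, h4⟩
    have h8 : C.π (h - D.m z) = p.1 - D.lam * C.π z := by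
      rw [map_sub, D.π_map, hh2]
    have h7 : C.ρ h - (D.mu * t - D.r) =
        C.ρ (h - D.m z) + (D.r + D.mu * (C.ρ z - t)) := by
      rw [map_sub, D.ρ_map]; ring
    obtain ⟨h5, h6⟩ := map_congr hlab (hW (h - D.m z) (by linarith) (by linarith))
    refine ⟨⟨h - D.m z, ?_, h8, ?_⟩, by simp only; linarith, by simp only; linarith⟩
    · rw [sub_neg_eq_add, h5, ← h7]; exact hh1
    · rw [sub_neg_eq_add, h6, ← h7]; exact hh3

lemma apply_tiling (hℓ : 0 < D.ℓ) (c : Bool) (t : ℝ) :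
    (D.rule hℓ).apply (D.tiling c t) = D.tiling (D.flip c) (D.mu * t - D.r) := by
  ext p
  refine Set.mem_iUnion₂.trans ⟨?_, fun hp => ?_⟩
  · rintro ⟨⟨x, i⟩, hx, hp⟩
    have hp' : p ∈ place D.len (D.lam * x) (D.word hℓ i) := hp
    rw [place_repl hℓ hx] at hp'
    exact hp'.1
  · obtain ⟨⟨x, i⟩, hx, h1, h2⟩ :=
      (isTiling_tiling hℓ (D := D) (c := c) (t := t)).exists_mem_Ico D.len_pos (p.1 / D.lam)
    refine ⟨⟨x, i⟩, hx, ?_⟩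
    change p ∈ place D.len (D.lam * x) (D.word hℓ i)
    rw [place_repl hℓ hx]
    rw [le_div_iff₀ D.lam_pos] at h1
    rw [div_lt_iff₀ D.lam_pos] at h2
    exact ⟨hp, by linarith, by linarith⟩

/-- Labels are constant on small one-sided neighbourhoods. -/
lemma exists_label_eq {c : Bool} {u : ℝ} (hu : u ∈ halfOpen c 0 D.ℓ) : ∃ δ > 0, ∀ v, 0 < v →
    v < δ → ∀ c', (if c = true then u + v else u - v) ∈ halfOpen c' 0 D.ℓ ∧
      D.label c' (if c = true then u + v else u - v) = D.label c u := by
  have hq := D.q_pos'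
  suffices h : ∃ δ > 0, ∀ v, 0 < v → v < δ → ∀ c',
      D.label c' (if c = true then u + v else u - v) = D.label c u by
    obtain ⟨δ, hδ, h⟩ := h
    refine ⟨δ, hδ, fun v hv hv' c' => ⟨?_, h v hv hv' c'⟩⟩
    have h1 := mem_halfOpen_congr (h v hv hv' c') (d := 0) (by
      rw [map_zero, abs_zero]
      have := D.π_next_pos (D.exists_lab hu).choose
      have := D.π_next_le (D.exists_lab hu).choose
      linarith)
    rw [map_zero, zero_add, zero_add] at h1
    exact h1.2 hu
  -- Only finitely many comparison points are near `u`, so `δ` can stop before the first one on the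
  -- side of the shift; the cap `1` on `δ` keeps the remaining ones out of reach.
  have hF : {f : G | |C.π f| ≤ D.K ∧ |C.ρ f| ≤ D.q * (|u| + 1)}.Finite :=
    (C.finite (max D.K (D.q * (|u| + 1)))).subset fun f hf =>
      ⟨hf.1.trans (le_max_left _ _), hf.2.trans (le_max_right _ _)⟩
  have hF' : ∀ f : G, |C.π f| ≤ D.K → |C.ρ f / D.q| ≤ |u| + 1 →
      f ∈ {f : G | |C.π f| ≤ D.K ∧ |C.ρ f| ≤ D.q * (|u| + 1)} := by
    intro f h1 h2
    rw [abs_div, Nat.abs_cast, div_le_iff₀ hq] at h2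
    exact ⟨h1, by linarith⟩
  cases c
  · obtain ⟨δ, hδ, h⟩ := exists_pos_forall_le (hF.subset (Set.sep_subset _
      fun f => C.ρ f / D.q < u)) (fun f => u - C.ρ f / D.q) (fun f hf => by
        have := hf.2; linarith)
    refine ⟨min δ 1, by positivity, fun v hv hv' c' => ?_⟩
    rw [lt_min_iff] at hv'
    simp only [Bool.false_eq_true, if_false]
    ext f
    simp only [label, Set.mem_ofPred_eq, above_false]
    refine and_congr_right fun hf => ?_
    constructor
    · intro h1
      have : C.ρ f / D.q ≤ u - v := by
        cases c'
        · exact ((above_false _ _).1 h1).le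
        · exact (above_true _ _).1 h1
      linarith
    · intro h1
      have : C.ρ f / D.q < u - v := by
        by_cases h2 : |C.ρ f / D.q| ≤ |u| + 1
        · have := h f ⟨hF' f hf h2, h1⟩
          linarith
        · rw [abs_le, not_and_or, not_le, not_le] at h2
          have := neg_abs_le u
          have := le_abs_self u
          rcases h2 with h2 | h2 <;> linarith
      cases c'
      · exact (above_false _ _).2 this
      · exact (above_true _ _).2 this.le
  · obtain ⟨δ, hδ, h⟩ := exists_pos_forall_le (hF.subset (Set.sep_subset _
      fun f => u < C.ρ f / D.q)) (fun f => C.ρ f / D.q - u) (fun f hf => by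
        have := hf.2; linarith)
    refine ⟨min δ 1, by positivity, fun v hv hv' c' => ?_⟩
    rw [lt_min_iff] at hv'
    simp only [if_true]
    ext f
    simp only [label, Set.mem_ofPred_eq, above_true]
    refine and_congr_right fun hf => ?_
    constructor
    · intro h1
      have h1' : C.ρ f / D.q ≤ u + v := by
        cases c'
        · exact ((above_false _ _).1 h1).le
        · exact (above_true _ _).1 h1
      by_contra! h3
      by_cases h2 : |C.ρ f / D.q| ≤ |u| + 1
      · have := h f ⟨hF' f hf h2, h3⟩
        linarith
      · rw [abs_le, not_and_or, not_le, not_le] at h2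
        have := neg_abs_le u
        have := le_abs_self u
        rcases h2 with h2 | h2 <;> linarith
    · intro h1
      have : C.ρ f / D.q < u + v := by linarith
      cases c'
      · exact (above_false _ _).2 this
      · exact (above_true _ _).2 this.le

/-- All labels of a finite patch survive a small common shift of positions, upwards for kind `true`
and downwards for kind `false`, whatever the kind of the target window. By density some `h` realises
such a shift together with the change of base. -/
lemma patchesAppear_tiling (c c' : Bool) (t t' : ℝ) :
    PatchesAppear (D.tiling c t) (D.tiling c' t') := by
  intro F hF hFT
  have h1 : ∀ p : ℝ × Fin D.numLabels, ∃ z, p ∈ F → C.ρ z - t ∈ halfOpen c 0 D.ℓ ∧ C.π z = p.1 ∧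
      D.lab p.2 = D.label c (C.ρ z - t) := by
    intro p
    by_cases hp : p ∈ F
    · obtain ⟨z, hz⟩ := hFT hp
      exact ⟨z, fun _ => hz⟩
    · exact ⟨0, fun h => absurd h hp⟩
  choose z hz using h1
  have h2 : ∀ p, ∃ δ, p ∈ F → 0 < δ ∧ ∀ v, 0 < v → v < δ → ∀ c',
      (if c = true then C.ρ (z p) - t + v else C.ρ (z p) - t - v) ∈ halfOpen c' 0 D.ℓ ∧
      D.label c' (if c = true then C.ρ (z p) - t + v else C.ρ (z p) - t - v) =
        D.label c (C.ρ (z p) - t) := by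
    intro p
    by_cases hp : p ∈ F
    · obtain ⟨δ, h⟩ := exists_label_eq (hz p hp).1
      exact ⟨δ, fun _ => h⟩
    · exact ⟨0, fun h => absurd h hp⟩
  choose δ hδ using h2
  obtain ⟨ε, hε, hεδ⟩ := exists_pos_forall_le hF δ fun p hp => (hδ p hp).1
  have h3 : ∃ h v, 0 < v ∧ v < ε ∧ C.ρ h = if c = true then t' - t + v else t' - t - v := by
    cases c
    · obtain ⟨h, h4, h5, -⟩ := C.dense (t' - t - ε) (t' - t) 0 (by linarith)
      exact ⟨h, t' - t - C.ρ h, by linarith, by linarith, by simp⟩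
    · obtain ⟨h, h4, h5, -⟩ := C.dense (t' - t) (t' - t + ε) 0 (by linarith)
      exact ⟨h, C.ρ h - (t' - t), by linarith, by linarith, by simp⟩
  obtain ⟨h, v, hv, hvε, hh⟩ := h3
  refine ⟨C.π h, fun p hp => ?_⟩
  obtain ⟨h4, h5⟩ := (hδ p hp).2 v hv (hvε.trans_le (hεδ p hp)) c'
  have h6 : C.ρ (z p + h) - t' =
      if c = true then C.ρ (z p) - t + v else C.ρ (z p) - t - v := by
    rw [map_add, hh]
    split_ifs <;> ring
  obtain ⟨h7, h8, h9⟩ := hz p hp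
  exact ⟨z p + h, h6 ▸ h4, by rw [map_add, h8], by rw [h6, h5]; exact h9⟩

lemma locallyIsomorphic_tiling (c c' : Bool) (t t' : ℝ) :
    LocallyIsomorphic (D.tiling c t) (D.tiling c' t') :=
  ⟨patchesAppear_tiling _ _ _ _, patchesAppear_tiling _ _ _ _⟩

lemma exists_predecessor (hℓ : 0 < D.ℓ) (c : Bool) (t : ℝ) (k : ℕ) :
    ∃ c' t', (D.rule hℓ).apply^[k] (D.tiling c' t') = D.tiling c t := by
  induction k generalizing c t with
  | zero => exact ⟨c, t, rfl⟩
  | succ k ih =>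
    -- The base `(t + r) / mu` is the one that the rule sends to `t`, since it sends a base `b` to
    -- `mu * b - r`.
    obtain ⟨c', t', h⟩ := ih (D.flip c) ((t + D.r) / D.mu)
    refine ⟨c', t', ?_⟩
    rw [Function.iterate_succ_apply', h, apply_tiling, flip_flip]
    congr 1
    rw [mul_div_cancel₀ _ D.mu_ne_zero]
    ring

lemma isLabelling_tiling (hℓ : 0 < D.ℓ) (c : Bool) (t : ℝ) :
    (D.rule hℓ).IsLabelling (C.vset (halfOpen c t (t + D.ℓ))) (D.tiling c t) := by
  refine ⟨isTiling_tiling hℓ, vert_tiling, fun i => ?_, fun k => ?_⟩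
  · have h1 : ((0 : ℝ), i) ∈ D.tiling (D.kind i) (-D.pos i) :=
      ⟨0, by simpa using D.pos_mem i, map_zero _, by simpa using (D.label_pos i).symm⟩
    obtain ⟨x, hx⟩ := patchesAppear_tiling (D := D) (D.kind i) c (-D.pos i) t {(0, i)} (by simp)
      (by simpa using h1)
    exact ⟨_, hx _ rfl⟩
  · obtain ⟨c', t', h⟩ := exists_predecessor hℓ c t k
    exact ⟨_, isTiling_tiling hℓ, locallyIsomorphic_tiling _ _ _ _, h⟩

lemma exists_pred (hℓ : 0 < D.ℓ) (c : Bool) (t : ℝ) : ∃ T',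
    IsTiling D.len T' ∧ LocallyIsomorphic T' (D.tiling c t) ∧
      (D.rule hℓ).apply T' = D.tiling c t ∧ C.PredShift D.ℓ t D.lam D.mu T' D.r := by
  refine ⟨D.tiling (D.flip c) ((t + D.r) / D.mu), isTiling_tiling hℓ,
    locallyIsomorphic_tiling _ _ _ _, ?_, ?_⟩
  · rw [apply_tiling, flip_flip]
    congr 1
    rw [mul_div_cancel₀ _ D.mu_ne_zero]
    ring
  · intro x hx
    have hx2 := hx
    rw [vert_tiling] at hx2
    obtain ⟨z, hz, rfl⟩ := hx2
    refine ⟨_, _, D.m z, C.posAt_of_mem_vert D.π_injective vert_tiling, (D.π_map z).symm, ?_⟩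
    rw [D.ρ_map, mul_sub, mul_div_cancel₀ _ D.mu_ne_zero]
    ring

end WindowMap

/-- A self-similarity that maps the window into itself gives a substitution rule, if the ends of
both windows are commensurable with the group. -/
lemma exists_rule_of_fits {G : Type*} [AddCommGroup G] (C : CutScheme G)
    (hπ : Function.Injective C.π) (m : G ≃+ G) {lam mu : ℝ} (hlam : 1 < lam) (hmu : mu ≠ 0)
    (hmπ : ∀ g, C.π (m g) = lam * C.π g) (hmρ : ∀ g, C.ρ (m g) = mu * C.ρ g) {ℓ r : ℝ}
    (hℓ : 0 < ℓ) (hfits : ∀ u, 0 ≤ u → u ≤ ℓ → 0 ≤ r + mu * u ∧ r + mu * u ≤ ℓ)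
    {q : ℕ} (hq : 0 < q) {e s : G} (he : C.ρ e = q * ℓ) (hs : C.ρ s = q * r) (c : Bool) (t : ℝ) :
    ∃ (σ : SubstitutionRule) (T T' : Set (ℝ × Fin σ.card)), σ.factor = lam ∧
      σ.IsLabelling (C.vset (halfOpen c t (t + ℓ))) T ∧ IsTiling σ.len T' ∧
      LocallyIsomorphic T' T ∧ σ.apply T' = T ∧ C.PredShift ℓ t lam mu T' r := by
  -- `exists_cover` handles only nonnegative starting points; subtracting `ρ h0` moves the start
  -- `-u` needed for `cover` to `-u - ρ h0`, which lies in `[0, 2 * ℓ]`.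
  obtain ⟨h0, h1, h2, h3⟩ := C.dense (-2 * ℓ) (-ℓ) 0 (by linarith)
  obtain ⟨R, hR⟩ := C.exists_cover hℓ (2 * ℓ)
  set W := max (R + C.π h0) 0 with hW
  have hW0 : 0 ≤ W := le_max_right _ _
  have hlam' : 0 < lam - 1 := by linarith
  have hq' : (0 : ℝ) < q := by exact_mod_cast hq
  let D : WindowMap C :=
    { π_injective := hπ
      m := m
      lam := lam
      mu := mu
      one_lt_lam := hlam
      mu_ne_zero := hmu
      π_map := hmπ
      ρ_map := hmρ
      ℓ := ℓ
      r := r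
      fits := hfits
      q := q
      q_pos := hq
      e := e
      s := s
      ρ_e := he
      ρ_s := hs
      W := W
      cover := by
        intro u hu0 hu1
        obtain ⟨g, hg1, hg2, hg3, hg4⟩ := hR (-u - C.ρ h0) (by linarith) (by linarith)
        refine ⟨g + h0, ?_, ?_, ?_, ?_⟩
        · rw [map_add]; linarith
        · rw [map_add]; linarith
        · rw [map_add]; linarith
        · rw [map_add]; exact le_trans (by linarith) (le_max_left _ _)
      -- The first two terms give `K_window`; the last makes `(lam - 1) * K` at least `|π s| + q *
      -- (lam * W)`, which is `K_map`.
      K := |C.π e| + q * W + (|C.π s| + q * (lam * W)) / (lam - 1)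
      K_window := by
        have : 0 ≤ (|C.π s| + q * (lam * W)) / (lam - 1) := by positivity
        linarith
      K_map := by
        have h4 : (|C.π s| + q * (lam * W)) / (lam - 1) * (lam - 1) =
          |C.π s| + q * (lam * W) := div_mul_cancel₀ _ hlam'.ne'
        have h5 : 0 ≤ (|C.π e| + q * W) * (lam - 1) := by positivity
        linarith }
  obtain ⟨T', h4, h5, h6, h7⟩ := D.exists_pred hℓ c t
  exact ⟨D.rule hℓ, D.tiling c t, T', rfl, D.isLabelling_tiling hℓ c t, h4, h5, h6, h7⟩

/-! ### The plane -/

/-- The linear form with coefficients `a` and `b` on the lattice. -/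
def linForm (a b : ℝ) : (Fin 2 → ℤ) →+ ℝ where
  toFun z := a * z 0 + b * z 1
  map_zero' := by simp
  map_add' z z' := by simp only [Pi.add_apply, Int.cast_add]; ring

lemma linForm_apply (a b : ℝ) (z : Fin 2 → ℤ) : linForm a b z = a * z 0 + b * z 1 := rfl

lemma matEnd_apply (M : Matrix (Fin 2) (Fin 2) ℤ) (p : Plane) (i : Fin 2) :
    matEnd M p i = M i 0 * p 0 + M i 1 * p 1 := by
  fin_cases i <;> simp [matEnd, Matrix.toLpLin_apply]

lemma plane_ext {p q : Plane} (h0 : p 0 = q 0) (h1 : p 1 = q 1) : p = q := by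
  ext i
  fin_cases i
  · exact h0
  · exact h1

lemma exists_slope (V : Submodule ℝ Plane) (hV : Module.finrank ℝ V = 1)
    (hv : V ≠ Submodule.span ℝ {(!₂[0, 1] : Plane)}) :
    ∃ α : ℝ, ∀ p : Plane, p ∈ V ↔ p 1 = α * p 0 := by
  obtain ⟨⟨w, hw⟩, hw0, hspan⟩ := finrank_eq_one_iff'.1 hV
  have hmem : ∀ p : Plane, p ∈ V ↔ ∃ c : ℝ, c • w = p := by
    intro p
    constructor
    · intro hp
      obtain ⟨c, hc⟩ := hspan ⟨p, hp⟩
      exact ⟨c, congrArg Subtype.val hc⟩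
    · rintro ⟨c, rfl⟩
      exact V.smul_mem c hw
  have hw1 : w ≠ 0 := fun h => hw0 (Subtype.ext h)
  have hne : w 0 ≠ 0 := by
    intro h0
    have h1 : w 1 ≠ 0 := fun h1 => hw1 (plane_ext h0 h1)
    apply hv
    ext p
    rw [hmem, Submodule.mem_span_singleton]
    constructor
    · rintro ⟨c, rfl⟩
      exact ⟨c * w 1, plane_ext (by simp [h0]) (by simp)⟩
    · rintro ⟨c, rfl⟩
      exact ⟨c / w 1, plane_ext (by simp [h0]) (by simp; field_simp)⟩
  refine ⟨w 1 / w 0, fun p => ?_⟩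
  rw [hmem]
  constructor
  · rintro ⟨c, rfl⟩
    simp only [PiLp.smul_apply, smul_eq_mul]
    field_simp
  · intro h
    refine ⟨p 0 / w 0, plane_ext ?_ ?_⟩
    · simp only [PiLp.smul_apply, smul_eq_mul]
      field_simp
    · simp only [PiLp.smul_apply, smul_eq_mul]
      rw [h]
      field_simp

/-- Coordinates for the two lines: their slopes `α` and `β`, and the factor `κ` between the
projection to `V` and the linear form that vanishes on `W`. -/
structure Slopes (P : Spaces) where
  α : ℝ
  β : ℝ
  κ : ℝ
  ne : α ≠ β
  κ_ne : κ ≠ 0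
  mem_V : ∀ p : Plane, p ∈ P.V ↔ p 1 = α * p 0
  mem_W : ∀ p : Plane, p ∈ P.W ↔ p 1 = β * p 0
  proj : ∀ (z : Fin 2 → ℤ) (x : ℝ), intPoint z - x • P.v ∈ P.W ↔ κ * (z 1 - β * z 0) = x

lemma Spaces.nonempty_slopes (P : Spaces) : Nonempty (Slopes P) := by
  obtain ⟨α, hα⟩ := exists_slope P.V P.finrank_V P.V_ne_vertical
  obtain ⟨β, hβ⟩ := exists_slope P.W P.finrank_W P.W_ne_vertical
  have hne : α ≠ β := by
    rintro rfl
    have h : P.V = P.W := by ext p; rw [hα, hβ]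
    have h1 := P.transversal.disjoint
    rw [h, disjoint_self] at h1
    have := P.finrank_W
    rw [h1] at this
    simp at this
  have hv := (hα P.v).1 P.v_mem
  have hv0 : P.v 0 ≠ 0 := by
    intro h0
    have : P.v = 0 := plane_ext h0 (by rw [hv, h0]; simp)
    have hn := P.norm_v
    rw [this] at hn
    simp at hn
  have hk : P.v 1 - β * P.v 0 ≠ 0 := by
    rw [hv, ← sub_mul]
    exact mul_ne_zero (sub_ne_zero.2 hne) hv0
  refine ⟨⟨α, β, (P.v 1 - β * P.v 0)⁻¹, hne, inv_ne_zero hk, hα, hβ, fun z x => ?_⟩⟩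
  rw [hβ]
  simp only [intPoint, PiLp.sub_apply, PiLp.smul_apply, smul_eq_mul]
  rw [inv_mul_eq_iff_eq_mul₀ hk]
  simp only [Matrix.cons_val_zero, Matrix.cons_val_one]
  constructor <;> intro h <;> linarith

namespace Slopes

variable {P : Spaces} (S : Slopes P)

/-- The projection of lattice points to `V`. -/
def πForm : (Fin 2 → ℤ) →+ ℝ := linForm (-(S.κ * S.β)) S.κ

/-- The projection of lattice points to `Y`. -/
def ρForm : (Fin 2 → ℤ) →+ ℝ := linForm (-S.α) 1

lemma πForm_apply (z : Fin 2 → ℤ) : S.πForm z = S.κ * (z 1 - S.β * z 0) := by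
  rw [πForm, linForm_apply]; ring

lemma ρForm_apply (z : Fin 2 → ℤ) : S.ρForm z = z 1 - S.α * z 0 := by
  rw [ρForm, linForm_apply]; ring

lemma vertices_eq (X : Set ℝ) : P.vertices X = {x | ∃ z, S.ρForm z ∈ X ∧ S.πForm z = x} := by
  ext x
  have h : ∀ z : Fin 2 → ℤ, intPoint z ∈ P.strip X ↔ S.ρForm z ∈ X := by
    intro z
    rw [ρForm_apply]
    constructor
    · rintro ⟨u, hu, y, hy, h⟩
      rw [S.mem_V] at hu
      have h0 := congrArg (fun p : Plane => p 0) h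
      have h1 := congrArg (fun p : Plane => p 1) h
      simp [intPoint, yPoint] at h0 h1
      rw [h1, h0, hu]
      simpa using hy
    · intro h
      refine ⟨!₂[(z 0 : ℝ), S.α * z 0], ?_, _, h, ?_⟩
      · rw [S.mem_V]; simp
      · apply plane_ext <;> simp [intPoint, yPoint]
  simp only [Spaces.vertices, Set.mem_ofPred_eq, h, S.proj, πForm_apply]

/-- A matrix with eigenvalue `lam` on `V` and eigenvalue `mu` on `W`. -/
structure EigenEqs (M : Matrix (Fin 2) (Fin 2) ℤ) (lam mu : ℝ) : Prop where
  ρ_zero : (M 1 0 : ℝ) - S.α * M 0 0 = -(mu * S.α)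
  ρ_one : (M 1 1 : ℝ) - S.α * M 0 1 = mu
  π_zero : (M 1 0 : ℝ) - S.β * M 0 0 = -(lam * S.β)
  π_one : (M 1 1 : ℝ) - S.β * M 0 1 = lam

variable {S}

lemma EigenEqs.ρ_mulVec {M : Matrix (Fin 2) (Fin 2) ℤ} {lam mu : ℝ} (h : S.EigenEqs M lam mu)
    (z : Fin 2 → ℤ) : S.ρForm (M.mulVec z) = mu * S.ρForm z := by
  simp only [ρForm_apply, Matrix.mulVec, dotProduct, Fin.sum_univ_two, Int.cast_add, Int.cast_mul]
  linear_combination (z 0 : ℝ) * h.ρ_zero + (z 1 : ℝ) * h.ρ_one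

lemma EigenEqs.π_mulVec {M : Matrix (Fin 2) (Fin 2) ℤ} {lam mu : ℝ} (h : S.EigenEqs M lam mu)
    (z : Fin 2 → ℤ) : S.πForm (M.mulVec z) = lam * S.πForm z := by
  simp only [πForm_apply, Matrix.mulVec, dotProduct, Fin.sum_univ_two, Int.cast_add, Int.cast_mul]
  linear_combination S.κ * (z 0 : ℝ) * h.π_zero + S.κ * (z 1 : ℝ) * h.π_one

lemma EigenEqs.of_mulVec {M : Matrix (Fin 2) (Fin 2) ℤ} {lam mu : ℝ}
    (hρ : ∀ z, S.ρForm (M.mulVec z) = mu * S.ρForm z)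
    (hπ : ∀ z, S.πForm (M.mulVec z) = lam * S.πForm z) : S.EigenEqs M lam mu := by
  have h1 := hρ ![1, 0]
  have h2 := hρ ![0, 1]
  have h3 := hπ ![1, 0]
  have h4 := hπ ![0, 1]
  simp only [πForm_apply, ρForm_apply, Matrix.mulVec, dotProduct, Fin.sum_univ_two] at h1 h2 h3 h4
  simp at h1 h2 h3 h4
  have hκ := S.κ_ne
  refine ⟨by linarith, by linarith, mul_left_cancel₀ hκ ?_, mul_left_cancel₀ hκ ?_⟩
  · linarith
  · linarith

lemma EigenEqs.trace {M : Matrix (Fin 2) (Fin 2) ℤ} {lam mu : ℝ} (h : S.EigenEqs M lam mu) :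
    (M 0 0 : ℝ) + M 1 1 = lam + mu := by
  have h1 : (S.α - S.β) * (M 0 0 + M 1 1 - (lam + mu)) = 0 := by
    linear_combination -h.ρ_zero + h.π_zero - S.β * h.ρ_one + S.α * h.π_one
  rcases mul_eq_zero.1 h1 with h2 | h2
  · exact absurd (sub_eq_zero.1 h2) S.ne
  · linarith

lemma EigenEqs.det {M : Matrix (Fin 2) (Fin 2) ℤ} {lam mu : ℝ} (h : S.EigenEqs M lam mu) :
    (M.det : ℝ) = lam * mu := by
  rw [Matrix.det_fin_two]
  push_cast
  have h1 : (S.α - S.β) * (M 0 0 * M 1 1 - M 0 1 * M 1 0 - lam * mu) = 0 := by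
    rw [← h.ρ_one, ← h.π_one]
    have e1 := h.ρ_zero
    have e3 := h.π_zero
    rw [← h.ρ_one] at e1
    rw [← h.π_one] at e3
    have e5 : (M 0 0 : ℝ) * (S.α - S.β) = M 1 1 * (S.α - S.β) -
        M 0 1 * (S.α ^ 2 - S.β ^ 2) := by linear_combination -e1 + e3
    have e6 : (M 1 0 : ℝ) * (S.α - S.β) = - M 0 1 * (S.α - S.β) * (S.α * S.β) := by
      linear_combination -S.β * e1 + S.α * e3
    linear_combination (M 1 1 : ℝ) * e5 - (M 0 1 : ℝ) * e6
  rcases mul_eq_zero.1 h1 with h2 | h2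
  · exact absurd (sub_eq_zero.1 h2) S.ne
  · linarith

/-- A rational `mu = M 1 1 - α * M 0 1` would make `α` rational, unless `M 0 1 = 0`, and then both
eigenvalues equal `M 1 1`. The integral trace passes irrationality on to `lam`. -/
lemma EigenEqs.irrational {M : Matrix (Fin 2) (Fin 2) ℤ} {lam mu : ℝ} (h : S.EigenEqs M lam mu)
    (hα : Irrational S.α) (hne : lam ≠ mu) : Irrational lam ∧ Irrational mu := by
  have key : Irrational mu := by
    rintro ⟨x, hx⟩
    have h1 := h.ρ_one
    by_cases h01 : M 0 1 = 0
    · have h2 := h.π_one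
      rw [h01] at h1 h2
      apply hne
      rw [← h1, ← h2]
      simp
    · apply hα
      refine ⟨((M 1 1 : ℚ) - x) / (M 0 1 : ℚ), ?_⟩
      have : (M 0 1 : ℝ) ≠ 0 := by exact_mod_cast h01
      push_cast
      rw [hx, ← h1]
      field_simp
      ring
  refine ⟨?_, key⟩
  rintro ⟨x, hx⟩
  apply key
  refine ⟨(M 0 0 : ℚ) + M 1 1 - x, ?_⟩
  push_cast
  rw [h.trace, hx]
  ring

lemma EigenEqs.irrational_β {M : Matrix (Fin 2) (Fin 2) ℤ} {lam mu : ℝ} (h : S.EigenEqs M lam mu)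
    (hα : Irrational S.α) (hne : lam ≠ mu) : Irrational S.β := by
  rintro ⟨x, hx⟩
  apply (h.irrational hα hne).1
  refine ⟨(M 1 1 : ℚ) - x * M 0 1, ?_⟩
  push_cast
  rw [hx, h.π_one]

lemma EigenEqs.pow {M : Matrix (Fin 2) (Fin 2) ℤ} {lam mu : ℝ} (h : S.EigenEqs M lam mu) (n : ℕ) :
    S.EigenEqs (M ^ n) (lam ^ n) (mu ^ n) := by
  induction n with
  | zero => constructor <;> simp
  | succ n ih =>
    refine EigenEqs.of_mulVec (fun z => ?_) fun z => ?_
    · rw [pow_succ', ← Matrix.mulVec_mulVec, h.ρ_mulVec, ih.ρ_mulVec]; ring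
    · rw [pow_succ', ← Matrix.mulVec_mulVec, h.π_mulVec, ih.π_mulVec]; ring

lemma EigenEqs.entries {M : Matrix (Fin 2) (Fin 2) ℤ} {lam mu : ℝ} (h : S.EigenEqs M lam mu) :
    (S.α - S.β) * M 0 1 = lam - mu ∧ (S.α - S.β) * M 1 0 = S.α * S.β * (mu - lam) ∧
    (S.α - S.β) * M 0 0 = S.α * mu - S.β * lam ∧ (S.α - S.β) * M 1 1 = S.α * lam - S.β * mu := by
  obtain ⟨h1, h2, h3, h4⟩ := h
  refine ⟨?_, ?_, ?_, ?_⟩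
  · linear_combination h4 - h2
  · linear_combination -S.β * h1 + S.α * h3
  · linear_combination -h1 + h3
  · linear_combination -S.β * h2 + S.α * h4

/-- Up to the factor `α - β`, the entries of `M ^ n` are combinations of `lam ^ n` and `mu ^ n` with
nonzero coefficients built from the slopes. The term in `lam ^ n` dominates once `|lam| ^ n` exceeds
both ratios of the slopes. -/
lemma EigenEqs.isPrimitive {M : Matrix (Fin 2) (Fin 2) ℤ} {lam mu : ℝ} (h : S.EigenEqs M lam mu)
    (hα : Irrational S.α) (hlam : 1 < |lam|) (hmu : |mu| < 1) : IsPrimitiveMatrix M := by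
  have hne : lam ≠ mu := by rintro rfl; linarith
  have hα0 := hα.ne_zero
  have hβ0 := (h.irrational_β hα hne).ne_zero
  obtain ⟨n, hn⟩ := pow_unbounded_of_one_lt (max (|S.α| / |S.β|) (|S.β| / |S.α|) + 1) hlam
  refine ⟨n, ?_⟩
  have h1 := h.pow n
  obtain ⟨e01, e10, e00, e11⟩ := h1.entries
  have hmn : |mu| ^ n ≤ 1 := pow_le_one₀ (abs_nonneg _) hmu.le
  have hA : |S.α| / |S.β| < |lam| ^ n := by
    have := le_max_left (|S.α| / |S.β|) (|S.β| / |S.α|); linarith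
  have hB : |S.β| / |S.α| < |lam| ^ n := by
    have := le_max_right (|S.α| / |S.β|) (|S.β| / |S.α|); linarith
  have hα1 : 0 < |S.α| := abs_pos.2 hα0
  have hβ1 : 0 < |S.β| := abs_pos.2 hβ0
  rw [div_lt_iff₀ hβ1] at hA
  rw [div_lt_iff₀ hα1] at hB
  have hC : |S.α * mu ^ n| < |S.β * lam ^ n| := by
    rw [abs_mul, abs_mul, abs_pow, abs_pow]
    nlinarith
  have hD : |S.β * mu ^ n| < |S.α * lam ^ n| := by
    rw [abs_mul, abs_mul, abs_pow, abs_pow]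
    nlinarith
  have hE : lam ^ n ≠ mu ^ n := by
    intro he
    rw [he, abs_mul, abs_mul] at hC hD
    have hm : 0 < |mu ^ n| := by
      by_contra! h0
      have := le_antisymm h0 (abs_nonneg _)
      rw [this] at hC
      simp at hC
    have := lt_of_mul_lt_mul_right hC hm.le
    have := lt_of_mul_lt_mul_right hD hm.le
    linarith
  intro i j
  fin_cases i <;> fin_cases j <;> intro h0 <;> simp only [Fin.zero_eta, Fin.mk_one] at h0
  · rw [h0] at e00
    rw [show S.α * mu ^ n = S.β * lam ^ n by simp at e00; linarith] at hC
    exact lt_irrefl _ hC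
  · rw [h0] at e01
    apply hE
    simp at e01
    linarith
  · rw [h0] at e10
    simp at e10
    rcases e10 with (e | e) | e
    · exact hα0 e
    · exact hβ0 e
    · exact hE (by linarith)
  · rw [h0] at e11
    rw [show S.β * mu ^ n = S.α * lam ^ n by simp at e11; linarith] at hD
    exact lt_irrefl _ hD

variable (S)

/-- The eigenvectors `(1, α)` and `(1, β)` are dualised: `EigenEqs` speaks of the forms vanishing on
`V` and `W`, and the form that vanishes on `V` has the eigenvalue of `W`. -/
lemma exists_eigenEqs {M : GL (Fin 2) ℤ} {lam : ℝ} (h : HasEigenspaces P M lam) :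
    ∃ mu, |mu| < 1 ∧ S.EigenEqs M.val lam mu := by
  obtain ⟨-, -, hV, mu, hmu, hW⟩ := h
  refine ⟨mu, hmu, ?_⟩
  have hv : (!₂[1, S.α] : Plane) ∈ P.V := by rw [S.mem_V]; simp
  have hw : (!₂[1, S.β] : Plane) ∈ P.W := by rw [S.mem_W]; simp
  rw [hV, Module.End.mem_eigenspace_iff] at hv
  rw [hW, Module.End.mem_eigenspace_iff] at hw
  have h0 := congrArg (fun p : Plane => p 0) hv
  have h1 := congrArg (fun p : Plane => p 1) hv
  have h2 := congrArg (fun p : Plane => p 0) hw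
  have h3 := congrArg (fun p : Plane => p 1) hw
  simp only [matEnd_apply, PiLp.smul_apply, smul_eq_mul] at h0 h1 h2 h3
  simp only [Matrix.cons_val_zero, Matrix.cons_val_one, mul_one] at h0 h1 h2 h3
  have hne := sub_ne_zero.2 S.ne
  refine ⟨mul_left_cancel₀ hne ?_, mul_left_cancel₀ hne ?_, mul_left_cancel₀ hne ?_,
    mul_left_cancel₀ hne ?_⟩
  · linear_combination (-S.β - S.α + S.α) * h1 + S.α * h3 + S.α * S.β * h0 - S.α ^ 2 * h2
  · linear_combination h1 - h3 - S.α * h0 + S.α * h2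
  · linear_combination -S.β * h1 + S.α * h3 + S.β ^ 2 * h0 - S.α * S.β * h2
  · linear_combination h1 - h3 - S.β * h0 + S.β * h2

lemma hasEigenspaces_of_eigenEqs (hα : Irrational S.α) {M : GL (Fin 2) ℤ} {lam mu : ℝ}
    (hlam : 1 < |lam|) (hmu : |mu| < 1) (h : S.EigenEqs M.val lam mu) :
    HasEigenspaces P M lam := by
  have hne : lam ≠ mu := by rintro rfl; linarith
  have hαβ := sub_ne_zero.2 S.ne
  have hρ : ∀ p : Plane, matEnd M.val p 1 - S.α * matEnd M.val p 0 = mu * (p 1 - S.α * p 0) := by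
    intro p
    rw [matEnd_apply, matEnd_apply]
    linear_combination (p 0 : ℝ) * h.ρ_zero + (p 1 : ℝ) * h.ρ_one
  have hπ : ∀ p : Plane, matEnd M.val p 1 - S.β * matEnd M.val p 0 = lam * (p 1 - S.β * p 0) := by
    intro p
    rw [matEnd_apply, matEnd_apply]
    linear_combination (p 0 : ℝ) * h.π_zero + (p 1 : ℝ) * h.π_one
  have key : ∀ (p : Plane) (ν : ℝ), matEnd M.val p = ν • p ↔
      (mu - ν) * (p 1 - S.α * p 0) = 0 ∧ (lam - ν) * (p 1 - S.β * p 0) = 0 := by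
    intro p ν
    have h1 := hρ p
    have h2 := hπ p
    constructor
    · intro he
      rw [he] at h1 h2
      simp only [PiLp.smul_apply, smul_eq_mul] at h1 h2
      constructor <;> linarith
    · rintro ⟨h3, h4⟩
      apply plane_ext
      · simp only [PiLp.smul_apply, smul_eq_mul]
        apply mul_left_cancel₀ hαβ
        linear_combination h2 - h1 + h4 - h3
      · simp only [PiLp.smul_apply, smul_eq_mul]
        apply mul_left_cancel₀ hαβ
        linear_combination S.α * h2 - S.β * h1 + S.α * h4 - S.β * h3
  refine ⟨h.isPrimitive hα hlam hmu, hlam, ?_, mu, hmu, ?_⟩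
  · ext p
    rw [S.mem_V, Module.End.mem_eigenspace_iff, key, sub_self, zero_mul, mul_eq_zero, sub_eq_zero,
      sub_eq_zero]
    simp [hne.symm]
  · ext p
    rw [S.mem_W, Module.End.mem_eigenspace_iff, key, sub_self, zero_mul, mul_eq_zero, sub_eq_zero,
      sub_eq_zero]
    simp [hne]

/-- Modulo `V` the plane is a line on which `M` acts by the other eigenvalue `mu`. -/
lemma subwindow_eq {M : Matrix (Fin 2) (Fin 2) ℤ} {lam mu : ℝ} (h : S.EigenEqs M lam mu)
    (s : Fin 2 → ℚ) (t : ℝ) (X : Set ℝ) :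
    P.subwindow M s t X = {y | ∃ ω ∈ X, y = t + ((s 1 : ℝ) - S.α * s 0) + mu * ω} := by
  ext y
  simp only [Spaces.subwindow, Set.mem_ofPred_eq]
  refine exists_congr fun ω => and_congr_right fun _ => ?_
  rw [S.mem_V]
  simp only [PiLp.sub_apply, PiLp.add_apply, matEnd_apply]
  simp [ratPoint, yPoint]
  have := h.ρ_one
  constructor <;> intro h1
  · linear_combination -h1 + ω * this
  · linear_combination -h1 + ω * this

/-! ### The cut and project scheme of the two lines -/

lemma ρForm_injective (hα : Irrational S.α) : Function.Injective S.ρForm := by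
  rw [injective_iff_map_eq_zero]
  intro z hz
  rw [ρForm_apply] at hz
  have h0 : z 0 = 0 := by
    by_contra h0
    apply hα
    refine ⟨(z 1 : ℚ) / z 0, ?_⟩
    have : (z 0 : ℝ) ≠ 0 := by exact_mod_cast h0
    push_cast
    field_simp
    linarith
  rw [h0] at hz
  have h1 : z 1 = 0 := by simpa using hz
  ext i
  fin_cases i
  · exact h0
  · exact h1

lemma πForm_injective (hβ : Irrational S.β) : Function.Injective S.πForm := by
  rw [injective_iff_map_eq_zero]
  intro z hz
  rw [πForm_apply] at hz
  have hz := (mul_eq_zero.1 hz).resolve_left S.κ_ne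
  have h0 : z 0 = 0 := by
    by_contra h0
    apply hβ
    refine ⟨(z 1 : ℚ) / z 0, ?_⟩
    have : (z 0 : ℝ) ≠ 0 := by exact_mod_cast h0
    push_cast
    field_simp
    linarith
  rw [h0] at hz
  have h1 : z 1 = 0 := by simpa using hz
  ext i
  fin_cases i
  · exact h0
  · exact h1

/-- Density of the multiples of `α` on the circle, in recurrent form: the forward orbit clusters at
every point, so `n` can be taken beyond `N`. -/
lemma exists_nat_mul_sub_mem {α : ℝ} (hα : Irrational α) {a b : ℝ} (hab : a < b) (N : ℕ) :
    ∃ n : ℕ, N ≤ n ∧ ∃ m : ℤ, a < m - α * n ∧ m - α * n < b := by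
  have h1 : DenseRange (· • (α : AddCircle (1 : ℝ)) : ℤ → AddCircle (1 : ℝ)) :=
    AddCircle.denseRange_zsmul_coe_iff.2 (by simpa using hα)
  have : Fact ((0 : ℝ) < 1) := ⟨one_pos⟩
  set y : AddCircle (1 : ℝ) := ((-(a + b) / 2 : ℝ) : AddCircle (1 : ℝ)) with hy
  have h2 : MapClusterPt y Filter.atTop (· • (α : AddCircle (1 : ℝ)) : ℕ → AddCircle (1 : ℝ)) :=
    (mapClusterPt_atTop_nsmul_tfae y (α : AddCircle (1 : ℝ))).out 3 0 |>.1 (h1 y)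
  have h3 : ((↑) : ℝ → AddCircle (1 : ℝ)) '' Set.Ioo (-b) (-a) ∈ nhds y := by
    refine (QuotientAddGroup.isOpenMap_coe _ isOpen_Ioo).mem_nhds ⟨_, ?_, rfl⟩
    constructor <;> linarith
  have h4 := (mapClusterPt_iff_frequently.1 h2 _ h3).and_eventually (Filter.eventually_ge_atTop N)
  obtain ⟨n, ⟨x, hx, hxn⟩, hn⟩ := h4.exists
  refine ⟨n, hn, ?_⟩
  have h5 : ((n * α - x : ℝ) : AddCircle (1 : ℝ)) = 0 := by
    rw [AddCircle.coe_sub, hxn, ← nsmul_eq_mul, AddCircle.coe_nsmul, sub_self]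
  obtain ⟨m, hm⟩ := (AddCircle.coe_eq_zero_iff (1 : ℝ)).1 h5
  refine ⟨m, ?_⟩
  simp only [zsmul_eq_mul, mul_one] at hm
  rw [hm]
  constructor <;> linarith [hx.1, hx.2]

/-- Since `π z = κ * ρ z + κ * (α - β) * z 0`, for bounded `ρ` the value of `π` is governed by the
first coordinate, which can be made large of either sign, by negating the vector if necessary. -/
lemma ρπ_dense (hα : Irrational S.α) (a b R : ℝ) (hab : a < b) :
    ∃ g, a < S.ρForm g ∧ S.ρForm g < b ∧ R < S.πForm g := by
  have hk : S.κ * (S.α - S.β) ≠ 0 := mul_ne_zero S.κ_ne (sub_ne_zero.2 S.ne)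
  have hform : ∀ z, S.πForm z = S.κ * S.ρForm z + S.κ * (S.α - S.β) * z 0 := by
    intro z
    rw [πForm_apply, ρForm_apply]; ring
  have hbound : ∀ x, a < x → x < b → -(|S.κ| * (|a| + |b|)) ≤ S.κ * x := by
    intro x h1 h2
    have h3 : |S.κ * x| ≤ |S.κ| * (|a| + |b|) := by
      rw [abs_mul]
      refine mul_le_mul_of_nonneg_left ?_ (abs_nonneg _)
      have := abs_le_max_abs_abs h1.le h2.le
      exact this.trans (max_le_add_of_nonneg (abs_nonneg _) (abs_nonneg _))
    exact (abs_le.1 h3).1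
  obtain ⟨N, hN⟩ := exists_nat_gt ((R + |S.κ| * (|a| + |b|)) / |S.κ * (S.α - S.β)|)
  rw [div_lt_iff₀ (abs_pos.2 hk)] at hN
  rcases lt_or_gt_of_ne hk with hneg | hpos
  · obtain ⟨n, hn, m, h1, h2⟩ := exists_nat_mul_sub_mem hα (neg_lt_neg hab) N
    rw [abs_of_neg hneg] at hN
    have hn' : (N : ℝ) ≤ n := by exact_mod_cast hn
    have h3 := mul_le_mul_of_nonneg_right hn' (neg_pos.2 hneg).le
    have hρ : S.ρForm ![-(n : ℤ), -m] = -(m - S.α * n) := by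
      rw [ρForm_apply]; simp; ring
    refine ⟨![-(n : ℤ), -m], by rw [hρ]; linarith, by rw [hρ]; linarith, ?_⟩
    rw [hform, hρ]
    have := hbound (-(m - S.α * n)) (by linarith) (by linarith)
    simp only [Matrix.cons_val_zero, Int.cast_neg, Int.cast_natCast]
    linarith
  · obtain ⟨n, hn, m, h1, h2⟩ := exists_nat_mul_sub_mem hα hab N
    rw [abs_of_pos hpos] at hN
    have hn' : (N : ℝ) ≤ n := by exact_mod_cast hn
    have h3 := mul_le_mul_of_nonneg_right hn' hpos.le
    have hρ : S.ρForm ![(n : ℤ), m] = m - S.α * n := by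
      rw [ρForm_apply]; simp
    refine ⟨![(n : ℤ), m], by rw [hρ]; linarith, by rw [hρ]; linarith, ?_⟩
    rw [hform, hρ]
    have := hbound (m - S.α * n) (by linarith) (by linarith)
    simp only [Matrix.cons_val_zero, Int.cast_natCast]
    linarith

lemma finite_box (R : ℝ) : {z | |S.πForm z| ≤ R ∧ |S.ρForm z| ≤ R}.Finite := by
  have hk : 0 < |S.κ * (S.α - S.β)| :=
    abs_pos.2 (mul_ne_zero S.κ_ne (sub_ne_zero.2 S.ne))
  set A := (R + |S.κ| * R) / |S.κ * (S.α - S.β)| with hA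
  obtain ⟨N, hN⟩ := exists_nat_ge (A + (R + |S.α| * A))
  refine (Set.finite_Icc (fun _ : Fin 2 => -(N : ℤ)) fun _ => (N : ℤ)).subset ?_
  rintro z ⟨h1, h2⟩
  have hR : 0 ≤ R := (abs_nonneg _).trans h1
  have hA0 : 0 ≤ A := by positivity
  have h3 : |(z 0 : ℝ)| ≤ A := by
    rw [hA, le_div_iff₀ hk, ← abs_mul]
    have : (z 0 : ℝ) * (S.κ * (S.α - S.β)) = S.πForm z - S.κ * S.ρForm z := by
      rw [πForm_apply, ρForm_apply]; ring
    rw [this]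
    refine (abs_sub _ _).trans (add_le_add h1 ?_)
    rw [abs_mul]
    exact mul_le_mul_of_nonneg_left h2 (abs_nonneg _)
  have h4 : |(z 1 : ℝ)| ≤ R + |S.α| * A := by
    have : (z 1 : ℝ) = S.ρForm z + S.α * z 0 := by rw [ρForm_apply]; ring
    rw [this]
    refine (abs_add_le _ _).trans (add_le_add h2 ?_)
    rw [abs_mul]
    exact mul_le_mul_of_nonneg_left h3 (abs_nonneg _)
  have h5 : 0 ≤ R + |S.α| * A := by positivity
  have h6 : |z 0| ≤ (N : ℤ) := by
    have : |(z 0 : ℝ)| ≤ N := by linarith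
    exact_mod_cast this
  have h7 : |z 1| ≤ (N : ℤ) := by
    have : |(z 1 : ℝ)| ≤ N := by linarith
    exact_mod_cast this
  rw [abs_le] at h6 h7
  constructor
  · intro i; fin_cases i
    · exact h6.1
    · exact h7.1
  · intro i; fin_cases i
    · exact h6.2
    · exact h7.2

/-- The cut and project scheme of the two lines. -/
def cut (hα : Irrational S.α) : CutScheme (Fin 2 → ℤ) where
  π := S.πForm
  ρ := S.ρForm
  ρ_injective := S.ρForm_injective hα
  dense := S.ρπ_dense hα
  finite := S.finite_box

lemma vertices_eq_vset (hα : Irrational S.α) (X : Set ℝ) : P.vertices X = (S.cut hα).vset X :=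
  S.vertices_eq X

/-- For a nonperiodic tiling, the tiling space has irrational slope. -/
lemma irrational_of_nonperiodic {X : Set ℝ} (h : Nonperiodic (P.vertices X)) :
    Irrational S.α := by
  rintro ⟨x, hx⟩
  have hx' : (x.num : ℝ) - S.α * x.den = 0 := by
    rw [← hx]
    have : (x : ℝ) * x.den = x.num := by exact_mod_cast Rat.mul_den_eq_num x
    linarith
  -- A rational slope puts this lattice vector on `V`, and its projection is a period.
  have h1 : S.ρForm ![(x.den : ℤ), x.num] = 0 := by rw [ρForm_apply]; simpa using hx'
  have h2 := h (S.πForm ![(x.den : ℤ), x.num]) fun y => by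
    rw [S.vertices_eq]
    constructor
    · rintro ⟨z, hz, rfl⟩
      exact ⟨z + ![(x.den : ℤ), x.num], by rw [map_add, h1, add_zero]; exact hz, map_add _ _ _⟩
    · rintro ⟨z, hz, hzy⟩
      exact ⟨z - ![(x.den : ℤ), x.num], by rw [map_sub, h1, sub_zero]; exact hz,
        by rw [map_sub, hzy]; ring⟩
  rw [πForm_apply] at h2
  have h3 := (mul_eq_zero.1 h2).resolve_left S.κ_ne
  simp at h3
  have h4 : (S.α - S.β) * x.den = 0 := by linarith
  rcases mul_eq_zero.1 h4 with h5 | h5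
  · exact S.ne (sub_eq_zero.1 h5)
  · exact x.den_nz (by exact_mod_cast h5)

end Slopes

/-! ### Rational window spaces -/

lemma exists_add_zsmul_mem_halfOpen {L₀ ℓ : ℝ} (hL : L₀ ≠ 0) (hLℓ : |L₀| ≤ ℓ) (c : Bool)
    (x t : ℝ) : ∃ j : ℤ, x + j * L₀ ∈ halfOpen c t (t + ℓ) := by
  have h1 : ∃ j : ℤ, x + j * |L₀| ∈ halfOpen c t (t + ℓ) := by
    cases c
    · obtain ⟨j, hj, -⟩ := existsUnique_add_zsmul_mem_Ioc (abs_pos.2 hL) x t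
      rw [zsmul_eq_mul] at hj
      exact ⟨j, hj.1, hj.2.trans (by linarith)⟩
    · obtain ⟨j, hj, -⟩ := existsUnique_add_zsmul_mem_Ico (abs_pos.2 hL) x t
      rw [zsmul_eq_mul] at hj
      exact ⟨j, hj.1, hj.2.trans_le (by linarith)⟩
  obtain ⟨j, hj⟩ := h1
  rcases abs_choice L₀ with h | h
  · exact ⟨j, by rwa [h] at hj⟩
  · refine ⟨-j, ?_⟩
    rw [h] at hj
    convert hj using 1
    push_cast
    ring

namespace CutScheme

/-- If the projection to the tiling space has a cyclic image, then a nonperiodic model set admits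
no substitution rule. -/
lemma not_isRuleOf_of_cyclic {G : Type*} [AddCommGroup G] (C : CutScheme G) {z₀ e : G}
    (hz₀ : z₀ ≠ 0) (hπz₀ : C.π z₀ = 0) (hker : ∀ g, C.π g = 0 → ∃ j : ℤ, g = j • z₀)
    (he : C.π e ≠ 0) (hcyc : ∀ g, ∃ n : ℤ, C.π g = n * C.π e) {ℓ t : ℝ} (hℓ : 0 < ℓ) {c : Bool}
    (hD : Nonperiodic (C.vset (halfOpen c t (t + ℓ)))) (σ : SubstitutionRule) :
    ¬ σ.IsRuleOf (C.vset (halfOpen c t (t + ℓ))) := by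
  rintro ⟨T, hT⟩
  have hL0 : C.ρ z₀ ≠ 0 := fun h => hz₀ (C.ρ_injective (by rw [h, map_zero]))
  -- If the kernel of `π` moved by steps of at most `ℓ` in the window, every `π g` would be a vertex
  -- and `π e` a period.
  have hℓL : ℓ < |C.ρ z₀| := by
    by_contra! hle
    have hall : ∀ g, C.π g ∈ C.vset (halfOpen c t (t + ℓ)) := by
      intro g
      obtain ⟨j, hj⟩ := exists_add_zsmul_mem_halfOpen hL0 hle c (C.ρ g) t
      refine ⟨g + j • z₀, ?_, ?_⟩
      · rwa [map_add, map_zsmul, zsmul_eq_mul]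
      · rw [map_add, map_zsmul, hπz₀]; simp
    refine he (hD (C.π e) fun x => ⟨?_, ?_⟩)
    · rintro ⟨g, -, rfl⟩
      rw [← map_add]
      exact hall _
    · rintro ⟨g, -, hg⟩
      have : x = C.π (g - e) := by rw [map_sub, hg]; ring
      rw [this]
      exact hall _
  set L := |C.ρ z₀| with hL
  -- the inflation factor is an integer
  obtain ⟨T', -, hT'2, hT'3⟩ := hT.2.2.2 1
  obtain ⟨e', he'⟩ := C.exists_lam_mul' hℓ hT.2.1 hT'2.2 hT'3 e
  obtain ⟨Λ, hΛ⟩ := hcyc e'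
  have hfac : σ.factor = Λ := by
    rw [hΛ] at he'
    exact mul_right_cancel₀ he he'
  have hΛ1 : (1 : ℝ) < Λ := hfac ▸ σ.one_lt_factor
  -- occurrences of long patches
  set η := ℓ / (σ.card + 1) with hη
  have hη0 : 0 < η := by positivity
  have hηℓ : (σ.card + 1) * η = ℓ := by rw [hη]; field_simp
  -- The first bound excludes `j = 0` at the end and the second `j ≠ 0`, where `j` counts multiples
  -- of `z₀`.
  set w := min (η / 8) (L - ℓ) with hw
  have hw0 : 0 < w := lt_min (by positivity) (by linarith)
  have hw1 : w ≤ η / 8 := min_le_left _ _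
  have hw2 : w ≤ L - ℓ := min_le_right _ _
  obtain ⟨R, hR⟩ := C.exists_cover hw0 ℓ
  obtain ⟨k, hk⟩ := σ.exists_level R
  obtain ⟨U, -, hU2, hU3⟩ := hT.2.2.2 k
  have hΛk : (1 : ℝ) ≤ (Λ : ℝ) ^ k := one_le_pow₀ hΛ1.le
  have hΛk0 : (0 : ℝ) < (Λ : ℝ) ^ k := by linarith
  -- Inflation by `Λ ^ k` multiplies window coordinates by `Λ ^ k` modulo `ρ z₀`. The vertices are
  -- packed near the base at spacing `η / Λ ^ k`, so that inflated pairs are about a multiple of `η`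
  -- apart and yet less than `ℓ`.
  have h1 : ∀ a : Fin (σ.card + 1), ∃ g, t + a * η / Λ ^ k < C.ρ g ∧
      C.ρ g < t + a * η / Λ ^ k + η / 4 / Λ ^ k := by
    intro a
    obtain ⟨g, h1, h2, -⟩ := C.dense (t + a * η / Λ ^ k) (t + a * η / Λ ^ k + η / 4 / Λ ^ k) 0 (by
      have : 0 < η / 4 / (Λ : ℝ) ^ k := by positivity
      linarith)
    exact ⟨g, h1, h2⟩
  choose g hg1 hg2 using h1
  have hgV : ∀ a, C.π (g a) ∈ vert T := by
    intro a
    rw [hT.2.1]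
    refine ⟨g a, mem_halfOpen_of_lt ?_ ?_, rfl⟩
    · have : 0 ≤ (a : ℝ) * η / Λ ^ k := by positivity
      linarith [hg1 a]
    · have : (a : ℝ) ≤ σ.card := by exact_mod_cast Nat.lt_succ_iff.1 a.2
      have h2 := mul_le_mul_of_nonneg_right this hη0.le
      have h3 : (a : ℝ) * η / Λ ^ k + η / 4 / Λ ^ k ≤ a * η + η / 4 := by
        rw [← add_div]
        exact div_le_self (by positivity) hΛk
      linarith [hg2 a]
  obtain ⟨a, b, i, y, y', hab, hy, hy', hyy⟩ :=
    SubstitutionRule.exists_same_patch hU2.2 hU3 _ hgV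
  have hyv := SubstitutionRule.mem_vert_of_place_patch hy
  have hyv' := SubstitutionRule.mem_vert_of_place_patch hy'
  have hyv2 := hyv
  have hyv2' := hyv'
  rw [hT.2.1] at hyv2 hyv2'
  obtain ⟨z, hz, rfl⟩ := hyv2
  obtain ⟨z', hz', rfl⟩ := hyv2'
  -- Full positions are not available, as `π` has a kernel: a point outside the window may be
  -- congruent modulo `z₀` to one inside. This cannot happen below the height `L`.
  have hnear : ∀ z, C.ρ z ∈ halfOpen c t (t + ℓ) →
      C.PosNear ℓ L (vert T) (C.π z) (C.ρ z - t) := by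
    intro z hz
    have hz1 := mem_Icc_of_mem_halfOpen hz
    refine ⟨by linarith, by linarith, fun g h2 h3 => ?_, fun g h2 h3 h4 => ?_⟩
    · rw [hT.2.1]
      exact ⟨z + g, mem_halfOpen_of_lt (by rw [map_add]; linarith) (by rw [map_add]; linarith),
        map_add _ _ _⟩
    · rw [hT.2.1] at h4
      obtain ⟨h, hh, hh2⟩ := h4
      have hh1 := mem_Icc_of_mem_halfOpen hh
      obtain ⟨j, hj⟩ := hker (z + g - h) (by rw [map_sub, map_add, hh2]; ring)
      have hj2 : C.ρ z + C.ρ g - C.ρ h = j * C.ρ z₀ := by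
        rw [← map_add, ← map_sub, hj, map_zsmul, zsmul_eq_mul]
      rcases eq_or_ne j 0 with rfl | hj0
      · simp at hj2
        linarith
      · have h5 : (1 : ℝ) ≤ |(j : ℝ)| := by exact_mod_cast Int.one_le_abs hj0
        have h6 : L ≤ |C.ρ z + C.ρ g - C.ρ h| := by
          rw [hj2, abs_mul]
          exact le_mul_of_one_le_left (abs_nonneg _) h5
        have h7 : |C.ρ z + C.ρ g - C.ρ h| < L := by
          rw [abs_lt]
          constructor <;> linarith
        linarith
  have h3 : |C.ρ z - t - (C.ρ z' - t)| ≤ w :=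
    (hnear z hz).abs_sub_le (hnear z' hz') hw2 hR fun s hs hs' =>
      hT.1.pattern_eq σ.len_pos σ.len_pos hT.1 hy hy' rfl hs (hs'.trans_le (hk k le_rfl i))
  obtain ⟨j, hj⟩ := hker (z' - z - Λ ^ k • (g b - g a)) (by
    rw [map_sub, map_sub, hyy, map_zsmul, map_sub, zsmul_eq_mul, hfac]
    push_cast
    ring)
  have hj2 : C.ρ z' - C.ρ z = Λ ^ k * (C.ρ (g b) - C.ρ (g a)) + j * C.ρ z₀ := by
    have h4 := congrArg C.ρ hj
    rw [map_sub, map_sub, map_zsmul, map_zsmul, map_sub, zsmul_eq_mul, zsmul_eq_mul] at h4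
    push_cast at h4
    linarith
  set X := (Λ : ℝ) ^ k * (C.ρ (g b) - C.ρ (g a)) with hX
  have hg1' : ∀ a, a * η < Λ ^ k * (C.ρ (g a) - t) := by
    intro a
    have h4 : a * η / (Λ : ℝ) ^ k < C.ρ (g a) - t := by linarith [hg1 a]
    rw [div_lt_iff₀ hΛk0] at h4
    linarith
  have hg2' : ∀ a, Λ ^ k * (C.ρ (g a) - t) < a * η + η / 4 := by
    intro a
    have h4 : C.ρ (g a) - t < (a * η + η / 4) / (Λ : ℝ) ^ k := by
      rw [add_div]; linarith [hg2 a]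
    rw [lt_div_iff₀ hΛk0] at h4
    linarith
  have hab' : (a : ℝ) + 1 ≤ b := by exact_mod_cast hab
  have hab2 := mul_le_mul_of_nonneg_right hab' hη0.le
  have hb : (b : ℝ) ≤ σ.card := by exact_mod_cast Nat.lt_succ_iff.1 b.2
  have hb2 := mul_le_mul_of_nonneg_right hb hη0.le
  have ha2 : 0 ≤ (a : ℝ) * η := by positivity
  have hX1 : 3 * η / 4 < X := by linarith [hg1' b, hg2' a]
  have hX2 : X < σ.card * η + η / 4 := by linarith [hg1' a, hg2' b]
  rw [abs_le] at h3
  rcases eq_or_ne j 0 with rfl | hj0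
  · simp at hj2
    linarith
  · have h5 : (1 : ℝ) ≤ |(j : ℝ)| := by exact_mod_cast Int.one_le_abs hj0
    have h6 : L ≤ |j * C.ρ z₀| := by
      rw [abs_mul]
      exact le_mul_of_one_le_left (abs_nonneg _) h5
    have h7 : |j * C.ρ z₀| < L := by
      rw [abs_lt]
      constructor <;> linarith
    linarith

end CutScheme

namespace Slopes

variable {P : Spaces} (S : Slopes P)

/-- A rational slope of `W` is the cyclic case: `π` takes values in the multiples of `κ / den`,
which a Bézout vector attains, and `(den, num)` generates its kernel. -/
lemma irrational_β_of_isRuleOf (hα : Irrational S.α) {ℓ t : ℝ} (hℓ : 0 < ℓ) {c : Bool}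
    (hD : Nonperiodic (P.vertices (halfOpen c t (t + ℓ)))) {σ : SubstitutionRule}
    (hσ : σ.IsRuleOf (P.vertices (halfOpen c t (t + ℓ)))) : Irrational S.β := by
  rintro ⟨x, hx⟩
  rw [S.vertices_eq_vset hα] at hD hσ
  have hden : (x.den : ℝ) ≠ 0 := by exact_mod_cast x.den_nz
  have hβ : S.β * x.den = x.num := by
    rw [← hx]
    exact_mod_cast Rat.mul_den_eq_num x
  have hform : ∀ z : Fin 2 → ℤ, S.πForm z = S.κ / x.den * (x.den * z 1 - x.num * z 0) := by
    intro z
    rw [πForm_apply, ← hβ]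
    field_simp
  have hcop : IsCoprime x.num (x.den : ℤ) :=
    Int.isCoprime_iff_gcd_eq_one.2 (by simpa [Int.gcd] using x.reduced)
  obtain ⟨u, v, huv⟩ := hcop
  have hκ : S.κ / x.den ≠ 0 := div_ne_zero S.κ_ne hden
  have he : S.πForm ![-u, v] = S.κ / x.den := by
    rw [hform]
    have : (u : ℝ) * x.num + v * x.den = 1 := by exact_mod_cast huv
    simp only [Matrix.cons_val_zero, Matrix.cons_val_one, Int.cast_neg]
    linear_combination S.κ / x.den * this
  refine (S.cut hα).not_isRuleOf_of_cyclic (z₀ := ![(x.den : ℤ), x.num]) (e := ![-u, v])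
    ?_ ?_ ?_ ?_ ?_ hℓ hD σ hσ
  · intro h
    have := congrFun h 0
    simp at this
  · change S.πForm _ = 0
    rw [hform]
    simp
    right
    ring
  · intro g hg
    change S.πForm g = 0 at hg
    rw [hform] at hg
    have h1 := (mul_eq_zero.1 hg).resolve_left hκ
    have h2 : (x.den : ℤ) * g 1 = x.num * g 0 := by
      have : (x.den : ℝ) * g 1 = x.num * g 0 := by linarith
      exact_mod_cast this
    have h3 : (x.den : ℤ) ∣ g 0 :=
      (show IsCoprime (x.den : ℤ) x.num from ⟨v, u, by linarith⟩).dvd_of_dvd_mul_left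
        ⟨g 1, h2.symm⟩
    obtain ⟨j, hj⟩ := h3
    refine ⟨j, ?_⟩
    have hden' : (x.den : ℤ) ≠ 0 := by exact_mod_cast x.den_nz
    ext i
    fin_cases i
    · simp [hj, mul_comm]
    · simp only [Fin.mk_one, Pi.smul_apply, Matrix.cons_val_one, smul_eq_mul]
      apply mul_left_cancel₀ hden'
      rw [h2, hj]
      simp
      ring
  · change S.πForm _ ≠ 0
    rw [he]
    exact hκ
  · intro g
    refine ⟨x.den * g 1 - x.num * g 0, ?_⟩
    change S.πForm _ = _ * S.πForm _
    rw [he, hform]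
    push_cast
    ring

/-! ### The inflation acts on the lattice -/

/-- The inflation by the factor of a substitution rule is given by an integer matrix. -/
lemma exists_matrix (hα : Irrational S.α) (hβ : Irrational S.β) {ℓ t : ℝ} (hℓ : 0 < ℓ) {c : Bool}
    {σ : SubstitutionRule} (hσ : σ.IsRuleOf (P.vertices (halfOpen c t (t + ℓ)))) :
    ∃ (M : Matrix (Fin 2) (Fin 2) ℤ) (mu : ℝ), mu ≠ 0 ∧ σ.factor ≠ mu ∧
      S.EigenEqs M σ.factor mu := by
  obtain ⟨T, hT⟩ := hσ
  rw [S.vertices_eq_vset hα] at hT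
  set C := S.cut hα with hC
  have hπi : Function.Injective C.π := S.πForm_injective hβ
  obtain ⟨T', -, hT'2, hT'3⟩ := hT.2.2.2 1
  have hlift := fun g => C.exists_lam_mul' hℓ hT.2.1 hT'2.2 hT'3 g
  obtain ⟨g₀, hg₀⟩ := hlift ![1, 0]
  obtain ⟨g₁, hg₁⟩ := hlift ![0, 1]
  change σ.factor * S.πForm _ = S.πForm _ at hg₀ hg₁
  set M : Matrix (Fin 2) (Fin 2) ℤ := !![g₀ 0, g₁ 0; g₀ 1, g₁ 1] with hM
  have hMπ : ∀ z, S.πForm (M.mulVec z) = σ.factor * S.πForm z := by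
    intro z
    simp only [πForm_apply] at hg₀ hg₁ ⊢
    simp [hM, Matrix.mulVec, dotProduct, Fin.sum_univ_two] at hg₀ hg₁ ⊢
    linear_combination -(z 0 : ℝ) * hg₀ - (z 1 : ℝ) * hg₁
  have hMρ : ∀ z, |S.ρForm z| < ℓ → |S.ρForm (M.mulVec z)| < ℓ := by
    intro z hz
    obtain ⟨g', h1, h2⟩ := C.exists_lam_mul hℓ hT.2.1 hT'2.2 hT'3 hz
    have : g' = M.mulVec z := hπi (by
      change S.πForm _ = S.πForm _
      rw [hMπ]
      exact h1.symm)
    rw [← this]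
    exact h2
  have hne := sub_ne_zero.2 S.ne
  have hκ := S.κ_ne
  -- the linear form `ρ ∘ M` in terms of `ρ` and `π`
  obtain ⟨a, b, hab⟩ : ∃ a b : ℝ, ∀ z, S.ρForm (M.mulVec z) = a * S.ρForm z + b * S.πForm z := by
    set c₀ := (M 1 0 : ℝ) - S.α * M 0 0 with hc₀
    set c₁ := (M 1 1 : ℝ) - S.α * M 0 1 with hc₁
    refine ⟨-(c₀ + S.β * c₁) / (S.α - S.β), (c₀ + S.α * c₁) / (S.κ * (S.α - S.β)), fun z => ?_⟩
    have : S.ρForm (M.mulVec z) = c₀ * z 0 + c₁ * z 1 := by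
      rw [ρForm_apply]
      simp only [Matrix.mulVec, dotProduct, Fin.sum_univ_two, Int.cast_add, Int.cast_mul]
      rw [hc₀, hc₁]
      ring
    rw [this, ρForm_apply, πForm_apply]
    field_simp
    ring
  -- Vectors with `|ρ| < ℓ` can have arbitrarily large `π`, but `M` keeps `|ρ|` below `ℓ`.
  have hb : b = 0 := by
    by_contra hb
    have hb' : 0 < |b| := abs_pos.2 hb
    obtain ⟨g, h1, h2, h3⟩ := S.ρπ_dense hα 0 ℓ ((ℓ + |a| * ℓ) / |b|) hℓ
    have h4 := hMρ g (by rw [abs_of_pos h1]; exact h2)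
    rw [div_lt_iff₀ hb'] at h3
    have h5 : |b * S.πForm g| ≤ |S.ρForm (M.mulVec g)| + |a * S.ρForm g| := by
      rw [show b * S.πForm g = S.ρForm (M.mulVec g) - a * S.ρForm g by rw [hab]; ring]
      exact abs_sub _ _
    rw [abs_mul, abs_mul, abs_of_pos h1] at h5
    have h6 := mul_le_mul_of_nonneg_left h2.le (abs_nonneg a)
    have h7 := mul_le_mul_of_nonneg_left (le_abs_self (S.πForm g)) hb'.le
    linarith
  have hMρ' : ∀ z, S.ρForm (M.mulVec z) = a * S.ρForm z := by
    intro z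
    rw [hab, hb]
    ring
  refine ⟨M, a, ?_, ?_, EigenEqs.of_mulVec hMρ' hMπ⟩
  · rintro rfl
    have h1 : ∀ z, S.πForm z = 0 := by
      intro z
      have h2 : M.mulVec z = 0 := S.ρForm_injective hα (by rw [hMρ', map_zero, zero_mul])
      have h3 := hMπ z
      rw [h2, map_zero] at h3
      exact (mul_eq_zero.1 h3.symm).resolve_left σ.factor_pos.ne'
    have h2 : (![1, 0] : Fin 2 → ℤ) = 0 := S.πForm_injective hβ (by rw [h1, map_zero])
    have := congrFun h2 0
    simp at this
  -- If `mu` were the inflation factor, a vector with `ρ` between `ℓ / factor` and `ℓ` would be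
  -- expanded out of the range that `M` preserves.
  · intro h
    have h1 := σ.one_lt_factor
    have h0 := σ.factor_pos
    obtain ⟨g, h2, h3, -⟩ := S.ρπ_dense hα (ℓ / σ.factor) ℓ 0 (div_lt_self hℓ h1)
    have h4 : 0 < S.ρForm g := lt_trans (by positivity) h2
    have h5 := hMρ g (by rw [abs_of_pos h4]; exact h3)
    rw [hMρ', ← h, abs_of_pos (mul_pos h0 h4)] at h5
    rw [div_lt_iff₀ h0] at h2
    linarith

end Slopes

namespace Slopes

variable {P : Spaces} (S : Slopes P)

/-! ### Recurrence of the lattice -/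

/-- The point of the plane with `ρ = a + R / 2` and `π = R / 2` is rounded to a lattice point; this
changes `ρ` by at most `A` and `π` by at most `B`, both less than `R / 2`. -/
lemma exists_covers (hα : Irrational S.α) : ∃ R > 0, (S.cut hα).Covers R R := by
  have hk : S.κ * (S.α - S.β) ≠ 0 := mul_ne_zero S.κ_ne (sub_ne_zero.2 S.ne)
  set A := 1 + |S.α| with hA
  set B := |S.κ| * (1 + |S.β|) with hB
  have hA0 : 0 < A := by positivity
  have hB0 : 0 < B := mul_pos (abs_pos.2 S.κ_ne) (by positivity)
  refine ⟨2 * (A + B) + 1, by positivity, fun a => ?_⟩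
  set R := 2 * (A + B) + 1 with hR
  set x := (R / 2 - S.κ * (a + R / 2)) / (S.κ * (S.α - S.β)) with hx
  set y := a + R / 2 + S.α * x with hy
  have hρ : y - S.α * x = a + R / 2 := by rw [hy]; ring
  have hπ : S.κ * (y - S.β * x) = R / 2 := by
    have h1 : x * (S.κ * (S.α - S.β)) = R / 2 - S.κ * (a + R / 2) := div_mul_cancel₀ _ hk
    rw [hy]
    linear_combination h1
  have hx1 : |(⌊x⌋ : ℝ) - x| ≤ 1 := by
    rw [abs_le]; constructor <;> linarith [Int.floor_le x, Int.lt_floor_add_one x]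
  have hy1 : |(⌊y⌋ : ℝ) - y| ≤ 1 := by
    rw [abs_le]; constructor <;> linarith [Int.floor_le y, Int.lt_floor_add_one y]
  have h1 : |S.ρForm ![⌊x⌋, ⌊y⌋] - (a + R / 2)| ≤ A := by
    have : S.ρForm ![⌊x⌋, ⌊y⌋] - (a + R / 2) = (⌊y⌋ - y) - S.α * (⌊x⌋ - x) := by
      rw [← hρ, ρForm_apply]
      simp only [Matrix.cons_val_zero, Matrix.cons_val_one]
      ring
    rw [this]
    refine (abs_sub _ _).trans (add_le_add hy1 ?_)
    rw [abs_mul]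
    exact mul_le_of_le_one_right (abs_nonneg _) hx1
  have h2 : |S.πForm ![⌊x⌋, ⌊y⌋] - R / 2| ≤ B := by
    have : S.πForm ![⌊x⌋, ⌊y⌋] - R / 2 = S.κ * ((⌊y⌋ - y) - S.β * (⌊x⌋ - x)) := by
      rw [← hπ, πForm_apply]
      simp only [Matrix.cons_val_zero, Matrix.cons_val_one]
      ring
    rw [this, abs_mul]
    refine mul_le_mul_of_nonneg_left ((abs_sub _ _).trans (add_le_add hy1 ?_)) (abs_nonneg _)
    rw [abs_mul]
    exact mul_le_of_le_one_right (abs_nonneg _) hx1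
  rw [abs_le] at h1 h2
  refine ⟨![⌊x⌋, ⌊y⌋], ?_⟩
  change a < S.ρForm _ ∧ S.ρForm _ < a + R ∧ 0 < S.πForm _ ∧ S.πForm _ < R
  refine ⟨?_, ?_, ?_, ?_⟩ <;> linarith [h1.1, h1.2, h2.1, h2.2]

variable {S}

/-- A hyperbolic integer matrix commutes with a hyperbolic unit. -/
lemma EigenEqs.exists_unit {M : Matrix (Fin 2) (Fin 2) ℤ} {lam mu : ℝ} (h : S.EigenEqs M lam mu)
    (hα : Irrational S.α) (hne : lam ≠ mu) : ∃ (ω : ℝ) (u : (Fin 2 → ℤ) → (Fin 2 → ℤ)), 1 < ω ∧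
      (∀ z, S.πForm (u z) = ω * S.πForm z) ∧ ∀ z, S.ρForm (u z) = ω⁻¹ * S.ρForm z := by
  set τ := M 0 0 + M 1 1 with hτ
  set d := τ ^ 2 - 4 * M.det with hd
  have htr : (τ : ℝ) = lam + mu := by rw [hτ]; push_cast; exact h.trace
  have hdR : (d : ℝ) = (lam - mu) ^ 2 := by
    rw [hd, Int.cast_sub, Int.cast_pow, Int.cast_mul, htr, h.det]
    push_cast
    ring
  have hd0 : 0 < d := by
    have : (0 : ℝ) < d := by have := sub_ne_zero.2 hne; rw [hdR]; positivity
    exact_mod_cast this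
  have hdsq : ¬ IsSquare d := by
    rintro ⟨k, hk⟩
    have h1 : (lam - mu) ^ 2 = (k : ℝ) ^ 2 := by
      rw [← hdR, hk]; push_cast; ring
    have h2 : ∃ k : ℤ, lam - mu = k := by
      rcases sq_eq_sq_iff_eq_or_eq_neg.1 h1 with h2 | h2
      · exact ⟨k, h2⟩
      · exact ⟨-k, by push_cast; exact h2⟩
    obtain ⟨k, hk⟩ := h2
    refine (h.irrational hα hne).1 ⟨((τ : ℚ) + k) / 2, ?_⟩
    push_cast
    rw [htr, ← hk]
    ring
  -- `M` is not assumed unimodular, so the unit comes from Pell's equation: `x + y * (2 * M - τ)`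
  -- has eigenvalues `x ± y * (lam - mu)`, with product `1`. The sign of `y` is chosen below to
  -- expand along `π`, and squaring makes the eigenvalue positive.
  obtain ⟨x, y, hxy, hy⟩ := Pell.exists_of_not_isSquare hd0 hdsq
  have hxyR : (x : ℝ) ^ 2 - (lam - mu) ^ 2 * y ^ 2 = 1 := by
    rw [← hdR]; exact_mod_cast hxy
  have hyR : (y : ℝ) ≠ 0 := by exact_mod_cast hy
  have key : ∃ y : ℤ, (x : ℝ) ^ 2 - (lam - mu) ^ 2 * y ^ 2 = 1 ∧ 1 < |x + y * (lam - mu)| := by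
    by_contra! hcon
    have h1 := hcon y hxyR
    have h2 := hcon (-y) (by push_cast; rw [neg_sq]; exact hxyR)
    push_cast at h2
    have h3 : |(x : ℝ) + y * (lam - mu)| * |x + -y * (lam - mu)| = 1 := by
      rw [← abs_mul, ← abs_one, ← hxyR]
      congr 1
      ring
    have h4 : |(x : ℝ) + y * (lam - mu)| = 1 := by
      refine le_antisymm h1 ?_
      rw [← h3]
      exact mul_le_of_le_one_right (abs_nonneg _) h2
    have h5 : ((x : ℝ) + y * (lam - mu)) ^ 2 = 1 := by rw [← sq_abs, h4, one_pow]
    have h6 : |(x : ℝ) + -y * (lam - mu)| = 1 := by rw [h4, one_mul] at h3; exact h3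
    have h7 : ((x : ℝ) + -y * (lam - mu)) ^ 2 = 1 := by rw [← sq_abs, h6, one_pow]
    have h8 : (lam - mu) ^ 2 * (y : ℝ) ^ 2 = 0 := by linarith
    have h9 : (lam - mu) ^ 2 * (y : ℝ) ^ 2 ≠ 0 :=
      mul_ne_zero (pow_ne_zero _ (sub_ne_zero.2 hne)) (pow_ne_zero _ hyR)
    exact h9 h8
  obtain ⟨y, hxy, hgt⟩ := key
  set v : (Fin 2 → ℤ) → (Fin 2 → ℤ) := fun z => x • z + y • ((2 : ℤ) • M.mulVec z - τ • z) with hv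
  have hvπ : ∀ z, S.πForm (v z) = (x + y * (lam - mu)) * S.πForm z := by
    intro z
    simp only [hv, map_add, map_zsmul, map_sub]
    simp only [zsmul_eq_mul, h.π_mulVec, htr]
    push_cast
    ring
  have hvρ : ∀ z, S.ρForm (v z) = (x - y * (lam - mu)) * S.ρForm z := by
    intro z
    simp only [hv, map_add, map_zsmul, map_sub]
    simp only [zsmul_eq_mul, h.ρ_mulVec, htr]
    push_cast
    ring
  have hprod : ((x : ℝ) + y * (lam - mu)) * (x - y * (lam - mu)) = 1 := by
    rw [← hxy]; ring
  refine ⟨(x + y * (lam - mu)) ^ 2, fun z => v (v z), ?_, fun z => ?_, fun z => ?_⟩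
  · rw [← sq_abs]
    exact one_lt_pow₀ hgt two_ne_zero
  · rw [hvπ, hvπ]; ring
  · rw [hvρ, hvρ, ← mul_assoc, ← sq]
    congr 1
    exact eq_inv_of_mul_eq_one_left (by rw [← mul_pow, mul_comm, hprod, one_pow])

/-- Linear recurrence: the points with projection in `(0, R)` are `K / R`-dense in the window
space. -/
lemma EigenEqs.exists_covers {M : Matrix (Fin 2) (Fin 2) ℤ} {lam mu : ℝ} (h : S.EigenEqs M lam mu)
    (hα : Irrational S.α) (hne : lam ≠ mu) :
    ∃ K > 0, ∃ R₀ > 0, ∀ R, R₀ ≤ R → (S.cut hα).Covers (K / R) R := by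
  obtain ⟨ω, u, hω, huπ, huρ⟩ := h.exists_unit hα hne
  obtain ⟨R₀, hR₀, hcov⟩ := S.exists_covers hα
  have hω0 : 0 < ω := by linarith
  have hit : ∀ j z, S.πForm (u^[j] z) = ω ^ j * S.πForm z ∧
      ω ^ j * S.ρForm (u^[j] z) = S.ρForm z := by
    intro j z
    induction j with
    | zero => simp
    | succ j ih =>
      rw [Function.iterate_succ_apply', huπ, huρ, ih.1]
      refine ⟨by ring, ?_⟩
      rw [← ih.2, pow_succ]
      field_simp
  refine ⟨R₀ ^ 2 * ω, by positivity, R₀, hR₀, fun R hR a => ?_⟩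
  -- The unit to the largest power with `ω ^ j * R₀ ≤ R` stretches the covering at scale `R₀` in `π`
  -- and shrinks it in `ρ` by the same factor.
  obtain ⟨j, hj1, hj2⟩ := exists_nat_pow_near ((one_le_div hR₀).2 hR) hω
  rw [le_div_iff₀ hR₀] at hj1
  rw [div_lt_iff₀ hR₀] at hj2
  have hωj : 0 < ω ^ j := pow_pos hω0 j
  obtain ⟨g, h1, h2, h3, h4⟩ := hcov (ω ^ j * a)
  change ω ^ j * a < S.ρForm g at h1
  change S.ρForm g < _ at h2
  change 0 < S.πForm g at h3
  change S.πForm g < _ at h4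
  obtain ⟨h5, h6⟩ := hit j g
  have hR0 : 0 < R := by linarith
  refine ⟨u^[j] g, ?_⟩
  change a < S.ρForm _ ∧ S.ρForm _ < a + _ ∧ 0 < S.πForm _ ∧ S.πForm _ < R
  refine ⟨?_, ?_, ?_, ?_⟩
  · rw [← h6] at h1
    exact lt_of_mul_lt_mul_left h1 hωj.le
  · rw [← h6] at h2
    have h7 : R₀ ≤ ω ^ j * (R₀ ^ 2 * ω / R) := by
      rw [mul_div_assoc', le_div_iff₀ hR0]
      rw [pow_succ] at hj2
      have := mul_le_mul_of_nonneg_left hj2.le hR₀.le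
      linarith
    refine lt_of_mul_lt_mul_left (lt_of_lt_of_le h2 ?_) hωj.le
    rw [mul_add]
    linarith
  · rw [h5]; exact mul_pos hωj h3
  · rw [h5]
    have := mul_lt_mul_of_pos_left h4 hωj
    linarith

/-- Level-`k` patches have length at least `factor ^ k * m`, so linear recurrence confines their
positions to a constant over `factor ^ k`, whereas a repeated patch shows a spread of a constant
times `|mu| ^ k`. Hence `(factor * |mu|) ^ k` is bounded. -/
lemma EigenEqs.abs_mul_le_one {M : Matrix (Fin 2) (Fin 2) ℤ} {σ : SubstitutionRule} {mu : ℝ}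
    (h : S.EigenEqs M σ.factor mu)
    (hα : Irrational S.α) (hne : σ.factor ≠ mu) {ℓ t : ℝ} (hℓ : 0 < ℓ) {c : Bool}
    (hσ : σ.IsRuleOf (P.vertices (halfOpen c t (t + ℓ)))) : σ.factor * |mu| ≤ 1 := by
  obtain ⟨T, hT⟩ := hσ
  rw [S.vertices_eq_vset hα] at hT
  have hπi : Function.Injective (S.cut hα).π := S.πForm_injective (h.irrational_β hα hne)
  obtain ⟨K, hK, R₀, hR₀, hcov⟩ := h.exists_covers hα hne
  obtain ⟨m, hm, hml⟩ := exists_min_len' σ.len_pos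
  set η := ℓ / (σ.card + 1) / 2 with hη
  have hη0 : 0 < η := by positivity
  have key : ∀ k : ℕ, R₀ ≤ σ.factor ^ k * m → (σ.factor * |mu|) ^ k ≤ K / m / η := by
    intro k hk
    obtain ⟨U, -, hU2, hU3⟩ := hT.2.2.2 k
    have hpos : 0 < σ.factor ^ k := pow_pos σ.factor_pos k
    have h1 := (S.cut hα).abs_pow_mul_le hπi hℓ hT.1 hT.2.1 M.mulVec h.π_mulVec h.ρ_mulVec hU2.2 hU3
      (hcov _ hk) fun i => mul_le_mul_of_nonneg_left (hml i) hpos.le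
    rw [← hη, le_div_iff₀ (by positivity)] at h1
    rw [div_div, le_div_iff₀ (by positivity), mul_pow]
    linarith
  by_contra! hgt
  obtain ⟨k₁, hk₁⟩ := pow_unbounded_of_one_lt (R₀ / m) σ.one_lt_factor
  obtain ⟨k₂, hk₂⟩ := pow_unbounded_of_one_lt (K / m / η) hgt
  have h1 := key (k₁ + k₂) (by
    rw [div_lt_iff₀ hm] at hk₁
    refine hk₁.le.trans (mul_le_mul_of_nonneg_right ?_ hm.le)
    exact pow_le_pow_right₀ σ.one_lt_factor.le (by omega))
  have h2 := pow_le_pow_right₀ hgt.le (show k₂ ≤ k₁ + k₂ by omega)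
  linarith

variable (S)

/-- The tiling space and the window space of a substitution tiling are the eigenspaces of
a unimodular matrix. -/
lemma exists_hasEigenspaces (hα : Irrational S.α) {ℓ t : ℝ} (hℓ : 0 < ℓ) {c : Bool}
    (hD : Nonperiodic (P.vertices (halfOpen c t (t + ℓ)))) {σ : SubstitutionRule}
    (hσ : σ.IsRuleOf (P.vertices (halfOpen c t (t + ℓ)))) :
    ∃ M : GL (Fin 2) ℤ, HasEigenspaces P M σ.factor := by
  have hβ := S.irrational_β_of_isRuleOf hα hℓ hD hσ
  obtain ⟨M, mu, hmu, hne, h⟩ := S.exists_matrix hα hβ hℓ hσ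
  have h1 := h.abs_mul_le_one hα hne hℓ hσ
  have hdet := h.det
  have h2 : |(M.det : ℝ)| ≤ 1 := by
    rw [hdet, abs_mul, abs_of_pos σ.factor_pos]; exact h1
  have h3 : |M.det| ≤ 1 := by exact_mod_cast h2
  have h4 : M.det ≠ 0 := by
    intro h0
    rw [h0, Int.cast_zero] at hdet
    exact mul_ne_zero σ.factor_pos.ne' hmu hdet.symm
  have h5 : IsUnit M.det := by
    rw [Int.isUnit_iff_abs_eq]
    have := Int.one_le_abs h4
    omega
  have hu : IsUnit M := (Matrix.isUnit_iff_isUnit_det M).2 h5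
  obtain ⟨g, hg⟩ := hu
  refine ⟨g, S.hasEigenspaces_of_eigenEqs hα (mu := mu) ?_ ?_ ?_⟩
  · rw [abs_of_pos σ.factor_pos]; exact σ.one_lt_factor
  · have h6 := σ.one_lt_factor
    have h7 : 0 < |mu| := abs_pos.2 hmu
    nlinarith
  · rw [show g.val = M from hg]; exact h

end Slopes

/-! ### Quadratic irrationals, rational points and inflation factors -/

/-- The elements of a quadratic field. -/
lemma exists_eq_add_mul_of_mem_adjoin {lam : ℝ} {τ δ : ℤ} (h : lam ^ 2 = τ * lam - δ) {x : ℝ}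
    (hx : x ∈ IntermediateField.adjoin ℚ ({lam} : Set ℝ)) : ∃ a b : ℚ, x = a + b * lam := by
  have hint : IsIntegral ℚ lam := by
    refine ⟨Polynomial.X ^ 2 - (Polynomial.C (τ : ℚ) * Polynomial.X - Polynomial.C (δ : ℚ)), ?_, ?_⟩
    · apply Polynomial.monic_X_pow_sub
      compute_degree
      norm_num
    · simp only [Polynomial.eval₂_sub, Polynomial.eval₂_pow, Polynomial.eval₂_mul,
        Polynomial.eval₂_C, Polynomial.eval₂_X]
      simp [h]
  have hx' : x ∈ Algebra.adjoin ℚ ({lam} : Set ℝ) := by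
    rw [← IntermediateField.adjoin_simple_toSubalgebra_of_isAlgebraic hint.isAlgebraic]
    exact hx
  induction hx' using Algebra.adjoin_induction with
  | mem y hy => exact ⟨0, 1, by simp [Set.mem_singleton_iff.1 hy]⟩
  | algebraMap r => exact ⟨r, 0, by simp⟩
  | add y z hy hz ihy ihz =>
    obtain ⟨a, b, rfl⟩ := ihy (IntermediateField.algebra_adjoin_le_adjoin _ _ hy)
    obtain ⟨a', b', rfl⟩ := ihz (IntermediateField.algebra_adjoin_le_adjoin _ _ hz)
    exact ⟨a + a', b + b', by push_cast; ring⟩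
  | mul y z hy hz ihy ihz =>
    obtain ⟨a, b, rfl⟩ := ihy (IntermediateField.algebra_adjoin_le_adjoin _ _ hy)
    obtain ⟨a', b', rfl⟩ := ihz (IntermediateField.algebra_adjoin_le_adjoin _ _ hz)
    refine ⟨a * a' - b * b' * δ, a * b' + a' * b + b * b' * τ, ?_⟩
    push_cast
    linear_combination (b * b' : ℝ) * h

lemma exists_clear_denominators (x y : Fin 2 → ℚ) : ∃ q : ℕ, 0 < q ∧ ∃ z w : Fin 2 → ℤ,
    (∀ i, (z i : ℝ) = q * x i) ∧ ∀ i, (w i : ℝ) = q * y i := by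
  have h1 : ∀ x : Fin 2 → ℚ, ∃ q : ℕ, 0 < q ∧ ∃ z : Fin 2 → ℤ, ∀ i, (z i : ℝ) = q * x i := by
    intro x
    refine ⟨(x 0).den * (x 1).den, Nat.mul_pos (x 0).pos (x 1).pos,
      ![(x 0).num * (x 1).den, (x 1).num * (x 0).den], fun i => ?_⟩
    have e0 : ((x 0 : ℚ) : ℝ) * (x 0).den = (x 0).num := by exact_mod_cast Rat.mul_den_eq_num _
    have e1 : ((x 1 : ℚ) : ℝ) * (x 1).den = (x 1).num := by exact_mod_cast Rat.mul_den_eq_num _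
    fin_cases i
    · simp [← e0]; ring
    · simp [← e1]; ring
  obtain ⟨q, hq, z, hz⟩ := h1 x
  obtain ⟨q', hq', w, hw⟩ := h1 y
  refine ⟨q * q', Nat.mul_pos hq hq', fun i => q' * z i, fun i => q * w i, fun i => ?_,
    fun i => ?_⟩
  · push_cast; rw [hz]; ring
  · push_cast; rw [hw]; ring

/-- Patches of level `k` have length `factor ^ k` times one of finitely many prototile lengths, so
equal lengths at all levels compare the growth rates. -/
lemma SubstitutionRule.PatchEquivalent.factor_le {σ σ' : SubstitutionRule}
    (h : σ.PatchEquivalent σ') (i : Fin σ.card) : σ.factor ≤ σ'.factor := by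
  by_contra! hlt
  have h1 : ∀ k, ∃ j, σ.factor ^ k * σ.len i = σ'.factor ^ k * σ'.len j := by
    intro k
    obtain ⟨j, hj⟩ := h.1 i k
    have := congrArg List.sum hj
    simp only [SubstitutionRule.shape, SubstitutionRule.sum_patch] at this
    exact ⟨j, this⟩
  obtain ⟨B, hB⟩ := (Finset.univ.image σ'.len).exists_le
  have h2 : 1 < σ.factor / σ'.factor := (one_lt_div σ'.factor_pos).2 hlt
  obtain ⟨k, hk⟩ := pow_unbounded_of_one_lt (B / σ.len i) h2
  obtain ⟨j, hj⟩ := h1 k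
  have h3 := hB (σ'.len j) (Finset.mem_image_of_mem _ (Finset.mem_univ _))
  have h4 : 0 < σ'.factor ^ k := pow_pos σ'.factor_pos k
  rw [div_pow, div_lt_div_iff₀ (σ.len_pos i) h4, hj] at hk
  have := mul_le_mul_of_nonneg_right h3 h4.le
  linarith

/-- The action of an invertible integer matrix on the lattice. -/
def latticeEquiv (M : GL (Fin 2) ℤ) : (Fin 2 → ℤ) ≃+ (Fin 2 → ℤ) where
  toFun := M.val.mulVec
  invFun := M⁻¹.val.mulVec
  left_inv z := by
    rw [Matrix.mulVec_mulVec, ← Units.val_mul, inv_mul_cancel, Units.val_one, Matrix.one_mulVec]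
  right_inv z := by
    rw [Matrix.mulVec_mulVec, ← Units.val_mul, mul_inv_cancel, Units.val_one, Matrix.one_mulVec]
  map_add' z w := Matrix.mulVec_add _ z w

namespace Slopes

variable {P : Spaces} {S : Slopes P} {M : Matrix (Fin 2) (Fin 2) ℤ} {lam mu : ℝ}

lemma EigenEqs.M01_ne_zero (h : S.EigenEqs M lam mu) (hne : lam ≠ mu) : (M 0 1 : ℝ) ≠ 0 := by
  intro h0
  apply hne
  rw [← h.ρ_one, ← h.π_one, h0]
  ring

lemma EigenEqs.sq_eq (h : S.EigenEqs M lam mu) :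
    lam ^ 2 = ((M 0 0 + M 1 1 : ℤ) : ℝ) * lam - (M.det : ℤ) := by
  rw [h.det]
  push_cast
  rw [h.trace]
  ring

lemma EigenEqs.lam_eq (h : S.EigenEqs M lam mu) : lam = M 0 0 + M 0 1 * S.α := by
  obtain ⟨h1, -, h3, -⟩ := h.entries
  have := sub_ne_zero.2 S.ne
  apply mul_left_cancel₀ this
  linear_combination -h3 - S.α * h1

lemma EigenEqs.mu_mem (h : S.EigenEqs M lam mu) :
    mu ∈ IntermediateField.adjoin ℚ ({lam} : Set ℝ) := by
  have h1 : mu = M 0 0 + M 1 1 - lam := by rw [h.trace]; ring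
  rw [h1]
  exact sub_mem (add_mem (intCast_mem _ _) (intCast_mem _ _))
    (IntermediateField.mem_adjoin_simple_self ℚ lam)

lemma EigenEqs.ρForm_mem (h : S.EigenEqs M lam mu) (hne : lam ≠ mu) (g : Fin 2 → ℤ) :
    S.ρForm g ∈ IntermediateField.adjoin ℚ ({lam} : Set ℝ) := by
  have h0 := h.M01_ne_zero hne
  have hα : S.α = (lam - M 0 0) / M 0 1 := by
    rw [eq_div_iff h0]
    linarith [h.lam_eq]
  have hαm : S.α ∈ IntermediateField.adjoin ℚ ({lam} : Set ℝ) := by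
    rw [hα]
    exact div_mem (sub_mem (IntermediateField.mem_adjoin_simple_self ℚ lam) (intCast_mem _ _))
      (intCast_mem _ _)
  rw [ρForm_apply]
  exact sub_mem (intCast_mem _ _) (mul_mem hαm (intCast_mem _ _))

/-- The elements of the quadratic field are the projections of rational points. -/
lemma EigenEqs.exists_rat (h : S.EigenEqs M lam mu) {x : ℝ}
    (hx : x ∈ IntermediateField.adjoin ℚ ({lam} : Set ℝ)) :
    ∃ s : Fin 2 → ℚ, x = s 1 - S.α * s 0 := by
  obtain ⟨a, b, hab⟩ := exists_eq_add_mul_of_mem_adjoin h.sq_eq hx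
  refine ⟨![-(b * M 0 1), a + b * M 0 0], ?_⟩
  rw [hab]
  simp only [Matrix.cons_val_zero, Matrix.cons_val_one]
  push_cast
  linear_combination (b : ℝ) * h.lam_eq

lemma rat_eq_of_ρ_eq (hα : Irrational S.α) {s s' : Fin 2 → ℚ}
    (h : (s 1 : ℝ) - S.α * s 0 = s' 1 - S.α * s' 0) : s = s' := by
  have h0 : s 0 = s' 0 := by
    by_contra hne
    have hne' : (s 0 : ℝ) - s' 0 ≠ 0 := sub_ne_zero.2 (by exact_mod_cast hne)
    apply hα
    refine ⟨(s 1 - s' 1) / (s 0 - s' 0), ?_⟩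
    push_cast
    rw [div_eq_iff hne']
    linarith
  rw [h0] at h
  have h1 : (s 1 : ℝ) = s' 1 := by linarith
  ext i
  fin_cases i
  · exact h0
  · exact (Rat.cast_injective h1 : s 1 = s' 1)

/-! ### Rules and subwindows -/

variable {Ω : Window} {σ : SubstitutionRule}

lemma subwindowFits_iff {M : GL (Fin 2) ℤ} (h : S.EigenEqs M.val lam mu) (s : Fin 2 → ℚ) :
    SubwindowFits P Ω M s ↔ ∀ u, 0 ≤ u → u ≤ Ω.length →
      0 ≤ ((s 1 : ℝ) - S.α * s 0) + mu * u ∧ ((s 1 : ℝ) - S.α * s 0) + mu * u ≤ Ω.length := by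
  rw [SubwindowFits, S.subwindow_eq h]
  constructor
  · intro h1 u h2 h3
    have h4 := h1 ⟨u, ⟨h2, h3⟩, rfl⟩
    constructor <;> linarith [h4.1, h4.2]
  · rintro h1 y ⟨u, ⟨h2, h3⟩, rfl⟩
    have h4 := h1 u h2 h3
    constructor <;> linarith [h4.1, h4.2]

lemma mu_ne_zero_of_GL {M : GL (Fin 2) ℤ} (h : S.EigenEqs M.val lam mu) : mu ≠ 0 := by
  rintro rfl
  have h1 := h.det
  rw [mul_zero] at h1
  have h2 : M.val.det = 0 := by exact_mod_cast h1
  have h3 : IsUnit M.val.det := (Matrix.isUnit_iff_isUnit_det _).1 M.isUnit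
  rw [h2] at h3
  exact not_isUnit_zero h3

/-- By `exists_posAt` the predecessor is a translated model set with a window of the same length;
inflation scales that window by `mu`, leaving only the kind and the shift undetermined. -/
lemma exists_image_eq (hα : Irrational S.α) {M : GL (Fin 2) ℤ} (h : S.EigenEqs M.val σ.factor mu)
    (hne : σ.factor ≠ mu) {T T' : Set (ℝ × Fin σ.card)}
    (hT : σ.IsLabelling (P.vertices Ω.toSet) T) (hT' : IsTiling σ.len T')
    (hLI : LocallyIsomorphic T' T) (happ : σ.apply T' = T) :
    ∃ c r, (fun x => σ.factor * x) '' vert T' =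
      (S.cut hα).vset {y | ∃ ω ∈ halfOpen c 0 Ω.length, y = Ω.base + r + mu * ω} := by
  rw [S.vertices_eq_vset hα] at hT
  have hπi : Function.Injective (S.cut hα).π := S.πForm_injective (h.irrational_β hα hne)
  obtain ⟨⟨x, i⟩, hxi⟩ := hT'.nonempty
  have hx : x ∈ vert T' := ⟨i, hxi⟩
  obtain ⟨⟨c, u, hu⟩, hX⟩ := (S.cut hα).exists_posAt hπi σ.len_pos hT.1 hT' hT.2.1 hLI hx
  have h1 := σ.factor_mul_mem_vert hx
  rw [happ, hT.2.1] at h1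
  obtain ⟨z, -, hz⟩ := h1
  refine ⟨c, (S.cut hα).ρ z - mu * u - Ω.base, ?_⟩
  rw [hu.vset_image (mu_ne_zero_of_GL h) (latticeEquiv M) h.π_mulVec h.ρ_mulVec hX hz.symm]
  congr 1
  ext y
  simp only [add_sub_cancel]

lemma predShift_of_image_eq (hα : Irrational S.α) {M : GL (Fin 2) ℤ}
    (h : S.EigenEqs M.val σ.factor mu) (hne : σ.factor ≠ mu) {T' : Set (ℝ × Fin σ.card)}
    {c : Bool} {r : ℝ} (him : (fun x => σ.factor * x) '' vert T' =
      (S.cut hα).vset {y | ∃ ω ∈ halfOpen c 0 Ω.length, y = Ω.base + r + mu * ω}) :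
    (S.cut hα).PredShift Ω.length Ω.base σ.factor mu T' r :=
  (S.cut hα).predShift_of_image (S.πForm_injective (h.irrational_β hα hne)) (mu_ne_zero_of_GL h)
    σ.factor_pos.ne' M.val.mulVec h.π_mulVec h.ρ_mulVec him

/-- A rule is associated to the subwindow of one of its predecessors. -/
lemma isAssociated_of_predShift (hα : Irrational S.α) {M : GL (Fin 2) ℤ}
    (hM : HasEigenspaces P M σ.factor) (hmu : |mu| < 1)
    (h : S.EigenEqs M.val σ.factor mu) {T T' : Set (ℝ × Fin σ.card)}
    (hT : σ.IsLabelling (P.vertices Ω.toSet) T) (hT' : IsTiling σ.len T')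
    (hLI : LocallyIsomorphic T' T) (happ : σ.apply T' = T) {s : Fin 2 → ℚ}
    (hr : (S.cut hα).PredShift Ω.length Ω.base σ.factor mu T' ((s 1 : ℝ) - S.α * s 0)) :
    IsAssociated P Ω σ M s := by
  have hne : σ.factor ≠ mu := by
    rintro h0
    have := σ.one_lt_factor
    rw [← h0, abs_of_pos σ.factor_pos] at hmu
    linarith
  have hπi : Function.Injective (S.cut hα).π := S.πForm_injective (h.irrational_β hα hne)
  have hmu1 : 1 - mu ≠ 0 := by have := le_abs_self mu; intro h0; linarith
  refine ⟨⟨T, hT⟩, hM, ?_, fun T₂ T₂' hT₂ hT₂' hLI₂ happ₂ => ?_⟩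
  · rw [subwindowFits_iff h]
    rw [S.vertices_eq_vset hα] at hT
    set r := (s 1 : ℝ) - S.α * s 0 with hrdef
    have hreal : ∀ x ∈ vert T', ∀ c u, (S.cut hα).PosAt Ω.length (vert T') x c u →
        0 ≤ r + mu * u ∧ r + mu * u ≤ Ω.length := by
      intro x hx c u hu
      obtain ⟨c', u', z, hu', hz, hzu⟩ := hr x hx
      rw [hu'.unique hx hu] at hzu
      have h1 := σ.factor_mul_mem_vert hx
      rw [happ] at h1
      rw [hz] at h1
      have h2 := ((S.cut hα).posAt_of_mem_vert hπi hT.2.1 (z := z)).mem_Icc h1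
      rw [hzu] at h2
      exact h2
    obtain ⟨⟨x, i⟩, hxi⟩ := hT'.nonempty
    have hx : x ∈ vert T' := ⟨i, hxi⟩
    obtain ⟨c, u₀, -, hu₀, -⟩ := hr x hx
    -- The condition holds at the positions that occur in `T'`. These are dense in `[0, ℓ]`, and
    -- `|mu| < 1` does not enlarge the error of an approximation.
    have key : ∀ u, 0 ≤ u → u ≤ Ω.length → ∀ ε > 0,
        -ε ≤ r + mu * u ∧ r + mu * u ≤ Ω.length + ε := by
      intro u h0 h1 ε hε
      obtain ⟨g, h2, h3, -⟩ := (S.cut hα).dense (max 0 (u - ε) - u₀)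
        (min Ω.length (u + ε) - u₀) 0 (by
          have := Ω.length_pos
          have : max 0 (u - ε) < min Ω.length (u + ε) := by
            rw [max_lt_iff, lt_min_iff, lt_min_iff]
            refine ⟨⟨by linarith, by linarith⟩, by linarith, by linarith⟩
          linarith)
      have h4 : max 0 (u - ε) < (S.cut hα).ρ g + u₀ := by linarith
      have h5 : (S.cut hα).ρ g + u₀ < min Ω.length (u + ε) := by linarith
      rw [max_lt_iff] at h4
      rw [lt_min_iff] at h5
      have h6 := hreal _ ((hu₀ g).2 (mem_halfOpen_of_lt h4.1 h5.1)) _ _ (hu₀.add g)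
      have h7 : |mu * (u - (u₀ + (S.cut hα).ρ g))| ≤ ε := by
        rw [abs_mul]
        have h8 : |u - (u₀ + (S.cut hα).ρ g)| ≤ ε := by
          rw [abs_le]; constructor <;> linarith
        have := mul_le_mul hmu.le h8 (abs_nonneg _) zero_le_one
        linarith
      rw [abs_le] at h7
      constructor <;> linarith [h7.1, h7.2, h6.1, h6.2]
    intro u h0 h1
    constructor
    · refine le_of_forall_pos_le_add fun ε hε => ?_
      linarith [(key u h0 h1 ε hε).1]
    · exact le_of_forall_pos_le_add fun ε hε => (key u h0 h1 ε hε).2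
  -- A rule is patch equivalent to itself, so any two of its predecessors have the same fixed point
  -- and, `mu` being common, the same shift.
  · obtain ⟨c, r₂, him⟩ := exists_image_eq hα h hne hT₂ hT₂' hLI₂ happ₂
    have hr₂ := predShift_of_image_eq hα h hne him
    rw [S.vertices_eq_vset hα] at hT hT₂
    have hfix := (S.cut hα).fixedPoint_eq hπi hmu hT hT' hLI.2 happ hr hmu hT₂ hT₂' hLI₂.2 happ₂
      hr₂ (Setoid.refl (α := SubstitutionRule) σ)
    have hrr := (div_left_inj' hmu1).1 hfix
    refine ⟨c, ?_⟩
    rw [him, ← hrr, S.vertices_eq_vset hα, S.subwindow_eq h]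

/-- Every rule is associated to a subwindow, and the length of the window is in the quadratic
field. -/
lemma exists_isAssociated (hα : Irrational S.α) {M : GL (Fin 2) ℤ}
    (hM : HasEigenspaces P M σ.factor) (hσ : σ.IsRuleOf (P.vertices Ω.toSet)) :
    (∃ s, IsAssociated P Ω σ M s) ∧
      Ω.length ∈ IntermediateField.adjoin ℚ ({σ.factor} : Set ℝ) := by
  obtain ⟨mu, hmu, h⟩ := S.exists_eigenEqs hM
  have hne : σ.factor ≠ mu := by
    rintro h0
    have := σ.one_lt_factor
    rw [← h0, abs_of_pos σ.factor_pos] at hmu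
    linarith
  have hπi : Function.Injective (S.cut hα).π := S.πForm_injective (h.irrational_β hα hne)
  obtain ⟨T, hT⟩ := hσ
  obtain ⟨T', hT', hLI, happ⟩ := hT.2.2.2 1
  obtain ⟨c, r, him⟩ := exists_image_eq hα h hne hT hT' hLI happ
  have hr := predShift_of_image_eq hα h hne him
  have hT2 := hT
  rw [S.vertices_eq_vset hα] at hT2
  obtain ⟨h1, h2⟩ := (S.cut hα).shift_and_length_mem hπi Ω.length_pos hmu (mu_ne_zero_of_GL h) hT2
    hT' hLI happ hr (IntermediateField.adjoin ℚ ({σ.factor} : Set ℝ)).toSubfield h.mu_mem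
    (h.ρForm_mem hne)
  obtain ⟨s, rfl⟩ := h.exists_rat h1
  exact ⟨⟨s, isAssociated_of_predShift hα hM hmu h hT hT' hLI happ hr⟩, h2⟩

/-- Every subwindow that fits into the window has an associated rule. -/
lemma exists_rule (hα : Irrational S.α) {M : GL (Fin 2) ℤ} (hM : HasEigenspaces P M lam)
    (hlam : 0 < lam) (hℓ : Ω.length ∈ IntermediateField.adjoin ℚ ({lam} : Set ℝ)) {s : Fin 2 → ℚ}
    (hs : SubwindowFits P Ω M s) : ∃ σ, IsAssociated P Ω σ M s := by
  obtain ⟨mu, hmu, h⟩ := S.exists_eigenEqs hM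
  have hlam1 : 1 < lam := by have := hM.2.1; rwa [abs_of_pos hlam] at this
  have hne : lam ≠ mu := by
    rintro h0
    rw [← h0, abs_of_pos hlam] at hmu
    linarith
  have hπi : Function.Injective (S.cut hα).π := S.πForm_injective (h.irrational_β hα hne)
  obtain ⟨e, he⟩ := h.exists_rat hℓ
  obtain ⟨q, hq, z, w, hz, hw⟩ := exists_clear_denominators e s
  obtain ⟨σ, T, T', rfl, hT, hT', hLI, happ, hr⟩ := exists_rule_of_fits (S.cut hα) hπi
    (latticeEquiv M) hlam1 (mu_ne_zero_of_GL h) h.π_mulVec h.ρ_mulVec Ω.length_pos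
    ((subwindowFits_iff h s).1 hs) hq (e := z) (s := w)
    (by change S.ρForm z = _; rw [ρForm_apply, hz, hz, he]; ring)
    (by change S.ρForm w = _; rw [ρForm_apply, hw, hw]; ring) Ω.leftClosed Ω.base
  refine ⟨σ, isAssociated_of_predShift hα hM hmu h ?_ hT' hLI happ hr⟩
  rw [S.vertices_eq_vset hα]
  exact hT

/-- Rules that are associated to different translations are not patch equivalent. -/
lemma translation_eq (hα : Irrational S.α) {σ₁ σ₂ : SubstitutionRule} {M₁ M₂ : GL (Fin 2) ℤ}
    {s₁ s₂ : Fin 2 → ℚ} (h₁ : IsAssociated P Ω σ₁ M₁ s₁) (h₂ : IsAssociated P Ω σ₂ M₂ s₂)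
    (he : σ₁.PatchEquivalent σ₂) : s₁ = s₂ := by
  obtain ⟨mu₁, hmu₁, e₁⟩ := S.exists_eigenEqs h₁.2.1
  obtain ⟨mu₂, hmu₂, e₂⟩ := S.exists_eigenEqs h₂.2.1
  have hne₁ : σ₁.factor ≠ mu₁ := by
    rintro h0
    have := σ₁.one_lt_factor
    rw [← h0, abs_of_pos σ₁.factor_pos] at hmu₁
    linarith
  have hne₂ : σ₂.factor ≠ mu₂ := by
    rintro h0
    have := σ₂.one_lt_factor
    rw [← h0, abs_of_pos σ₂.factor_pos] at hmu₂
    linarith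
  have hπi : Function.Injective (S.cut hα).π := S.πForm_injective (e₁.irrational_β hα hne₁)
  obtain ⟨T₁, hT₁⟩ := h₁.1
  obtain ⟨T₁', hT₁', hLI₁, happ₁⟩ := hT₁.2.2.2 1
  obtain ⟨c₁, him₁⟩ := h₁.2.2.2 T₁ T₁' hT₁ hT₁' hLI₁ happ₁
  rw [S.vertices_eq_vset hα, S.subwindow_eq e₁] at him₁
  have hr₁ := predShift_of_image_eq hα e₁ hne₁ him₁
  obtain ⟨T₂, hT₂⟩ := h₂.1
  obtain ⟨T₂', hT₂', hLI₂, happ₂⟩ := hT₂.2.2.2 1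
  obtain ⟨c₂, him₂⟩ := h₂.2.2.2 T₂ T₂' hT₂ hT₂' hLI₂ happ₂
  rw [S.vertices_eq_vset hα, S.subwindow_eq e₂] at him₂
  have hr₂ := predShift_of_image_eq hα e₂ hne₂ him₂
  rw [S.vertices_eq_vset hα] at hT₁ hT₂
  have hfix := (S.cut hα).fixedPoint_eq hπi hmu₁ hT₁ hT₁' hLI₁.2 happ₁ hr₁ hmu₂ hT₂ hT₂' hLI₂.2
    happ₂ hr₂ he
  have hfac : σ₁.factor = σ₂.factor := by
    obtain ⟨⟨-, i⟩, -⟩ := hT₁.1.nonempty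
    obtain ⟨⟨-, j⟩, -⟩ := hT₂.1.nonempty
    exact le_antisymm (he.factor_le i)
      (SubstitutionRule.PatchEquivalent.factor_le ⟨he.2, he.1⟩ j)
  -- The two characteristic polynomials share the irrational root `factor`; different traces would
  -- make it rational, and equal traces give equal second roots.
  have hmu : mu₁ = mu₂ := by
    have q₁ := e₁.sq_eq
    have q₂ := e₂.sq_eq
    rw [← hfac] at q₂
    have t₁ := e₁.trace
    have t₂ := e₂.trace
    rw [← hfac] at t₂
    set τ₁ := M₁.val 0 0 + M₁.val 1 1
    set τ₂ := M₂.val 0 0 + M₂.val 1 1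
    have hτ : τ₁ = τ₂ := by
      by_contra hne
      have hne' : (τ₁ : ℝ) - τ₂ ≠ 0 := sub_ne_zero.2 (by exact_mod_cast hne)
      apply (e₁.irrational hα hne₁).1
      refine ⟨((M₁.val.det - M₂.val.det : ℤ) : ℚ) / ((τ₁ - τ₂ : ℤ) : ℚ), ?_⟩
      rw [Rat.cast_div, Rat.cast_intCast, Rat.cast_intCast, Int.cast_sub, Int.cast_sub,
        div_eq_iff hne']
      linarith
    have hτ' : (τ₁ : ℝ) = τ₂ := by exact_mod_cast hτ
    simp only [τ₁, τ₂, Int.cast_add] at hτ'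
    linarith
  subst hmu
  have hmu1 : 1 - mu₁ ≠ 0 := by have := le_abs_self mu₁; intro h0; linarith
  exact rat_eq_of_ρ_eq hα ((div_left_inj' hmu1).1 hfix)

/-- There are only countably many substitution rules for a tiling. -/
lemma countable_rules (S : Slopes P) (Ω : Window) :
    {σ : SubstitutionRule | σ.IsRuleOf (P.vertices Ω.toSet)}.Countable := by
  classical
  have hlen : ∀ σ : SubstitutionRule, σ.IsRuleOf (P.vertices Ω.toSet) →
      (∀ i, ∃ g, S.πForm g = σ.len i) ∧ Nonempty (Fin σ.card) := by
    rintro σ ⟨T, hT⟩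
    refine ⟨fun i => ?_, ?_⟩
    · obtain ⟨x, hx⟩ := hT.2.2.1 i
      have h1 : x ∈ vert T := ⟨i, hx⟩
      have h2 := hT.1.end_mem_vert σ.len_pos hx
      rw [hT.2.1, S.vertices_eq] at h1 h2
      obtain ⟨z, -, hz⟩ := h1
      obtain ⟨w, -, hw⟩ := h2
      exact ⟨w - z, by rw [map_sub, hz, hw]; ring⟩
    · obtain ⟨⟨-, i⟩, -⟩ := hT.1.nonempty
      exact ⟨i⟩
  -- Lengths are encoded by lattice vectors that project to them. The factor need not be recorded,
  -- as `covers` at any prototile determines it.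
  let f : SubstitutionRule → Σ n : ℕ, (Fin n → Fin 2 → ℤ) × (Fin n → List (Fin n)) := fun σ =>
    ⟨σ.card, fun i => if h : ∃ g, S.πForm g = σ.len i then h.choose else 0, σ.repl⟩
  refine Set.MapsTo.countable_of_injOn (f := f) (t := Set.univ) (fun _ _ => Set.mem_univ _) ?_
    Set.countable_univ
  rintro ⟨n, len, hlen₁, lam, hlam, repl, hcov⟩ h₁ ⟨n', len', hlen₂, lam', hlam', repl', hcov'⟩ h₂ he
  obtain ⟨h1, ⟨i⟩⟩ := hlen _ h₁
  obtain ⟨h2, -⟩ := hlen _ h₂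
  simp only [f, Sigma.mk.injEq] at he
  obtain ⟨rfl, he⟩ := he
  simp only [heq_eq_eq, Prod.mk.injEq] at he
  obtain ⟨he1, rfl⟩ := he
  have hl : len = len' := by
    ext j
    have h3 := congrFun he1 j
    have e1 : ∃ g, S.πForm g = len j := h1 j
    have e2 : ∃ g, S.πForm g = len' j := h2 j
    rw [dif_pos e1, dif_pos e2] at h3
    rw [← e1.choose_spec, ← e2.choose_spec, h3]
  subst hl
  have hf : lam = lam' := by
    have h3 := hcov i
    rw [hcov' i] at h3
    exact (mul_right_cancel₀ (hlen₁ i).ne' h3).symm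
  subst hf
  rfl

/-- Infinitely many translates of the subwindow fit into the window. -/
lemma infinite_fits (hα : Irrational S.α) {M : GL (Fin 2) ℤ} (h : S.EigenEqs M.val lam mu)
    (hmu : |mu| < 1) : {z : Fin 2 → ℤ | SubwindowFits P Ω M fun i => z i}.Infinite := by
  have hℓ := Ω.length_pos
  rw [abs_lt] at hmu
  have h1 : mu * Ω.length < Ω.length := by
    have := mul_lt_mul_of_pos_right hmu.2 hℓ; linarith
  have h2 : -Ω.length < mu * Ω.length := by
    have := mul_lt_mul_of_pos_right hmu.1 hℓ; linarith
  -- A shift in this open interval keeps the images of both ends, `r` and `r + mu * ℓ`, inside the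
  -- window for either sign of `mu`.
  have hJ : max 0 (-(mu * Ω.length)) < min Ω.length (Ω.length - mu * Ω.length) := by
    rw [max_lt_iff, lt_min_iff, lt_min_iff]
    refine ⟨⟨by linarith, by linarith⟩, by linarith, by linarith⟩
  have hsub : ∀ z : Fin 2 → ℤ, max 0 (-(mu * Ω.length)) < S.ρForm z →
      S.ρForm z < min Ω.length (Ω.length - mu * Ω.length) →
      SubwindowFits P Ω M fun i => z i := by
    intro z h3 h4
    rw [max_lt_iff] at h3
    rw [lt_min_iff] at h4
    rw [subwindowFits_iff h]
    intro u hu0 hu1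
    simp only [Rat.cast_intCast]
    rw [← ρForm_apply]
    rcases le_total 0 mu with h5 | h5
    · have := mul_nonneg h5 hu0
      have := mul_le_mul_of_nonneg_left hu1 h5
      constructor <;> linarith
    · have := mul_nonpos_of_nonpos_of_nonneg h5 hu0
      have := mul_le_mul_of_nonpos_left hu1 h5
      constructor <;> linarith
  intro hfin
  obtain ⟨B, hB⟩ := (hfin.image S.πForm).bddAbove
  obtain ⟨z, h3, h4, h5⟩ := S.ρπ_dense hα _ _ B hJ
  have := hB ⟨z, hsub z h3 h4, rfl⟩
  linarith

/-- An inflation factor must be positive; `-M` has the same eigenspaces and its eigenvalue `-lam`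
generates the same field. -/
lemma exists_hasEigenspaces_pos (hα : Irrational S.α) {M : GL (Fin 2) ℤ}
    (hM : HasEigenspaces P M lam) {x : ℝ}
    (hx : x ∈ IntermediateField.adjoin ℚ ({lam} : Set ℝ)) :
    ∃ (M : GL (Fin 2) ℤ) (lam : ℝ), HasEigenspaces P M lam ∧ 0 < lam ∧
      x ∈ IntermediateField.adjoin ℚ ({lam} : Set ℝ) := by
  have h1 := hM.2.1
  rcases lt_trichotomy lam 0 with hneg | h0 | hpos
  · obtain ⟨mu, hmu, h⟩ := S.exists_eigenEqs hM
    refine ⟨-M, -lam, S.hasEigenspaces_of_eigenEqs hα (by rwa [abs_neg]) (mu := -mu)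
      (by rwa [abs_neg]) ?_, by linarith, ?_⟩
    · rw [Units.val_neg]
      refine EigenEqs.of_mulVec (fun z => ?_) fun z => ?_
      · rw [Matrix.neg_mulVec, map_neg, h.ρ_mulVec]; ring
      · rw [Matrix.neg_mulVec, map_neg, h.π_mulVec]; ring
    · have h2 : IntermediateField.adjoin ℚ ({lam} : Set ℝ) ≤
          IntermediateField.adjoin ℚ ({-lam} : Set ℝ) := by
        rw [IntermediateField.adjoin_simple_le_iff]
        have := neg_mem (IntermediateField.mem_adjoin_simple_self ℚ (-lam))
        rwa [neg_neg] at this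
      exact h2 hx
  · rw [h0, abs_zero] at h1
    linarith
  · exact ⟨M, lam, hM, hpos, hx⟩

lemma exists_fits (hα : Irrational S.α) {M : GL (Fin 2) ℤ} (hM : HasEigenspaces P M lam) :
    ∃ s, SubwindowFits P Ω M s := by
  obtain ⟨mu, hmu, h⟩ := S.exists_eigenEqs hM
  obtain ⟨z, hz⟩ := (infinite_fits (Ω := Ω) hα h hmu).nonempty
  exact ⟨_, hz⟩

end Slopes

end IntervalProjection

theorem mainTheorem1 (P : IntervalProjection.Spaces) (Ω : IntervalProjection.Window)
    (hD : IntervalProjection.Nonperiodic (P.vertices Ω.toSet)) :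
    -- the tiling admits a substitution rule iff the two conditions hold
    ((∃ σ : IntervalProjection.SubstitutionRule, σ.IsRuleOf (P.vertices Ω.toSet)) ↔
      ∃ (M : GL (Fin 2) ℤ) (lam : ℝ), IntervalProjection.HasEigenspaces P M lam ∧
        Ω.length ∈ IntermediateField.adjoin ℚ ({lam} : Set ℝ)) ∧
    -- each substitution rule is associated to a subwindow
    (∀ σ : IntervalProjection.SubstitutionRule, σ.IsRuleOf (P.vertices Ω.toSet) →
      ∃ (M : GL (Fin 2) ℤ) (s : Fin 2 → ℚ), IntervalProjection.IsAssociated P Ω σ M s) ∧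
    -- each subwindow inside the window has an associated substitution rule
    (∀ (M : GL (Fin 2) ℤ) (lam : ℝ) (s : Fin 2 → ℚ), IntervalProjection.HasEigenspaces P M lam →
      0 < lam → Ω.length ∈ IntermediateField.adjoin ℚ ({lam} : Set ℝ) →
      IntervalProjection.SubwindowFits P Ω M s →
      ∃ σ : IntervalProjection.SubstitutionRule, IntervalProjection.IsAssociated P Ω σ M s) ∧
    -- rules associated to different translations are not patch equivalent
    (∀ (σ₁ σ₂ : IntervalProjection.SubstitutionRule) (M₁ M₂ : GL (Fin 2) ℤ) (s₁ s₂ : Fin 2 → ℚ),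
      IntervalProjection.IsAssociated P Ω σ₁ M₁ s₁ →
      IntervalProjection.IsAssociated P Ω σ₂ M₂ s₂ →
      s₁ ≠ s₂ → ¬ σ₁.PatchEquivalent σ₂) ∧
    -- the number of patch equivalence classes of rules is countably infinite
    ((∃ σ : IntervalProjection.SubstitutionRule, σ.IsRuleOf (P.vertices Ω.toSet)) →
      {q : Quotient IntervalProjection.SubstitutionRule.patchSetoid |
        ∃ σ : IntervalProjection.SubstitutionRule, σ.IsRuleOf (P.vertices Ω.toSet) ∧
          Quotient.mk _ σ = q}.Countable ∧
      {q : Quotient IntervalProjection.SubstitutionRule.patchSetoid |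
        ∃ σ : IntervalProjection.SubstitutionRule, σ.IsRuleOf (P.vertices Ω.toSet) ∧
          Quotient.mk _ σ = q}.Infinite) := by
  open IntervalProjection Slopes in
  obtain ⟨S⟩ := P.nonempty_slopes
  have hα := S.irrational_of_nonperiodic hD
  have hrule : ∀ σ : SubstitutionRule, σ.IsRuleOf (P.vertices Ω.toSet) →
      ∃ M : GL (Fin 2) ℤ, HasEigenspaces P M σ.factor := fun σ hσ =>
    S.exists_hasEigenspaces hα Ω.length_pos hD hσ
  refine ⟨⟨?_, ?_⟩, ?_, ?_, ?_, ?_⟩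
  · rintro ⟨σ, hσ⟩
    obtain ⟨M, hM⟩ := hrule σ hσ
    exact ⟨M, σ.factor, hM, (exists_isAssociated hα hM hσ).2⟩
  · rintro ⟨M, lam, hM, hℓ⟩
    obtain ⟨M', lam', hM', hpos, hℓ'⟩ := exists_hasEigenspaces_pos hα hM hℓ
    obtain ⟨s, hs⟩ := exists_fits (Ω := Ω) hα hM'
    obtain ⟨σ, hσ⟩ := exists_rule hα hM' hpos hℓ' hs
    exact ⟨σ, hσ.1⟩
  · intro σ hσ
    obtain ⟨M, hM⟩ := hrule σ hσ
    exact ⟨M, (exists_isAssociated hα hM hσ).1⟩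
  · intro M lam s hM hlam hℓ hs
    exact exists_rule hα hM hlam hℓ hs
  · intro σ₁ σ₂ M₁ M₂ s₁ s₂ h₁ h₂ hne he
    exact hne (translation_eq hα h₁ h₂ he)
  · rintro ⟨σ, hσ⟩
    refine ⟨((S.countable_rules Ω).image (Quotient.mk _)).mono ?_, ?_⟩
    · rintro q ⟨σ, hσ, rfl⟩
      exact ⟨σ, hσ, rfl⟩
    · obtain ⟨M, hM⟩ := hrule σ hσ
      have hℓ := (exists_isAssociated hα hM hσ).2
      obtain ⟨mu, hmu, h⟩ := S.exists_eigenEqs hM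
      -- Integral translations with one fixed matrix suffice: infinitely many fit, and
      -- `translation_eq` separates their classes. Translations that do not fit receive the dummy
      -- value `σ`.
      have hex : ∀ z : Fin 2 → ℤ, ∃ ρ : SubstitutionRule, SubwindowFits P Ω M (fun i => z i) →
          IsAssociated P Ω ρ M fun i => z i := by
        intro z
        by_cases hz : SubwindowFits P Ω M fun i => z i
        · obtain ⟨ρ, hρ⟩ := exists_rule hα hM σ.factor_pos hℓ hz
          exact ⟨ρ, fun _ => hρ⟩
        · exact ⟨σ, fun h => absurd h hz⟩
      choose f hf using hex
      refine Set.infinite_of_injOn_mapsTo (f := fun z => Quotient.mk _ (f z)) ?_ ?_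
        (infinite_fits (Ω := Ω) hα h hmu)
      · intro z hz w hw he
        have h1 := translation_eq hα (hf z hz) (hf w hw) (Quotient.exact he)
        ext i
        exact_mod_cast congrFun h1 i
      · intro z hz
        exact ⟨f z, (hf z hz).1, rfl⟩
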